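/- **Setting.** Let $P_X$ be a fixed probability law on $\mathbb R$ with support $\mathcal X$. For each $n$, let $W_i=(Y_i,X_i,Z_i)$, $i\in[n]$, be i.i.d. with $Y_i\in\mathbb R$, $X_i\sim P_X$, $Z_i\in\mathbb R^{d_n}$; the conditional law of $(Y_i,Z_i)$ given $X_i=x$ (and $d_n$) may depend on $n$, and $\mathbb E[\cdot|X_i=x]$, $\mathbb V[\cdot|X_i=x]$ are computed from a fixed regular version of it. Let $\tau=\mathbb E[Y_i|X_i=0^+]-\mathbb E[Y_i|X_i=0^-]$ (one-sided limits, assumed to exist; $\tau=\tau_n$ may depend on $n$). Independently of the data, $[n]$ is split into $S\ge 1$ folds $I_1,\dots,I_S$ of equal size (up to one unit), $S$ fixed; $s(i)$ is the fold of $i$. A first-stage estimator $\widehat\eta$ maps data to functions on $\mathbb R^{d_n}$; $\widehat\eta_s$ is computed from $(W_j)_{j\notin I_s}$. Put $M_i(\eta)=Y_i-\eta(Z_i)$. For a kernel $K$, bandwidth $h=h_n>0$ and $0\le v\le p$, let $K_h(u)=K(u/h)/h$, $K_h^+(u)=K_h(u)\mathbf 1\{u\ge0\}$, $K_h^-(u)=K_h(u)\mathbf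 1\{u<0\}$, $\widetilde X_{p,i}=(1,X_i,\dots,X_i^p)^\top$, $$w^\star_{i,v,p}(h)=e_v^\top\Big(\sum_{j=1}^n K_h^\star(X_j)\widetilde X_{p,j}\widetilde X_{p,j}^\top\Big)^{-1}K_h^\star(X_i)\widetilde X_{p,i}\quad(\star\in\{+,-\}),\qquad w_{i,v,p}=w_{i,v,p}^+-w_{i,v,p}^-,$$ with $e_v$ the unit vector selecting the coefficient of $X_i^v$. Let $$\widehat\tau_{0,2}(h;\widehat\eta)=\sum_{i=1}^n w_{i,0,2}(h)M_i(\widehat\eta_{s(i)}),\qquad \widehat{\mathrm{se}}_{0,2}^2(h;\widehat\eta)=\sum_{i=1}^n w_{i,0,2}(h)^2\Big(M_i(\widehat\eta_{s(i)})-\frac1R\sum_{j\in\mathcal R_i}M_j(\widehat\eta_{s(j)})\Big)^2,$$ where $R\ge1$ is fixed and $\mathcal R_i$ is the set of the $R$ nearest neighbours of unit $i$ (other than $i$) in terms of the running variable on the same side of the cutoff $0$. For $\alpha\in(0,1)$ let $$CI^{rbc}_{1-\alpha}=\big[\widehat\tau_{0,2}(h;\widehat\eta)\pm z_\alpha\,\widehat{\mathrm{se}}_{0,2}(h;\widehat\eta)\big],$$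 with $z_\alpha$ the $1-\alpha/2$ quantile of $N(0,1)$. **Assumptions.** Write $\mathcal X_h=\mathcal X\cap[-h,h]$, and let $\mathcal E$ be the class of functions $\eta$ such that $\mathbb E[\eta(Z_i)|X_i=x]$ exists and is twice continuously differentiable in a neighbourhood of $x=0$. 1. For each $n$ there are $\mathcal T_n\subset\mathcal E$ and $\bar\eta=\bar\eta_n\in\mathcal T_n$ with $\mathbb P(\widehat\eta_s\in\mathcal T_n)\to1$ for every $s$, and there are open sets $\widetilde{\mathcal X}_h\supset\mathcal X_h$ such that $\sup_{\eta\in\mathcal T_n}\sup_{x\in A}\mathbb E[(\eta(Z_i)-\bar\eta(Z_i))^2|X_i=x]=O(r_n^2)$ for some $r_n=o(1)$, both for $A=\mathcal X_h$ and for $A=\widetilde{\mathcal X}_h\cap\mathcal X$. 2. For $j\in\{1,2,3\}$, $\partial_x^j\mathbb E[\eta(Z_i)-\bar\eta(Z_i)|X_i=x]$ exists on $\mathcal X_h\setminus\{0\}$ for all $\eta\in\mathcal T_n$ (for all large $n$) and $\sup_{\eta\in\mathcal T_n}\sup_{x\in\mathcal X_h\setminus\{0\}}|\partial_x^j\mathbb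 E[\eta(Z_i)-\bar\eta(Z_i)|X_i=x]|=O(v_{j,n})$ for some $v_{j,n}=o(1)$. 3. $P_X$ has a density that is continuous and bounded away from zero on an open neighbourhood of $0$; $K$ is a bounded symmetric probability density, continuous on its support and zero outside $[-1,1]$; $h\to0$ and $nh\to\infty$. 4. There are $C>0$, $L$ and $q>2$, not depending on $n$, such that for all $n$: $\mathbb E[M_i(\bar\eta)|X_i=x]$ is three times continuously differentiable in $x\ne0$ in the interior of $\mathcal X$, its second and third derivatives there are bounded by $C$ and $L$-Lipschitz on each side of $0$; for $x\in\mathcal X$, $\mathbb E[|M_i(\bar\eta)-\mathbb E[M_i(\bar\eta)|X_i]|^q|X_i=x]\le C$; $\mathbb E[M_i(\bar\eta)|X_i=x]$ and $\mathbb V[M_i(\bar\eta)|X_i=x]$ are $L$-Lipschitz on $\mathcal X$ on each side of $0$; and $\mathbb V[M_i(\bar\eta)|X_i=x]\ge1/C$ for $x\in\mathcal X\setminus\{0\}$. 5. There is $B$ with $\mathbb E[(M_i(\eta)-\mathbb E[M_i(\eta)|X_i])^4|X_i=x]\le B$ for all $n$, $\eta\in\mathcal T_n$, $x\in\widetilde{\mathcal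 X}_h\cap\mathcal X$. 6. For $v\in\{0,1,2\}$, $\sum_{i=1}^n w_{i,v,2}(h)^2\,\iota_i=o_P\big((nh^{1+2v})^{-1}\big)$, where $$\iota_i=\sum_{(j,l)\in\mathcal R_i^2,\;(j,l)\notin I_{s(i)}^2}\Big((\widehat\eta_{s(i)}(Z_i)-\bar\eta(Z_i))-(\widehat\eta_{s(j)}(Z_j)-\bar\eta(Z_j))\Big)\big(M_i(\bar\eta)-M_l(\bar\eta)\big).$$ **Proposition.** Under assumptions 1–6, if $nh^7=o(1)$, then $\mathbb P\big(\tau\in CI^{rbc}_{1-\alpha}\big)\ge1-\alpha+o(1)$ as $n\to\infty$. -/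

import Mathlib

open MeasureTheory ProbabilityTheory Filter Topology
open scoped ENNReal

noncomputable section

namespace FlexRD

/-! ## Local polynomial weights -/

/-- The vector `(1, x, …, x^p)`. -/
def polyVec (p : ℕ) (x : ℝ) : Fin (p + 1) → ℝ := fun k => x ^ (k : ℕ)

/-- `K_h^+(x) = K(x/h)/h · 1{x ≥ 0}`. -/
def kernelRight (K : ℝ → ℝ) (h x : ℝ) : ℝ := if 0 ≤ x then K (x / h) / h else 0

/-- `K_h^-(x) = K(x/h)/h · 1{x < 0}`. -/
def kernelLeft (K : ℝ → ℝ) (h x : ℝ) : ℝ := if x < 0 then K (x / h) / h else 0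

/-- The matrix `∑ᵢ k(xᵢ) x̃ᵢ x̃ᵢᵀ` with `x̃ᵢ = (1, xᵢ, …, xᵢ^p)`. -/
def gram {n : ℕ} (k : ℝ → ℝ) (p : ℕ) (x : Fin n → ℝ) : Matrix (Fin (p + 1)) (Fin (p + 1)) ℝ :=
  ∑ i, k (x i) • Matrix.vecMulVec (polyVec p (x i)) (polyVec p (x i))

/-- One-sided weight `e_vᵀ (∑ⱼ k(xⱼ) x̃ⱼ x̃ⱼᵀ)⁻¹ k(xᵢ) x̃ᵢ`, with entries counted from `0`. -/
def sideWeight {n : ℕ} (k : ℝ → ℝ) (p : ℕ) (v : Fin (p + 1)) (x : Fin n → ℝ) (i : Fin n) : ℝ :=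
  ((gram k p x)⁻¹.mulVec (k (x i) • polyVec p (x i))) v

/-- `w_{i,v,p}(h) = w⁺_{i,v,p}(h) - w⁻_{i,v,p}(h)`. -/
def weight {n : ℕ} (K : ℝ → ℝ) (h : ℝ) (p : ℕ) (v : Fin (p + 1)) (x : Fin n → ℝ) (i : Fin n) : ℝ :=
  sideWeight (kernelRight K h) p v x i - sideWeight (kernelLeft K h) p v x i

/-- The `p`-th order local polynomial RD estimator `∑ᵢ w_{i,v,p}(h) mᵢ` with outcomes `mᵢ`. -/
def localPoly {n : ℕ} (K : ℝ → ℝ) (h : ℝ) (p : ℕ) (v : Fin (p + 1)) (x m : Fin n → ℝ) : ℝ :=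
  ∑ i, weight K h p v x i * m i

/-! ## Nearest-neighbour standard error -/

/-- The two points lie on the same side of the cutoff `0`; the treated side is `{x ≥ 0}`. -/
def SameSide (a b : ℝ) : Prop := (0 ≤ a ↔ 0 ≤ b)

/-- Unit `k` comes before unit `j` in the order of distance to unit `i`; ties go to the smaller
index. -/
def Closer {n : ℕ} (x : Fin n → ℝ) (i k j : Fin n) : Prop :=
  |x k - x i| < |x j - x i| ∨ (|x k - x i| = |x j - x i| ∧ k < j)

open Classical in
/-- The `R` nearest neighbours of unit `i`, other than `i` itself, on its side of the cutoff (all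
of them if there are fewer than `R`). -/
def neighbors {n : ℕ} (R : ℕ) (x : Fin n → ℝ) (i : Fin n) : Finset (Fin n) :=
  Finset.univ.filter fun j => j ≠ i ∧ SameSide (x i) (x j) ∧
    (Finset.univ.filter fun k => k ≠ i ∧ SameSide (x i) (x k) ∧ Closer x i k j).card < R

/-- `σ̂ᵢ² = (mᵢ - R⁻¹ ∑_{j ∈ 𝓡ᵢ} mⱼ)²`. -/
def nnVariance {n : ℕ} (R : ℕ) (x m : Fin n → ℝ) (i : Fin n) : ℝ :=
  (m i - (1 / (R : ℝ)) * ∑ j ∈ neighbors R x i, m j) ^ 2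

/-- The standard error `(∑ᵢ w_{i,v,p}(h)² σ̂ᵢ²)^{1/2}`. -/
def stdError {n : ℕ} (K : ℝ → ℝ) (h : ℝ) (p : ℕ) (v : Fin (p + 1)) (R : ℕ) (x m : Fin n → ℝ) : ℝ :=
  Real.sqrt (∑ i, weight K h p v x i ^ 2 * nnVariance R x m i)

/-- The `u`-quantile of the standard normal distribution, for `0 < u < 1`. -/
def normalQuantile (u : ℝ) : ℝ := sInf {t : ℝ | u ≤ cdf (gaussianReal 0 1) t}

/-- The robust bias-corrected interval: the local quadratic estimate of the jump at the cutoff,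
plus or minus the `1 - α/2` normal quantile times the standard error. -/
def rbcInterval {n : ℕ} (K : ℝ → ℝ) (h : ℝ) (R : ℕ) (α : ℝ) (x m : Fin n → ℝ) : Set ℝ :=
  Set.Icc (localPoly K h 2 0 x m - normalQuantile (1 - α / 2) * stdError K h 2 0 R x m)
    (localPoly K h 2 0 x m + normalQuantile (1 - α / 2) * stdError K h 2 0 R x m)

/-! ## Data, cross-fitting -/

/-- An observation `(X, (Y, Z))`: running variable, outcome, `d` covariates. -/
abbrev Obs (d : ℕ) := ℝ × ℝ × (Fin d → ℝ)

/-- A first-stage estimator: for each set `I` of units, a map sending the data `(Wᵢ)_{i ∈ I}` to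
an adjustment function. -/
abbrev FirstStageEstimator (n d : ℕ) := (I : Finset (Fin n)) → (I → Obs d) → (Fin d → ℝ) → ℝ

/-- The units outside fold `t`, where `s i` is the fold of unit `i`. -/
def outsideFold {n S : ℕ} (s : Fin n → Fin S) (t : Fin S) : Finset (Fin n) :=
  Finset.univ.filter fun j => s j ≠ t

/-- `η̂_t`: the first-stage estimate computed from the data outside fold `t`. -/
def crossFit {n d S : ℕ} (est : FirstStageEstimator n d) (s : Fin n → Fin S) (w : Fin n → Obs d)
    (t : Fin S) : (Fin d → ℝ) → ℝ :=
  est (outsideFold s t) (fun j => w j)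

/-- The adjusted outcomes `Mᵢ(η̂_{s(i)}) = Yᵢ - η̂_{s(i)}(Zᵢ)`. -/
def crossOutcome {n d S : ℕ} (est : FirstStageEstimator n d) (s : Fin n → Fin S)
    (w : Fin n → Obs d) (i : Fin n) : ℝ :=
  (w i).2.1 - crossFit est s w (s i) (w i).2.2

/-- `M(η) = Y - η(Z)` as a function of `(Y, Z)`. -/
def adjOutcome {d : ℕ} (η : (Fin d → ℝ) → ℝ) (u : ℝ × (Fin d → ℝ)) : ℝ := u.1 - η u.2

/-- The folds have equal size, up to one unit when the sample size is not a multiple of `S`. -/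
def Balanced {n S : ℕ} (s : Fin n → Fin S) : Prop :=
  ∀ t t' : Fin S, (Finset.univ.filter fun i => s i = t).card ≤
    (Finset.univ.filter fun i => s i = t').card + 1

/-- A sampling scheme: for each `n`, the observations `W n i`, `i < n`, are i.i.d. with law
`PX ⊗ Q n` (so `X` has the law `PX` and `Q n x` is the conditional law of `(Y, Z)` given `X = x`),
and the split `s n` into `S` balanced folds is independent of the data. -/
structure IsSample {d : ℕ → ℕ} {S : ℕ} {Ω : ℕ → Type*} [∀ n, MeasurableSpace (Ω n)]
    (P : (n : ℕ) → Measure (Ω n)) (PX : Measure ℝ)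
    (Q : (n : ℕ) → Kernel ℝ (ℝ × (Fin (d n) → ℝ)))
    (W : (n : ℕ) → Fin n → Ω n → Obs (d n)) (s : (n : ℕ) → Ω n → Fin n → Fin S) : Prop where
  measurable_obs : ∀ n i, Measurable (W n i)
  law_obs : ∀ n i, (P n).map (W n i) = PX ⊗ₘ Q n
  indep_obs : ∀ n, iIndepFun (W n) (P n)
  measurable_split : ∀ n, Measurable (s n)
  indep_split : ∀ n, IndepFun (fun ω i => W n i ω) (s n) (P n)
  balanced : ∀ n ω, Balanced (s n ω)

/-- `τ = E[Y | X = 0⁺] - E[Y | X = 0⁻]`, where both one-sided limits exist. -/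
def IsRDParameter {d : ℕ} (Q : Kernel ℝ (ℝ × (Fin d → ℝ))) (τ : ℝ) : Prop :=
  ∃ a b : ℝ, Tendsto (fun x => ∫ u, u.1 ∂(Q x)) (𝓝[>] 0) (𝓝 a) ∧
    Tendsto (fun x => ∫ u, u.1 ∂(Q x)) (𝓝[<] 0) (𝓝 b) ∧ τ = a - b

/-! ## Assumptions -/

/-- `A n = o_P(1)`. -/
def IsLittleOP {Ω : ℕ → Type*} [∀ n, MeasurableSpace (Ω n)] (P : (n : ℕ) → Measure (Ω n))
    (A : (n : ℕ) → Ω n → ℝ) : Prop :=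
  ∀ ε : ℝ, 0 < ε → Tendsto (fun n => P n {ω | ε ≤ |A n ω|}) atTop (𝓝 0)

/-- The running variable has a density that is continuous and bounded away from zero on an open
neighbourhood of the cutoff. -/
def HasRunningDensity (PX : Measure ℝ) : Prop :=
  ∃ f : ℝ → ℝ, Measurable f ∧ (∀ x, 0 ≤ f x) ∧
    PX = volume.withDensity (fun x => ENNReal.ofReal (f x)) ∧
    ∃ U : Set ℝ, IsOpen U ∧ (0 : ℝ) ∈ U ∧ ContinuousOn f U ∧ ∃ c : ℝ, 0 < c ∧ ∀ x ∈ U, c ≤ f x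

/-- A bounded symmetric probability density that is continuous on its support and vanishes
outside `[-1, 1]`. -/
structure IsRDKernel (K : ℝ → ℝ) : Prop where
  measurable : Measurable K
  nonneg : ∀ u, 0 ≤ K u
  integral_eq_one : ∫ u, K u = 1
  bounded : ∃ b : ℝ, ∀ u, K u ≤ b
  symmetric : ∀ u, K (-u) = K u
  continuousOn_support : ContinuousOn K (Function.support K)
  eq_zero : ∀ u, u ∉ Set.Icc (-1 : ℝ) 1 → K u = 0

/-- Positive bandwidths with `h → 0` and `n h → ∞`. -/
structure IsBandwidth (h : ℕ → ℝ) : Prop where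
  pos : ∀ n, 0 < h n
  tendsto_zero : Tendsto h atTop (𝓝 0)
  tendsto_mul : Tendsto (fun n : ℕ => (n : ℝ) * h n) atTop atTop

/-- `𝒳_h = 𝒳 ∩ [-h, h]`, where `𝒳` is the support of the running variable. -/
def window (PX : Measure ℝ) (h : ℝ) : Set ℝ := PX.support ∩ Set.Icc (-h) h

/-- The class of admissible adjustment functions: `E[η(Z) | X = x]` exists and is twice
continuously differentiable in a neighbourhood of the cutoff. -/
def Admissible {d : ℕ} (Q : Kernel ℝ (ℝ × (Fin d → ℝ))) : Set ((Fin d → ℝ) → ℝ) :=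
  {η | Measurable η ∧ (∀ᶠ x in 𝓝 (0 : ℝ), Integrable (fun u => η u.2) (Q x)) ∧
    ContDiffAt ℝ 2 (fun x => ∫ u, η u.2 ∂(Q x)) 0}

/-- First-stage assumption: `η̄_n ∈ 𝒯_n` and `𝒯_n` consists of admissible functions; each `η̂_t`
belongs to `𝒯_n` with probability approaching one; and
`sup_{η ∈ 𝒯_n} sup_{x ∈ A_n} E[(η(Z) - η̄_n(Z))² | X = x] = O(r_n²)` with `r_n = o(1)`. -/
structure FirstStageAssumption {d : ℕ → ℕ} {S : ℕ} {Ω : ℕ → Type*} [∀ n, MeasurableSpace (Ω n)]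
    (P : (n : ℕ) → Measure (Ω n)) (Q : (n : ℕ) → Kernel ℝ (ℝ × (Fin (d n) → ℝ)))
    (W : (n : ℕ) → Fin n → Ω n → Obs (d n)) (s : (n : ℕ) → Ω n → Fin n → Fin S)
    (est : (n : ℕ) → FirstStageEstimator n (d n))
    (T : (n : ℕ) → Set ((Fin (d n) → ℝ) → ℝ)) (ηbar : (n : ℕ) → (Fin (d n) → ℝ) → ℝ)
    (A : ℕ → Set ℝ) (r : ℕ → ℝ) : Prop where
  admissible : ∀ n, T n ⊆ Admissible (Q n)
  mem : ∀ n, ηbar n ∈ T n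
  estimator_mem : ∀ t : Fin S,
    Tendsto (fun n => P n {ω | crossFit (est n) (s n ω) (fun i => W n i ω) t ∉ T n}) atTop (𝓝 0)
  rate_tendsto : Tendsto r atTop (𝓝 0)
  contraction : ∃ c : ℝ, ∀ᶠ n in atTop, ∀ η ∈ T n, ∀ x ∈ A n,
    ∫⁻ u, ENNReal.ofReal ((η u.2 - ηbar n u.2) ^ 2) ∂(Q n x) ≤ ENNReal.ofReal (c * r n ^ 2)

/-- Derivative assumption up to order `q`: for `1 ≤ j ≤ q`, the `j`-th derivative of
`x ↦ E[η(Z) - η̄_n(Z) | X = x]` exists on `A_n \ {0}` and is `O(v_{j,n})` uniformly in `x` and in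
`η ∈ 𝒯_n`, with `v_{j,n} = o(1)`. -/
def DerivativeAssumption {d : ℕ → ℕ} (Q : (n : ℕ) → Kernel ℝ (ℝ × (Fin (d n) → ℝ)))
    (T : (n : ℕ) → Set ((Fin (d n) → ℝ) → ℝ)) (ηbar : (n : ℕ) → (Fin (d n) → ℝ) → ℝ)
    (A : ℕ → Set ℝ) (q : ℕ) (v : ℕ → ℕ → ℝ) : Prop :=
  ∀ j, j < q → Tendsto (v (j + 1)) atTop (𝓝 0) ∧
    ∃ c : ℝ, ∀ᶠ n in atTop, ∀ η ∈ T n, ∀ x ∈ A n \ {0},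
      DifferentiableAt ℝ (iteratedDeriv j fun y => ∫ u, (η u.2 - ηbar n u.2) ∂(Q n y)) x ∧
      |iteratedDeriv (j + 1) (fun y => ∫ u, (η u.2 - ηbar n u.2) ∂(Q n y)) x| ≤ c * |v (j + 1) n|

/-- `g` is `L`-Lipschitz on `A ∩ (0, ∞)` and on `A ∩ (-∞, 0)`; it may jump at the cutoff. -/
def SidewiseLipschitz (L : ℝ) (g : ℝ → ℝ) (A : Set ℝ) : Prop :=
  ∀ x ∈ A, ∀ y ∈ A, 0 < x * y → |g x - g y| ≤ L * |x - y|

/-- Outcome regularity for local polynomials of order `p ≥ 1`, with constants `C`, `L` and a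
moment order `q > 2` that do not depend on `n`: the conditional mean of `M(η̄_n)` given `X = x` is
`p + 1` times continuously differentiable away from the cutoff, and it, its second and its
`(p+1)`-th derivative are `L`-Lipschitz on each side, both derivatives being bounded by `C`; the
`q`-th conditional central moment is bounded by `C`; the conditional variance is `L`-Lipschitz on
each side and at least `1 / C`. Derivatives are taken in the interior of the support. -/
def OutcomeAssumption {d : ℕ → ℕ} (PX : Measure ℝ)
    (Q : (n : ℕ) → Kernel ℝ (ℝ × (Fin (d n) → ℝ)))
    (ηbar : (n : ℕ) → (Fin (d n) → ℝ) → ℝ) (p : ℕ) : Prop :=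
  ∃ C L q : ℝ, 0 < C ∧ 2 < q ∧ ∀ n,
    (∀ x ∈ PX.support, Integrable (adjOutcome (ηbar n)) (Q n x) ∧
      ∫⁻ u, ENNReal.ofReal (|adjOutcome (ηbar n) u - ∫ u', adjOutcome (ηbar n) u' ∂(Q n x)| ^ q)
        ∂(Q n x) ≤ ENNReal.ofReal C) ∧
    ContDiffOn ℝ (p + 1) (fun x => ∫ u, adjOutcome (ηbar n) u ∂(Q n x))
      (interior PX.support \ {0}) ∧
    (∀ k ∈ ({2, p + 1} : Set ℕ),
      (∀ x ∈ interior PX.support \ {0},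
        |iteratedDeriv k (fun x => ∫ u, adjOutcome (ηbar n) u ∂(Q n x)) x| ≤ C) ∧
      SidewiseLipschitz L (iteratedDeriv k fun x => ∫ u, adjOutcome (ηbar n) u ∂(Q n x))
        (interior PX.support)) ∧
    SidewiseLipschitz L (fun x => ∫ u, adjOutcome (ηbar n) u ∂(Q n x)) PX.support ∧
    SidewiseLipschitz L (fun x => variance (adjOutcome (ηbar n)) (Q n x)) PX.support ∧
    ∀ x ∈ PX.support \ {0}, 1 / C ≤ variance (adjOutcome (ηbar n)) (Q n x)

/-- The fourth conditional central moments of `M(η)` given `X = x` are bounded uniformly in `n`,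
`η ∈ 𝒯_n` and `x ∈ A_n`. -/
def FourthMomentAssumption {d : ℕ → ℕ} (Q : (n : ℕ) → Kernel ℝ (ℝ × (Fin (d n) → ℝ)))
    (T : (n : ℕ) → Set ((Fin (d n) → ℝ) → ℝ)) (A : ℕ → Set ℝ) : Prop :=
  ∃ B : ℝ, ∀ n, ∀ η ∈ T n, ∀ x ∈ A n, Integrable (adjOutcome η) (Q n x) ∧
    ∫⁻ u, ENNReal.ofReal ((adjOutcome η u - ∫ u', adjOutcome η u' ∂(Q n x)) ^ 4) ∂(Q n x)
      ≤ ENNReal.ofReal B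

open Classical in
/-- `ιᵢ(η̂)`: the sum over pairs `(j, l)` of neighbours of `i`, not both in the fold of `i`, of
`((η̂_{s(i)}(Zᵢ) - η̄(Zᵢ)) - (η̂_{s(j)}(Zⱼ) - η̄(Zⱼ))) (Mᵢ(η̄) - M_l(η̄))`. -/
def crossTerm {n d S : ℕ} (R : ℕ) (est : FirstStageEstimator n d) (ηbar : (Fin d → ℝ) → ℝ)
    (s : Fin n → Fin S) (w : Fin n → Obs d) (i : Fin n) : ℝ :=
  ∑ jl ∈ (neighbors R (fun k => (w k).1) i ×ˢ neighbors R (fun k => (w k).1) i).filter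
      (fun jl => ¬ (s jl.1 = s i ∧ s jl.2 = s i)),
    ((crossFit est s w (s i) (w i).2.2 - ηbar (w i).2.2)
      - (crossFit est s w (s jl.1) (w jl.1).2.2 - ηbar (w jl.1).2.2)) *
    (adjOutcome ηbar (w i).2 - adjOutcome ηbar (w jl.2).2)

/-- `∑ᵢ w_{i,v,p}(h)² ιᵢ(η̂) = o_P((n h^{1+2v})⁻¹)` for `0 ≤ v ≤ p`. -/
def CrossTermAssumption {d : ℕ → ℕ} {S : ℕ} {Ω : ℕ → Type*} [∀ n, MeasurableSpace (Ω n)]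
    (P : (n : ℕ) → Measure (Ω n)) (W : (n : ℕ) → Fin n → Ω n → Obs (d n))
    (s : (n : ℕ) → Ω n → Fin n → Fin S) (est : (n : ℕ) → FirstStageEstimator n (d n))
    (ηbar : (n : ℕ) → (Fin (d n) → ℝ) → ℝ) (K : ℝ → ℝ) (h : ℕ → ℝ) (R p : ℕ) : Prop :=
  ∀ v : Fin (p + 1), IsLittleOP P fun n ω =>
    (n : ℝ) * h n ^ (1 + 2 * (v : ℕ)) *
      ∑ i, weight K (h n) p v (fun k => (W n k ω).1) i ^ 2 *
        crossTerm R (est n) (ηbar n) (s n ω) (fun k => W n k ω) i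

end FlexRD

end

/-! Coverage is only bounded from below, so two facts suffice off an event of small probability: the
estimation error equals the oracle noise up to a negligible term, and the standard error is not much
too small. The scale is (nh)^{-1/2}. For a good design the weights are O(1/(nh)), only O(nh) of them
are non-zero, and by Cauchy–Schwarz the conditional variance `designVar` of the oracle noise is at
least of order 1/(nh).

In the window, the outcome is the conditional mean of M(η̄), plus a residual, minus the first-stage
error η̂ - η̄. A local quadratic fit reproduces quadratics, so the conditional mean gives a bias
O(h³), negligible because √(nh) h³ = √(n h⁷) → 0. Given the running variables and the data outside a
fold, the first-stage estimate of that fold is a fixed function. Its error, centred at the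
conditional mean given X, has a weighted fold sum with variance O(r²/(nh)). The conditional mean
itself is C² through the cutoff, hence close to the same quadratic polynomial on both sides, with
coefficients o(1) and remainder o(h³). Weighted sums of quadratics cancel between the two sides over
the whole sample, though not over one fold. Over a fold only the centred fold indicator contributes,
which costs O_P((nh)^{-1/2}) times the o(1) coefficients (`GoodDesign.abs_sum_fold_mul_le`).

For the standard error, all but at most 2R units of the window have their R neighbours inside the
window. For these, Young's inequality separates the noise from the smooth part and from the
first-stage errors, which then enter only through their squares (`le_sum_weight_sq_mul_nnVariance`).
What remains is the weighted sum of squared residuals, close to `designVar` by Chebyshev with fourth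
moments, and an off-diagonal quadratic form, small by Chebyshev with second moments.

The standardized oracle noise is asymptotically normal: given a good design its characteristic
function is close to the Gaussian one, with an error of order (nh)^{-1/2}, and Lévy's theorem
together with the portmanteau theorem gives the tail bound (`eventually_measure_stdNoise_le`).

All deviation bounds are conditional, on the design, the split and the data outside a fold, and are
uniform enough to be integrated (`measure_fold_le`, `IsSample.measure_le`). They are collected in
`GoodEvent`, with a fixed small threshold δ for the vanishing terms and a large constant D for the
fold moments, which are only tight. On that event a miss of the parameter forces the standardized
noise beyond a slightly reduced quantile, and continuity of the Gaussian tail finishes the proof. -/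

noncomputable section

namespace FlexRD

/-! ## Local quadratic weights in rescaled form -/

/-- `n⁻¹ ∑ᵢ bᵢ φ(xᵢ/h)/h (xᵢ/h)^k`. -/
def wMoment {n : ℕ} (b : Fin n → ℝ) (φ : ℝ → ℝ) (h : ℝ) (k : ℕ) (x : Fin n → ℝ) : ℝ :=
  (1 / (n : ℝ)) * ∑ i, b i * (φ (x i / h) / h * (x i / h) ^ k)

/-- The Gram matrix of the rescaled design. -/
def scaledGram {n : ℕ} (φ : ℝ → ℝ) (h : ℝ) (x : Fin n → ℝ) : Matrix (Fin 3) (Fin 3) ℝ :=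
  Matrix.of fun a b => wMoment 1 φ h ((a : ℕ) + b) x

/-- Substituting u = x / h factors the powers of h out of the design, so that the matrix left to
invert has entries of order one. -/
lemma gram_eq_scaledGram {n : ℕ} (hn : 0 < n) (φ : ℝ → ℝ) {h : ℝ} (hh : 0 < h) (x : Fin n → ℝ) :
    gram (fun y => φ (y / h) / h) 2 x =
      (n : ℝ) • (Matrix.diagonal (fun a : Fin 3 => h ^ (a : ℕ)) * scaledGram φ h x *
        Matrix.diagonal (fun a : Fin 3 => h ^ (a : ℕ))) := by
  have hn' : (n : ℝ) ≠ 0 := by positivity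
  ext a b
  simp only [gram, Matrix.sum_apply, Matrix.smul_apply, Matrix.vecMulVec_apply, polyVec,
    Matrix.mul_diagonal, Matrix.diagonal_mul, scaledGram, wMoment, Matrix.of_apply, smul_eq_mul,
    Pi.one_apply, one_mul]
  rw [Finset.mul_sum, Finset.mul_sum, Finset.sum_mul, Finset.mul_sum]
  refine Finset.sum_congr rfl fun i _ => ?_
  rw [div_pow, pow_add, pow_add]
  field_simp

/-- Inverting n D Γ D gives n⁻¹ D⁻¹ Γ⁻¹ D⁻¹. The left factor is invisible in row 0, and the right
one turns the powers of x into powers of x / h. -/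
lemma sideWeight_eq {n : ℕ} (hn : 0 < n) (φ : ℝ → ℝ) {h : ℝ} (hh : 0 < h) (x : Fin n → ℝ)
    (hdet : (scaledGram φ h x).det ≠ 0) (i : Fin n) :
    sideWeight (fun y => φ (y / h) / h) 2 0 x i =
      (1 / (n : ℝ)) * ∑ b : Fin 3, (scaledGram φ h x)⁻¹ 0 b *
        (φ (x i / h) / h * (x i / h) ^ (b : ℕ)) := by
  have hn' : (n : ℝ) ≠ 0 := by positivity
  set Γ := scaledGram φ h x with hΓ
  have hinv : (gram (fun y => φ (y / h) / h) 2 x)⁻¹ =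
      (1 / (n : ℝ)) • (Matrix.diagonal (fun a : Fin 3 => (h ^ (a : ℕ))⁻¹) * Γ⁻¹ *
        Matrix.diagonal (fun a : Fin 3 => (h ^ (a : ℕ))⁻¹)) := by
    apply Matrix.inv_eq_right_inv
    have hD : Matrix.diagonal (fun a : Fin 3 => h ^ (a : ℕ)) *
        Matrix.diagonal (fun a : Fin 3 => (h ^ (a : ℕ))⁻¹) = 1 := by
      rw [Matrix.diagonal_mul_diagonal, ← Matrix.diagonal_one]
      congr 1; ext a; exact mul_inv_cancel₀ (by positivity)
    have hG : Γ * Γ⁻¹ = 1 := Matrix.mul_nonsing_inv _ (isUnit_iff_ne_zero.mpr hdet)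
    rw [gram_eq_scaledGram hn φ hh x, ← hΓ, Matrix.smul_mul, Matrix.mul_smul, smul_smul,
      mul_one_div_cancel hn', one_smul]
    generalize Matrix.diagonal (fun a : Fin 3 => h ^ (a : ℕ)) = D at *
    generalize Matrix.diagonal (fun a : Fin 3 => (h ^ (a : ℕ))⁻¹) = E at *
    calc D * Γ * D * (E * Γ⁻¹ * E) = D * (Γ * (D * E) * Γ⁻¹) * E := by
          simp only [Matrix.mul_assoc]
      _ = 1 := by rw [hD, Matrix.mul_one, hG, Matrix.mul_one, hD]
  rw [sideWeight, hinv, Matrix.smul_mulVec, Pi.smul_apply, smul_eq_mul]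
  congr 1
  rw [Matrix.mulVec, dotProduct]
  refine Finset.sum_congr rfl fun b _ => ?_
  rw [Matrix.mul_diagonal, Matrix.diagonal_mul, Pi.smul_apply, smul_eq_mul, polyVec, div_pow]
  have : h ^ (b : ℕ) ≠ 0 := by positivity
  simp only [Fin.val_zero, pow_zero, inv_one, one_mul]
  field_simp

/-- Weighted sums of powers against the weights, in terms of rescaled moments. -/
lemma sum_mul_sideWeight_mul_pow {n : ℕ} (hn : 0 < n) (φ : ℝ → ℝ) {h : ℝ} (hh : 0 < h)
    (x : Fin n → ℝ) (hdet : (scaledGram φ h x).det ≠ 0) (b : Fin n → ℝ) (k : ℕ) :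
    ∑ i, b i * sideWeight (fun y => φ (y / h) / h) 2 0 x i * x i ^ k =
      h ^ k * ∑ a : Fin 3, (scaledGram φ h x)⁻¹ 0 a * wMoment b φ h ((a : ℕ) + k) x := by
  simp only [sideWeight_eq hn φ hh x hdet, wMoment, Finset.mul_sum, Finset.sum_mul]
  rw [Finset.sum_comm]
  refine Finset.sum_congr rfl fun a _ => Finset.sum_congr rfl fun i _ => ?_
  rw [pow_add, div_pow, div_pow]
  have : h ^ k ≠ 0 := by positivity
  field_simp

/-- The moment of order a + k is the entry (a, k) of Γ, so the sums form row 0 of Γ⁻¹ Γ. The factor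
h ^ k is immaterial, since the entry vanishes unless k = 0. -/
lemma sum_sideWeight_mul_pow {n : ℕ} (hn : 0 < n) (φ : ℝ → ℝ) {h : ℝ} (hh : 0 < h)
    (x : Fin n → ℝ) (hdet : (scaledGram φ h x).det ≠ 0) (k : Fin 3) :
    ∑ i, sideWeight (fun y => φ (y / h) / h) 2 0 x i * x i ^ (k : ℕ) = if k = 0 then 1 else 0 := by
  have h1 := sum_mul_sideWeight_mul_pow hn φ hh x hdet 1 k
  simp only [Pi.one_apply, one_mul] at h1
  rw [h1]
  have h2 : (∑ a : Fin 3, (scaledGram φ h x)⁻¹ 0 a * wMoment 1 φ h ((a : ℕ) + k) x) =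
      ((scaledGram φ h x)⁻¹ * scaledGram φ h x) 0 k := by
    rw [Matrix.mul_apply]; rfl
  rw [h2, Matrix.nonsing_inv_mul _ (isUnit_iff_ne_zero.mpr hdet), Matrix.one_apply]
  by_cases hk : k = 0
  · subst hk; simp
  · simp [hk, Ne.symm hk]

/-- Meant for coefficients b with small moments, namely centred fold indicators. The factor 3 counts
the columns of Γ⁻¹. -/
lemma abs_sum_mul_sideWeight_mul_pow_le {n : ℕ} (hn : 0 < n) (φ : ℝ → ℝ) {h : ℝ} (hh : 0 < h)
    (x : Fin n → ℝ) (hdet : (scaledGram φ h x).det ≠ 0) {A δ : ℝ}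
    (hA : ∀ a, |(scaledGram φ h x)⁻¹ 0 a| ≤ A) (b : Fin n → ℝ) (k : ℕ)
    (hb : ∀ a : Fin 3, |wMoment b φ h ((a : ℕ) + k) x| ≤ δ) :
    |∑ i, b i * sideWeight (fun y => φ (y / h) / h) 2 0 x i * x i ^ k| ≤ h ^ k * (3 * A * δ) := by
  rw [sum_mul_sideWeight_mul_pow hn φ hh x hdet, abs_mul, abs_of_pos (by positivity : 0 < h ^ k)]
  have hA0 : 0 ≤ A := (abs_nonneg _).trans (hA 0)
  gcongr
  calc _ ≤ ∑ a : Fin 3, |(scaledGram φ h x)⁻¹ 0 a * wMoment b φ h ((a : ℕ) + k) x| :=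
        Finset.abs_sum_le_sum_abs _ _
    _ ≤ ∑ _a : Fin 3, A * δ := by
        refine Finset.sum_le_sum fun a _ => ?_
        rw [abs_mul]
        exact mul_le_mul (hA a) (hb a) (abs_nonneg _) hA0
    _ = 3 * A * δ := by simp; ring

lemma sideWeight_eq_zero {n : ℕ} (k : ℝ → ℝ) (p : ℕ) (v : Fin (p + 1)) (x : Fin n → ℝ) (i : Fin n)
    (hk : k (x i) = 0) : sideWeight k p v x i = 0 := by
  simp [sideWeight, hk]

lemma abs_sideWeight_le {n : ℕ} (hn : 0 < n) {φ : ℝ → ℝ} {h : ℝ} (hh : 0 < h) (x : Fin n → ℝ)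
    (hdet : (scaledGram φ h x).det ≠ 0) {A B : ℝ} (hA : ∀ a, |(scaledGram φ h x)⁻¹ 0 a| ≤ A)
    (hB : ∀ u, |φ u| ≤ B) (hφ : ∀ u, 1 < |u| → φ u = 0) (i : Fin n) :
    |sideWeight (fun y => φ (y / h) / h) 2 0 x i| ≤ 3 * A * B / (n * h) := by
  have hA0 : 0 ≤ A := (abs_nonneg _).trans (hA 0)
  have hB0 : 0 ≤ B := (abs_nonneg _).trans (hB 0)
  by_cases hx : 1 < |x i / h|
  · rw [sideWeight_eq_zero _ _ _ _ _ (by simp [hφ _ hx]), abs_zero]; positivity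
  rw [sideWeight_eq hn φ hh x hdet, abs_mul, abs_of_pos (by positivity : 0 < 1 / (n : ℝ))]
  have : |∑ b : Fin 3, (scaledGram φ h x)⁻¹ 0 b * (φ (x i / h) / h * (x i / h) ^ (b : ℕ))| ≤
      3 * A * B / h := by
    calc _ ≤ ∑ b : Fin 3, |(scaledGram φ h x)⁻¹ 0 b * (φ (x i / h) / h * (x i / h) ^ (b : ℕ))| :=
          Finset.abs_sum_le_sum_abs _ _
      _ ≤ ∑ _b : Fin 3, A * (B / h * 1) := by
          refine Finset.sum_le_sum fun b _ => ?_
          rw [abs_mul, abs_mul, abs_div, abs_of_pos hh, abs_pow]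
          gcongr
          · exact hA b
          · exact hB _
          · exact pow_le_one₀ (abs_nonneg _) (not_lt.mp hx)
      _ = 3 * A * B / h := by simp; ring
  calc _ ≤ 1 / (n : ℝ) * (3 * A * B / h) := by gcongr
    _ = _ := by field_simp

/-- `K · 1{u ≥ 0}`. -/
def rightPart (K : ℝ → ℝ) (u : ℝ) : ℝ := if 0 ≤ u then K u else 0

/-- `K · 1{u < 0}`. -/
def leftPart (K : ℝ → ℝ) (u : ℝ) : ℝ := if u < 0 then K u else 0

lemma kernelRight_eq (K : ℝ → ℝ) {h : ℝ} (hh : 0 < h) :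
    kernelRight K h = fun y => rightPart K (y / h) / h := by
  ext y
  have : 0 ≤ y / h ↔ 0 ≤ y := by rw [le_div_iff₀ hh, zero_mul]
  simp only [kernelRight, rightPart, this]
  split_ifs <;> simp

lemma kernelLeft_eq (K : ℝ → ℝ) {h : ℝ} (hh : 0 < h) :
    kernelLeft K h = fun y => leftPart K (y / h) / h := by
  ext y
  have : y / h < 0 ↔ y < 0 := by rw [div_lt_iff₀ hh, zero_mul]
  simp only [kernelLeft, leftPart, this]
  split_ifs <;> simp

/-! ## Well-behaved designs -/

/-- The indices of the observations in the estimation window. -/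
def windowUnits {n : ℕ} (h : ℝ) (x : Fin n → ℝ) : Finset (Fin n) :=
  Finset.univ.filter fun i => |x i| ≤ h

/-- A realization of the running variable for which both rescaled Gram matrices are well
conditioned and the number of units in the window is of order at most `n h`. -/
structure GoodDesign {n : ℕ} (K : ℝ → ℝ) (h A : ℝ) (x : Fin n → ℝ) : Prop where
  det_right : (scaledGram (rightPart K) h x).det ≠ 0
  det_left : (scaledGram (leftPart K) h x).det ≠ 0
  inv_right : ∀ a, |(scaledGram (rightPart K) h x)⁻¹ 0 a| ≤ A
  inv_left : ∀ a, |(scaledGram (leftPart K) h x)⁻¹ 0 a| ≤ A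
  card_le : ((windowUnits h x).card : ℝ) ≤ A * (n * h)
  ne_zero : ∀ i, x i ≠ 0

lemma IsRDKernel.abs_le {K : ℝ → ℝ} (hK : IsRDKernel K) {b : ℝ} (hb : ∀ u, K u ≤ b) (u : ℝ) :
    |K u| ≤ b := by
  rw [abs_of_nonneg (hK.nonneg u)]; exact hb u

lemma IsRDKernel.eq_zero_of_one_lt {K : ℝ → ℝ} (hK : IsRDKernel K) {u : ℝ} (hu : 1 < |u|) :
    K u = 0 :=
  hK.eq_zero u fun h => absurd (_root_.abs_le.mpr h) (not_le.mpr hu)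

lemma abs_rightPart_le {K : ℝ → ℝ} {b : ℝ} (hb : ∀ u, |K u| ≤ b) (u : ℝ) :
    |rightPart K u| ≤ b := by
  unfold rightPart
  split_ifs
  · exact hb u
  · simpa using (abs_nonneg _).trans (hb u)

lemma abs_leftPart_le {K : ℝ → ℝ} {b : ℝ} (hb : ∀ u, |K u| ≤ b) (u : ℝ) :
    |leftPart K u| ≤ b := by
  unfold leftPart
  split_ifs
  · exact hb u
  · simpa using (abs_nonneg _).trans (hb u)

lemma IsRDKernel.rightPart_eq_zero {K : ℝ → ℝ} (hK : IsRDKernel K) {u : ℝ} (hu : 1 < |u|) :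
    rightPart K u = 0 := by
  simp [rightPart, hK.eq_zero_of_one_lt hu]

lemma IsRDKernel.leftPart_eq_zero {K : ℝ → ℝ} (hK : IsRDKernel K) {u : ℝ} (hu : 1 < |u|) :
    leftPart K u = 0 := by
  simp [leftPart, hK.eq_zero_of_one_lt hu]

/-! ### Where the one-sided weights vanish -/

section SideWeights

variable {n : ℕ} {K : ℝ → ℝ} {h : ℝ} (x : Fin n → ℝ) (i : Fin n)

lemma rightWeight_eq_zero_of_neg (hx : x i < 0) : sideWeight (kernelRight K h) 2 0 x i = 0 :=
  sideWeight_eq_zero _ _ _ _ _ (by simp [kernelRight, hx])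

lemma leftWeight_eq_zero_of_nonneg (hx : 0 ≤ x i) : sideWeight (kernelLeft K h) 2 0 x i = 0 :=
  sideWeight_eq_zero _ _ _ _ _ (by simp [kernelLeft, not_lt.mpr hx])

lemma rightWeight_eq_zero_of_lt (hK : IsRDKernel K) (hh : 0 < h) (hx : h < |x i|) :
    sideWeight (kernelRight K h) 2 0 x i = 0 := by
  apply sideWeight_eq_zero
  have : 1 < |x i / h| := by rwa [abs_div, abs_of_pos hh, one_lt_div hh]
  simp [kernelRight, hK.eq_zero_of_one_lt this]

lemma leftWeight_eq_zero_of_lt (hK : IsRDKernel K) (hh : 0 < h) (hx : h < |x i|) :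
    sideWeight (kernelLeft K h) 2 0 x i = 0 := by
  apply sideWeight_eq_zero
  have : 1 < |x i / h| := by rwa [abs_div, abs_of_pos hh, one_lt_div hh]
  simp [kernelLeft, hK.eq_zero_of_one_lt this]

lemma weight_eq_zero_of_lt (hK : IsRDKernel K) (hh : 0 < h) (hx : h < |x i|) :
    weight K h 2 0 x i = 0 := by
  rw [weight, rightWeight_eq_zero_of_lt x i hK hh hx, leftWeight_eq_zero_of_lt x i hK hh hx,
    sub_zero]

lemma weight_of_nonneg (hx : 0 ≤ x i) :
    weight K h 2 0 x i = sideWeight (kernelRight K h) 2 0 x i := by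
  rw [weight, leftWeight_eq_zero_of_nonneg x i hx, sub_zero]

lemma weight_of_neg (hx : x i < 0) :
    weight K h 2 0 x i = -sideWeight (kernelLeft K h) 2 0 x i := by
  rw [weight, rightWeight_eq_zero_of_neg x i hx, zero_sub]

end SideWeights

/-! ### Size of the weights for a good design -/

namespace GoodDesign

variable {n : ℕ} {K : ℝ → ℝ} {h A b : ℝ} {x : Fin n → ℝ}

lemma sum_rightWeight_mul_pow (hx : GoodDesign K h A x) (hn : 0 < n) (hh : 0 < h) (k : Fin 3) :
    ∑ i, sideWeight (kernelRight K h) 2 0 x i * x i ^ (k : ℕ) = if k = 0 then 1 else 0 := by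
  rw [kernelRight_eq K hh]
  exact sum_sideWeight_mul_pow hn _ hh x hx.det_right k

lemma sum_leftWeight_mul_pow (hx : GoodDesign K h A x) (hn : 0 < n) (hh : 0 < h) (k : Fin 3) :
    ∑ i, sideWeight (kernelLeft K h) 2 0 x i * x i ^ (k : ℕ) = if k = 0 then 1 else 0 := by
  rw [kernelLeft_eq K hh]
  exact sum_sideWeight_mul_pow hn _ hh x hx.det_left k

lemma abs_rightWeight_le (hx : GoodDesign K h A x) (hK : IsRDKernel K) (hb : ∀ u, K u ≤ b)
    (hn : 0 < n) (hh : 0 < h) (i : Fin n) :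
    |sideWeight (kernelRight K h) 2 0 x i| ≤ 3 * A * b / (n * h) := by
  rw [kernelRight_eq K hh]
  exact abs_sideWeight_le hn hh x hx.det_right hx.inv_right
    (abs_rightPart_le (hK.abs_le hb)) (fun u hu => hK.rightPart_eq_zero hu) i

lemma abs_leftWeight_le (hx : GoodDesign K h A x) (hK : IsRDKernel K) (hb : ∀ u, K u ≤ b)
    (hn : 0 < n) (hh : 0 < h) (i : Fin n) :
    |sideWeight (kernelLeft K h) 2 0 x i| ≤ 3 * A * b / (n * h) := by
  rw [kernelLeft_eq K hh]
  exact abs_sideWeight_le hn hh x hx.det_left hx.inv_left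
    (abs_leftPart_le (hK.abs_le hb)) (fun u hu => hK.leftPart_eq_zero hu) i

lemma abs_weight_le (hx : GoodDesign K h A x) (hK : IsRDKernel K) (hb : ∀ u, K u ≤ b)
    (hn : 0 < n) (hh : 0 < h) (i : Fin n) :
    |weight K h 2 0 x i| ≤ 3 * A * b / (n * h) := by
  rcases le_or_gt 0 (x i) with h0 | h0
  · rw [weight_of_nonneg x i h0]; exact hx.abs_rightWeight_le hK hb hn hh i
  · rw [weight_of_neg x i h0, abs_neg]; exact hx.abs_leftWeight_le hK hb hn hh i

/-- Sums over the window are at most `A n h` times the largest term. -/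
lemma sum_le (hx : GoodDesign K h A x) {f : Fin n → ℝ} {M : ℝ} (hM : 0 ≤ M)
    (h0 : ∀ i, h < |x i| → f i = 0) (hf : ∀ i, f i ≤ M) : ∑ i, f i ≤ A * (n * h) * M := by
  calc ∑ i, f i = ∑ i ∈ windowUnits h x, f i := by
        symm; apply Finset.sum_subset (Finset.subset_univ _)
        intro i _ hi; apply h0; simpa [windowUnits] using hi
    _ ≤ ∑ _i ∈ windowUnits h x, M := Finset.sum_le_sum fun i _ => hf i
    _ = (windowUnits h x).card * M := by simp
    _ ≤ _ := by have := hx.card_le; gcongr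

lemma sum_abs_weight_pow_le (hx : GoodDesign K h A x) (hK : IsRDKernel K) (hb : ∀ u, K u ≤ b)
    (hn : 0 < n) (hh : 0 < h) {k : ℕ} (hk : k ≠ 0) :
    ∑ i, |weight K h 2 0 x i| ^ k ≤ A * (n * h) * (3 * A * b / (n * h)) ^ k := by
  apply hx.sum_le
  · exact pow_nonneg ((abs_nonneg _).trans (hx.abs_weight_le hK hb hn hh ⟨0, hn⟩)) k
  · intro i hi; rw [weight_eq_zero_of_lt x i hK hh hi, abs_zero, zero_pow hk]
  · intro i; exact pow_le_pow_left₀ (abs_nonneg _) (hx.abs_weight_le hK hb hn hh i) k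

lemma sum_rightWeight (hx : GoodDesign K h A x) (hn : 0 < n) (hh : 0 < h) :
    ∑ i, sideWeight (kernelRight K h) 2 0 x i = 1 := by
  simpa using hx.sum_rightWeight_mul_pow hn hh 0

/-- Cauchy–Schwarz: the right weights sum to one over at most A n h units. This is what keeps the
conditional variance at least of order 1/(nh). -/
lemma one_le_mul_sum_weight_sq (hx : GoodDesign K h A x) (hK : IsRDKernel K) (hn : 0 < n)
    (hh : 0 < h) : 1 ≤ A * (n * h) * ∑ i, weight K h 2 0 x i ^ 2 := by
  have h1 : ∑ i ∈ windowUnits h x, sideWeight (kernelRight K h) 2 0 x i = 1 := by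
    rw [← hx.sum_rightWeight hn hh]
    apply Finset.sum_subset (Finset.subset_univ _)
    intro i _ hi; apply rightWeight_eq_zero_of_lt x i hK hh; simpa [windowUnits] using hi
  have h2 := sq_sum_le_card_mul_sum_sq (s := windowUnits h x)
    (f := fun i => sideWeight (kernelRight K h) 2 0 x i)
  rw [h1, one_pow] at h2
  have h3 : ∑ i ∈ windowUnits h x, sideWeight (kernelRight K h) 2 0 x i ^ 2 ≤
      ∑ i, weight K h 2 0 x i ^ 2 := by
    refine (Finset.sum_le_univ_sum_of_nonneg fun i => sq_nonneg _).trans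
      (Finset.sum_le_sum fun i _ => ?_)
    rcases le_or_gt 0 (x i) with h0 | h0
    · rw [weight_of_nonneg x i h0]
    · rw [rightWeight_eq_zero_of_neg x i h0]; simpa using sq_nonneg (weight K h 2 0 x i)
  refine h2.trans ?_
  have h4 := hx.card_le
  have h5 : 0 ≤ A * (n * h) := (Nat.cast_nonneg _).trans h4
  gcongr

/-- A local quadratic fit reproduces quadratic polynomials, so it recovers `P(0)` for a function
within `M` of a quadratic polynomial `P` on the right of the cutoff. -/
lemma abs_sum_rightWeight_mul_sub_le (hx : GoodDesign K h A x) (hK : IsRDKernel K)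
    (hb : ∀ u, K u ≤ b) (hn : 0 < n) (hh : 0 < h) {g : ℝ → ℝ} {c₀ c₁ c₂ M : ℝ} (hM : 0 ≤ M)
    (hg : ∀ y, 0 < y → y ≤ h → |g y - (c₀ + c₁ * y + c₂ * y ^ 2)| ≤ M) :
    |∑ i, sideWeight (kernelRight K h) 2 0 x i * g (x i) - c₀| ≤ 3 * A ^ 2 * b * M := by
  set w := fun i => sideWeight (kernelRight K h) 2 0 x i with hw
  have hP : ∑ i, w i * (c₀ + c₁ * x i + c₂ * x i ^ 2) = c₀ := by
    have h0 := hx.sum_rightWeight_mul_pow hn hh 0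
    have h1 := hx.sum_rightWeight_mul_pow hn hh 1
    have h2 := hx.sum_rightWeight_mul_pow hn hh 2
    simp at h0 h1 h2
    have : ∀ i, w i * (c₀ + c₁ * x i + c₂ * x i ^ 2) =
        c₀ * w i + c₁ * (w i * x i) + c₂ * (w i * x i ^ 2) := fun i => by ring
    simp_rw [this, Finset.sum_add_distrib, ← Finset.mul_sum]
    simp only [hw, h0, h1, h2]; ring
  have h1 : ∑ i, w i * g (x i) - c₀ = ∑ i, w i * (g (x i) - (c₀ + c₁ * x i + c₂ * x i ^ 2)) := by
    simp_rw [mul_sub, Finset.sum_sub_distrib]; rw [hP]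
  rw [h1]
  refine (Finset.abs_sum_le_sum_abs _ _).trans ?_
  have hc : 0 ≤ 3 * A * b / (n * h) :=
    (abs_nonneg _).trans (hx.abs_rightWeight_le hK hb hn hh ⟨0, hn⟩)
  -- At most A n h units count, each with a weight of at most 3 A b / (n h).
  calc _ ≤ A * (n * h) * (3 * A * b / (n * h) * M) := by
        apply hx.sum_le (mul_nonneg hc hM)
        · intro i hi; simp [hw, rightWeight_eq_zero_of_lt x i hK hh hi]
        · intro i
          rcases lt_or_ge (x i) 0 with h0 | h0
          · simp only [hw, rightWeight_eq_zero_of_neg x i h0, zero_mul, abs_zero]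
            exact mul_nonneg hc hM
          rcases lt_or_ge h (x i) with h3 | h3
          · simp only [hw, rightWeight_eq_zero_of_lt x i hK hh (h3.trans_le (le_abs_self _)),
              zero_mul, abs_zero]; exact mul_nonneg hc hM
          -- The bound on g holds only to the right of the cutoff, so the case x i = 0 has to be
          -- excluded by `ne_zero`.
          rw [abs_mul]
          exact mul_le_mul (hx.abs_rightWeight_le hK hb hn hh i)
            (hg _ (lt_of_le_of_ne h0 (hx.ne_zero i).symm) h3) (abs_nonneg _) hc
    _ = _ := by field_simp

lemma abs_sum_leftWeight_mul_sub_le (hx : GoodDesign K h A x) (hK : IsRDKernel K)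
    (hb : ∀ u, K u ≤ b) (hn : 0 < n) (hh : 0 < h) {g : ℝ → ℝ} {c₀ c₁ c₂ M : ℝ} (hM : 0 ≤ M)
    (hg : ∀ y, y < 0 → -h ≤ y → |g y - (c₀ + c₁ * y + c₂ * y ^ 2)| ≤ M) :
    |∑ i, sideWeight (kernelLeft K h) 2 0 x i * g (x i) - c₀| ≤ 3 * A ^ 2 * b * M := by
  set w := fun i => sideWeight (kernelLeft K h) 2 0 x i with hw
  have hP : ∑ i, w i * (c₀ + c₁ * x i + c₂ * x i ^ 2) = c₀ := by
    have h0 := hx.sum_leftWeight_mul_pow hn hh 0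
    have h1 := hx.sum_leftWeight_mul_pow hn hh 1
    have h2 := hx.sum_leftWeight_mul_pow hn hh 2
    simp at h0 h1 h2
    have : ∀ i, w i * (c₀ + c₁ * x i + c₂ * x i ^ 2) =
        c₀ * w i + c₁ * (w i * x i) + c₂ * (w i * x i ^ 2) := fun i => by ring
    simp_rw [this, Finset.sum_add_distrib, ← Finset.mul_sum]
    simp only [hw, h0, h1, h2]; ring
  have h1 : ∑ i, w i * g (x i) - c₀ = ∑ i, w i * (g (x i) - (c₀ + c₁ * x i + c₂ * x i ^ 2)) := by
    simp_rw [mul_sub, Finset.sum_sub_distrib]; rw [hP]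
  rw [h1]
  refine (Finset.abs_sum_le_sum_abs _ _).trans ?_
  have hc : 0 ≤ 3 * A * b / (n * h) :=
    (abs_nonneg _).trans (hx.abs_leftWeight_le hK hb hn hh ⟨0, hn⟩)
  calc _ ≤ A * (n * h) * (3 * A * b / (n * h) * M) := by
        apply hx.sum_le (mul_nonneg hc hM)
        · intro i hi; simp [hw, leftWeight_eq_zero_of_lt x i hK hh hi]
        · intro i
          rcases le_or_gt 0 (x i) with h0 | h0
          · simp only [hw, leftWeight_eq_zero_of_nonneg x i h0, zero_mul, abs_zero]
            exact mul_nonneg hc hM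
          rcases lt_or_ge (x i) (-h) with h3 | h3
          · simp only [hw, leftWeight_eq_zero_of_lt x i hK hh
              ((lt_neg.mpr h3).trans_le (neg_le_abs _)), zero_mul, abs_zero]; exact mul_nonneg hc hM
          rw [abs_mul]
          exact mul_le_mul (hx.abs_leftWeight_le hK hb hn hh i) (hg _ h0 h3) (abs_nonneg _) hc
    _ = _ := by field_simp

end GoodDesign

/-! ## Quadratic Taylor approximation -/

/-- Quadratic Taylor bound for a function with successive derivatives `f₁, f₂, f₃` on a convex
set. -/
lemma abs_sub_quadratic_le {s : Set ℝ} (hs : Convex ℝ s) {f₀ f₁ f₂ f₃ : ℝ → ℝ} {C : ℝ}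
    (h0 : ∀ z ∈ s, HasDerivAt f₀ (f₁ z) z) (h1 : ∀ z ∈ s, HasDerivAt f₁ (f₂ z) z)
    (h2 : ∀ z ∈ s, HasDerivAt f₂ (f₃ z) z) (h3 : ∀ z ∈ s, |f₃ z| ≤ C) {x y : ℝ} (hx : x ∈ s)
    (hy : y ∈ s) :
    |f₀ x - (f₀ y + f₁ y * (x - y) + f₂ y / 2 * (x - y) ^ 2)| ≤ C * |x - y| ^ 3 := by
  have hC : 0 ≤ C := (abs_nonneg _).trans (h3 x hx)
  have hsub : Set.uIcc y x ⊆ s := by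
    rw [← segment_eq_uIcc]; exact hs.segment_subset hy hx
  have hz : ∀ z ∈ Set.uIcc y x, |z - y| ≤ |x - y| := fun z hz => by
    rcases le_total y x with h | h
    · rw [Set.uIcc_of_le h] at hz
      rw [abs_of_nonneg (by linarith [hz.1]), abs_of_nonneg (by linarith)]; linarith [hz.2]
    · rw [Set.uIcc_of_ge h] at hz
      rw [abs_of_nonpos (by linarith [hz.2]), abs_of_nonpos (by linarith)]; linarith [hz.1]
  have hcv : Convex ℝ (Set.uIcc y x) := convex_uIcc y x
  -- The mean value inequality between y and x, used three times from the second derivative down to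
  -- the function. Each use gains a factor |x - y|. Factorials are given away, hence C instead of C
  -- / 6.
  have key : ∀ {g g' : ℝ → ℝ} {M : ℝ}, 0 ≤ M → (∀ z ∈ Set.uIcc y x, HasDerivAt g (g' z) z) →
      (∀ z ∈ Set.uIcc y x, |g' z| ≤ M) → ∀ z ∈ Set.uIcc y x, |g z - g y| ≤ M * |x - y| := by
    intro g g' M hM hg hg' z hzz
    have := hcv.norm_image_sub_le_of_norm_hasDerivWithin_le
      (fun w hw => (hg w hw).hasDerivWithinAt) hg' Set.left_mem_uIcc hzz
    exact this.trans (mul_le_mul_of_nonneg_left (hz z hzz) hM)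
  have e2 := key hC (fun z hz => h2 z (hsub hz)) (fun z hz => h3 z (hsub hz))
  have e1 := key (g := fun z => f₁ z - f₂ y * (z - y)) (g' := fun z => f₂ z - f₂ y)
    (M := C * |x - y|) (by positivity)
    (fun z hz => by
      have := (h1 z (hsub hz)).sub (((hasDerivAt_id z).sub_const y).const_mul (f₂ y))
      exact this.congr_deriv (by simp)) e2
  have e0 := key (g := fun z => f₀ z - f₁ y * (z - y) - f₂ y / 2 * (z - y) ^ 2)
    (g' := fun z => f₁ z - f₁ y - f₂ y * (z - y)) (M := C * |x - y| * |x - y|) (by positivity)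
    (fun z hz => by
      have a1 := ((hasDerivAt_id z).sub_const y).const_mul (f₁ y)
      have a2 := (((hasDerivAt_id z).sub_const y).pow 2).const_mul (f₂ y / 2)
      have := ((h0 z (hsub hz)).sub a1).sub a2
      exact this.congr_deriv (by simp; ring))
    (fun z hz => by
      have := e1 z hz
      simp only [sub_self, mul_zero, sub_zero] at this
      convert this using 2; ring)
  have := e0 x Set.right_mem_uIcc
  simp only [sub_self, mul_zero, sub_zero, ne_eq, OfNat.ofNat_ne_zero, not_false_eq_true,
    zero_pow] at this
  calc _ = _ := by congr 1; ring
    _ ≤ _ := this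
    _ = _ := by ring

/-- Quadratic Taylor bound around `0`, when the derivatives exist on a convex set that has `0` as
a limit point. -/
lemma abs_sub_quadratic_zero_le {s : Set ℝ} (hs : Convex ℝ s) [(𝓝[s] (0 : ℝ)).NeBot]
    {f₀ f₁ f₂ f₃ : ℝ → ℝ} {C a₀ a₁ a₂ : ℝ}
    (h0 : ∀ z ∈ s, HasDerivAt f₀ (f₁ z) z) (h1 : ∀ z ∈ s, HasDerivAt f₁ (f₂ z) z)
    (h2 : ∀ z ∈ s, HasDerivAt f₂ (f₃ z) z) (h3 : ∀ z ∈ s, |f₃ z| ≤ C)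
    (l0 : Tendsto f₀ (𝓝[s] 0) (𝓝 a₀)) (l1 : Tendsto f₁ (𝓝[s] 0) (𝓝 a₁))
    (l2 : Tendsto f₂ (𝓝[s] 0) (𝓝 a₂)) {x : ℝ} (hx : x ∈ s) :
    |f₀ x - (a₀ + a₁ * x + a₂ / 2 * x ^ 2)| ≤ C * |x| ^ 3 := by
  have hid : Tendsto (fun y : ℝ => x - y) (𝓝[s] 0) (𝓝 x) := by
    have : Tendsto (fun y : ℝ => x - y) (𝓝 0) (𝓝 (x - 0)) :=
      (continuous_const.sub continuous_id).tendsto 0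
    rw [sub_zero] at this
    exact this.mono_left nhdsWithin_le_nhds
  -- The expansion point y tends to 0 inside s in the bound of `abs_sub_quadratic_le`.
  refine le_of_tendsto_of_tendsto (((tendsto_const_nhds (x := f₀ x)).sub
    ((l0.add (l1.mul hid)).add ((l2.div_const 2).mul (hid.pow 2)))).abs)
    ((hid.abs.pow 3).const_mul C) ?_
  filter_upwards [self_mem_nhdsWithin] with y hy
  exact abs_sub_quadratic_le hs h0 h1 h2 h3 hx hy

lemma hasDerivAt_iteratedDeriv {g : ℝ → ℝ} {j : ℕ} {x : ℝ}
    (h : DifferentiableAt ℝ (iteratedDeriv j g) x) :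
    HasDerivAt (iteratedDeriv j g) (iteratedDeriv (j + 1) g x) x := by
  rw [iteratedDeriv_succ]; exact h.hasDerivAt

lemma continuousAt_iteratedDeriv_of_contDiffAt {g : ℝ → ℝ} {x : ℝ} {k j : ℕ}
    (h : ContDiffAt ℝ k g x) (hj : j ≤ k) : ContinuousAt (iteratedDeriv j g) x := by
  obtain ⟨u, hu, hg⟩ := h.contDiffOn le_rfl (by simp)
  obtain ⟨v, hvu, hv, hxv⟩ := mem_nhds_iff.mp (by simpa using hu)
  have h1 := (hg.mono hvu).continuousOn_iteratedDerivWithin (m := j) (by exact_mod_cast hj)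
    hv.uniqueDiffOn
  have h2 : ContinuousOn (iteratedDeriv j g) v :=
    h1.congr fun y hy => (iteratedDerivWithin_of_isOpen hv hy).symm
  exact h2.continuousAt (hv.mem_nhds hxv)

/-- A function that is `C²` at `0` and has three derivatives on `[-h, h] \ {0}` is close to its
Taylor polynomial at `0`. -/
lemma exists_quadratic_approx {g : ℝ → ℝ} {h : ℝ} (hh : 0 < h) (hg : ContDiffAt ℝ 2 g 0)
    {c : ℕ → ℝ} (hd : ∀ j, j < 3 → ∀ x ∈ Set.Icc (-h) h \ {0},
      DifferentiableAt ℝ (iteratedDeriv j g) x ∧ |iteratedDeriv (j + 1) g x| ≤ c (j + 1)) :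
    ∃ a₁ a₂ : ℝ, |a₁| ≤ c 1 ∧ |a₂| ≤ c 2 ∧ ∀ x, x ≠ 0 → |x| ≤ h →
      |g x - (g 0 + a₁ * x + a₂ * x ^ 2)| ≤ c 3 * |x| ^ 3 := by
  have hc : ∀ j, j ≤ 2 → ContinuousAt (iteratedDeriv j g) 0 := fun j hj =>
    continuousAt_iteratedDeriv_of_contDiffAt (k := 2) hg hj
  have hpos : Set.Ioc 0 h ⊆ Set.Icc (-h) h \ {0} := fun x hx =>
    ⟨⟨by linarith [hx.1], hx.2⟩, by simpa using hx.1.ne'⟩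
  have hneg : Set.Ico (-h) 0 ⊆ Set.Icc (-h) h \ {0} := fun x hx =>
    ⟨⟨hx.1, by linarith [hx.2]⟩, by simpa using hx.2.ne⟩
  have n1 : (𝓝[Set.Ioc 0 h] (0 : ℝ)).NeBot := by
    rw [nhdsWithin_Ioc_eq_nhdsGT hh]; infer_instance
  have n2 : (𝓝[Set.Ico (-h) 0] (0 : ℝ)).NeBot := by
    rw [nhdsWithin_Ico_eq_nhdsLT (by linarith)]; infer_instance
  -- The hypothesis excludes the point 0; the bounds reach it as limits from the right.
  have hbd : ∀ j, j < 2 → |iteratedDeriv (j + 1) g 0| ≤ c (j + 1) := fun j hj => by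
    have h1 : Tendsto (fun x => |iteratedDeriv (j + 1) g x|) (𝓝[Set.Ioc 0 h] 0)
        (𝓝 |iteratedDeriv (j + 1) g 0|) :=
      ((hc (j + 1) (by omega)).tendsto.mono_left nhdsWithin_le_nhds).abs
    refine le_of_tendsto h1 ?_
    filter_upwards [self_mem_nhdsWithin] with x hx
    exact (hd j (by omega) x (hpos hx)).2
  have h20 : |iteratedDeriv 2 g 0 / 2| ≤ c 2 := by
    have := hbd 1 (by omega)
    rw [abs_div, abs_two]
    have h0 := abs_nonneg (iteratedDeriv 2 g 0)
    simp only [Nat.reduceAdd] at this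
    linarith
  -- Since g is C² at 0, one Taylor polynomial serves both sides of the cutoff. Only the third
  -- derivative may jump there.
  refine ⟨iteratedDeriv 1 g 0, iteratedDeriv 2 g 0 / 2, hbd 0 (by omega), h20, ?_⟩
  have main : ∀ s : Set ℝ, Convex ℝ s → (𝓝[s] (0 : ℝ)).NeBot → s ⊆ Set.Icc (-h) h \ {0} →
      ∀ x ∈ s, |g x - (g 0 + iteratedDeriv 1 g 0 * x + iteratedDeriv 2 g 0 / 2 * x ^ 2)|
        ≤ c 3 * |x| ^ 3 := by
    intro s hs hne hsub x hx
    have hd' : ∀ j, j < 3 → ∀ z ∈ s,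
        HasDerivAt (iteratedDeriv j g) (iteratedDeriv (j + 1) g z) z := fun j hj z hz =>
      hasDerivAt_iteratedDeriv (hd j hj z (hsub hz)).1
    have l : ∀ j, j ≤ 2 → Tendsto (iteratedDeriv j g) (𝓝[s] 0) (𝓝 (iteratedDeriv j g 0)) :=
      fun j hj => (hc j hj).tendsto.mono_left nhdsWithin_le_nhds
    have := abs_sub_quadratic_zero_le hs (hd' 0 (by omega)) (hd' 1 (by omega)) (hd' 2 (by omega))
      (fun z hz => (hd 2 (by omega) z (hsub hz)).2) (l 0 (by omega)) (l 1 (by omega))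
      (l 2 (by omega)) hx
    simpa only [iteratedDeriv_zero] using this
  intro x hx0 hxh
  rcases lt_or_gt_of_ne hx0 with hx | hx
  · exact main _ (convex_Ico _ _) n2 hneg x ⟨(_root_.abs_le.mp hxh).1, hx⟩
  · exact main _ (convex_Ioc _ _) n1 hpos x ⟨hx, (_root_.abs_le.mp hxh).2⟩

/-! ### Bias of the one-sided local quadratic fits -/

namespace GoodDesign

variable {n : ℕ} {K : ℝ → ℝ} {h A b : ℝ} {x : Fin n → ℝ}

/-- Bias of a one-sided local quadratic fit. -/
lemma abs_rightBias_le (hx : GoodDesign K h A x) (hK : IsRDKernel K) (hb : ∀ u, K u ≤ b)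
    (hn : 0 < n) (hh : 0 < h) {f : ℝ → ℝ} {a C L : ℝ}
    (hd : ∀ j, j < 3 → ∀ z ∈ Set.Ioc 0 h, DifferentiableAt ℝ (iteratedDeriv j f) z)
    (h1 : ∀ z ∈ Set.Ioo 0 h, |deriv f z| ≤ L) (h2 : ∀ z ∈ Set.Ioc 0 h, |iteratedDeriv 2 f z| ≤ C)
    (h3 : ∀ z ∈ Set.Ioc 0 h, |iteratedDeriv 3 f z| ≤ C) (ha : Tendsto f (𝓝[>] 0) (𝓝 a)) :
    |∑ i, sideWeight (kernelRight K h) 2 0 x i * f (x i) - a| ≤ 3 * A ^ 2 * b * (C * h ^ 3) := by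
  have hd' : ∀ j, j < 3 → ∀ z ∈ Set.Ioc 0 h,
      HasDerivAt (iteratedDeriv j f) (iteratedDeriv (j + 1) f z) z := fun j hj z hz =>
    hasDerivAt_iteratedDeriv (hd j hj z hz)
  have hC : 0 ≤ C := (abs_nonneg _).trans (h3 h ⟨hh, le_rfl⟩)
  -- The value at 0 of the Taylor polynomial of f at y. The derivatives of f need not be known to
  -- converge at the cutoff. Being bounded, they drop out of c₀ y as y → 0⁺, so c₀ y tends to the
  -- one-sided limit a of f.
  set c₀ : ℝ → ℝ := fun y => f y - iteratedDeriv 1 f y * y + iteratedDeriv 2 f y / 2 * y ^ 2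
  have hc : ∀ y ∈ Set.Ioc 0 h, |∑ i, sideWeight (kernelRight K h) 2 0 x i * f (x i) - c₀ y| ≤
      3 * A ^ 2 * b * (C * h ^ 3) := fun y hy => by
    refine hx.abs_sum_rightWeight_mul_sub_le hK hb hn hh (g := f)
      (c₁ := iteratedDeriv 1 f y - iteratedDeriv 2 f y * y) (c₂ := iteratedDeriv 2 f y / 2)
      (by positivity) fun z hz hzh => ?_
    have := abs_sub_quadratic_le (convex_Ioc 0 h) (hd' 0 (by omega)) (hd' 1 (by omega))
      (hd' 2 (by omega)) h3 ⟨hz, hzh⟩ hy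
    simp only [iteratedDeriv_zero, zero_add] at this
    calc _ = _ := by congr 1; simp only [c₀]; ring
      _ ≤ _ := this
      _ ≤ C * h ^ 3 := by
        gcongr; rw [abs_le]; constructor <;> linarith [hy.1, hy.2]
  have hy0 : Tendsto (fun y : ℝ => y) (𝓝[>] 0) (𝓝 0) := tendsto_id.mono_left nhdsWithin_le_nhds
  have hmem : ∀ᶠ y in 𝓝[>] (0 : ℝ), y ∈ Set.Ioo 0 h := Ioo_mem_nhdsGT hh
  have t1 : Tendsto (fun y => iteratedDeriv 1 f y * y) (𝓝[>] 0) (𝓝 0) := by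
    refine squeeze_zero_norm' (a := fun y => L * |y|) ?_ (by simpa using hy0.abs.const_mul L)
    filter_upwards [hmem] with y hy
    rw [norm_mul, iteratedDeriv_one, Real.norm_eq_abs, Real.norm_eq_abs]
    exact mul_le_mul_of_nonneg_right (h1 y hy) (abs_nonneg _)
  have t2 : Tendsto (fun y => iteratedDeriv 2 f y / 2 * y ^ 2) (𝓝[>] 0) (𝓝 0) := by
    refine squeeze_zero_norm' (a := fun y => C * |y| ^ 2) ?_
      (by simpa using (hy0.abs.pow 2).const_mul C)
    filter_upwards [hmem] with y hy
    rw [norm_mul, norm_pow, Real.norm_eq_abs, Real.norm_eq_abs, abs_div, abs_two]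
    have := h2 y ⟨hy.1, hy.2.le⟩
    have h0 := abs_nonneg (iteratedDeriv 2 f y)
    gcongr; linarith
  have t : Tendsto c₀ (𝓝[>] 0) (𝓝 a) := by
    have := (ha.sub t1).add t2
    rwa [sub_zero, add_zero] at this
  refine le_of_tendsto ((tendsto_const_nhds.sub t).abs) ?_
  filter_upwards [hmem] with y hy using hc y ⟨hy.1, hy.2.le⟩

lemma abs_leftBias_le (hx : GoodDesign K h A x) (hK : IsRDKernel K) (hb : ∀ u, K u ≤ b)
    (hn : 0 < n) (hh : 0 < h) {f : ℝ → ℝ} {a C L : ℝ}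
    (hd : ∀ j, j < 3 → ∀ z ∈ Set.Ico (-h) 0, DifferentiableAt ℝ (iteratedDeriv j f) z)
    (h1 : ∀ z ∈ Set.Ioo (-h) 0, |deriv f z| ≤ L)
    (h2 : ∀ z ∈ Set.Ico (-h) 0, |iteratedDeriv 2 f z| ≤ C)
    (h3 : ∀ z ∈ Set.Ico (-h) 0, |iteratedDeriv 3 f z| ≤ C) (ha : Tendsto f (𝓝[<] 0) (𝓝 a)) :
    |∑ i, sideWeight (kernelLeft K h) 2 0 x i * f (x i) - a| ≤ 3 * A ^ 2 * b * (C * h ^ 3) := by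
  have hd' : ∀ j, j < 3 → ∀ z ∈ Set.Ico (-h) 0,
      HasDerivAt (iteratedDeriv j f) (iteratedDeriv (j + 1) f z) z := fun j hj z hz =>
    hasDerivAt_iteratedDeriv (hd j hj z hz)
  have hC : 0 ≤ C := (abs_nonneg _).trans (h3 (-h) ⟨le_rfl, by linarith⟩)
  set c₀ : ℝ → ℝ := fun y => f y - iteratedDeriv 1 f y * y + iteratedDeriv 2 f y / 2 * y ^ 2
  have hc : ∀ y ∈ Set.Ico (-h) 0, |∑ i, sideWeight (kernelLeft K h) 2 0 x i * f (x i) - c₀ y| ≤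
      3 * A ^ 2 * b * (C * h ^ 3) := fun y hy => by
    refine hx.abs_sum_leftWeight_mul_sub_le hK hb hn hh (g := f)
      (c₁ := iteratedDeriv 1 f y - iteratedDeriv 2 f y * y) (c₂ := iteratedDeriv 2 f y / 2)
      (by positivity) fun z hz hzh => ?_
    have := abs_sub_quadratic_le (convex_Ico (-h) 0) (hd' 0 (by omega)) (hd' 1 (by omega))
      (hd' 2 (by omega)) h3 ⟨hzh, hz⟩ hy
    simp only [iteratedDeriv_zero, zero_add] at this
    calc _ = _ := by congr 1; simp only [c₀]; ring
      _ ≤ _ := this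
      _ ≤ C * h ^ 3 := by
        gcongr; rw [abs_le]; constructor <;> linarith [hy.1, hy.2]
  have hy0 : Tendsto (fun y : ℝ => y) (𝓝[<] 0) (𝓝 0) := tendsto_id.mono_left nhdsWithin_le_nhds
  have hmem : ∀ᶠ y in 𝓝[<] (0 : ℝ), y ∈ Set.Ioo (-h) 0 := Ioo_mem_nhdsLT (by linarith)
  have t1 : Tendsto (fun y => iteratedDeriv 1 f y * y) (𝓝[<] 0) (𝓝 0) := by
    refine squeeze_zero_norm' (a := fun y => L * |y|) ?_ (by simpa using hy0.abs.const_mul L)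
    filter_upwards [hmem] with y hy
    rw [norm_mul, iteratedDeriv_one, Real.norm_eq_abs, Real.norm_eq_abs]
    exact mul_le_mul_of_nonneg_right (h1 y hy) (abs_nonneg _)
  have t2 : Tendsto (fun y => iteratedDeriv 2 f y / 2 * y ^ 2) (𝓝[<] 0) (𝓝 0) := by
    refine squeeze_zero_norm' (a := fun y => C * |y| ^ 2) ?_
      (by simpa using (hy0.abs.pow 2).const_mul C)
    filter_upwards [hmem] with y hy
    rw [norm_mul, norm_pow, Real.norm_eq_abs, Real.norm_eq_abs, abs_div, abs_two]
    have := h2 y ⟨hy.1.le, hy.2⟩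
    have h0 := abs_nonneg (iteratedDeriv 2 f y)
    gcongr; linarith
  have t : Tendsto c₀ (𝓝[<] 0) (𝓝 a) := by
    have := (ha.sub t1).add t2
    rwa [sub_zero, add_zero] at this
  refine le_of_tendsto ((tendsto_const_nhds.sub t).abs) ?_
  filter_upwards [hmem] with y hy using hc y ⟨hy.1.le, hy.2⟩

end GoodDesign

/-! ## Nearest neighbours -/

section Neighbors

variable {n : ℕ} {x : Fin n → ℝ}

lemma Closer.trans {i j k l : Fin n} (h₁ : Closer x i j k) (h₂ : Closer x i k l) :
    Closer x i j l := by
  unfold Closer at *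
  rcases h₁ with h₁ | ⟨h₁, h₁'⟩ <;> rcases h₂ with h₂ | ⟨h₂, h₂'⟩
  · exact Or.inl (h₁.trans h₂)
  · exact Or.inl (h₂ ▸ h₁)
  · exact Or.inl (h₁ ▸ h₂)
  · exact Or.inr ⟨h₁.trans h₂, h₁'.trans h₂'⟩

lemma not_closer_self (i j : Fin n) : ¬ Closer x i j j := by
  simp [Closer]

lemma closer_or_closer (i : Fin n) {j k : Fin n} (hjk : j ≠ k) :
    Closer x i j k ∨ Closer x i k j := by
  unfold Closer
  rcases lt_trichotomy |x j - x i| |x k - x i| with h | h | h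
  · exact Or.inl (Or.inl h)
  · rcases lt_or_gt_of_ne hjk with h' | h'
    · exact Or.inl (Or.inr ⟨h, h'⟩)
    · exact Or.inr (Or.inr ⟨h.symm, h'⟩)
  · exact Or.inr (Or.inl h)

lemma mem_neighbors {R : ℕ} {i j : Fin n} (hj : j ∈ neighbors R x i) :
    j ≠ i ∧ SameSide (x i) (x j) := by
  simp only [neighbors, Finset.mem_filter, Finset.mem_univ, true_and] at hj
  exact ⟨hj.1, hj.2.1⟩

-- Among the candidates, the number of closer candidates is strictly increasing for the total order
-- `Closer`. Ranks are therefore exactly 0, 1, 2, …, each taken once, and the neighbours are the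
-- candidates with rank below R.
open Classical in
lemma card_neighbors {R : ℕ} {i : Fin n}
    (hR : R ≤ (Finset.univ.filter fun k => k ≠ i ∧ SameSide (x i) (x k)).card) :
    (neighbors R x i).card = R := by
  set C := Finset.univ.filter fun k => k ≠ i ∧ SameSide (x i) (x k) with hC
  set rank : Fin n → ℕ := fun j =>
    (Finset.univ.filter fun k => k ≠ i ∧ SameSide (x i) (x k) ∧ Closer x i k j).card with hrank
  have hlt : ∀ j ∈ C, ∀ k, Closer x i j k → rank j < rank k := fun j hj k hjk => by
    apply Finset.card_lt_card
    refine ⟨fun l hl => ?_, fun hsub => ?_⟩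
    · simp only [Finset.mem_filter, Finset.mem_univ, true_and] at hl ⊢
      exact ⟨hl.1, hl.2.1, hl.2.2.trans hjk⟩
    · simp only [hC, Finset.mem_filter, Finset.mem_univ, true_and] at hj
      have : j ∈ Finset.univ.filter fun l => l ≠ i ∧ SameSide (x i) (x l) ∧ Closer x i l j :=
        hsub (by simpa using ⟨hj.1, hj.2, hjk⟩)
      simp only [Finset.mem_filter, Finset.mem_univ, true_and] at this
      exact not_closer_self i j this.2.2
  have hinj : Set.InjOn rank C := fun j hj k hk hjk => by
    by_contra hne
    rcases closer_or_closer (x := x) i hne with h | h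
    · exact (hlt j hj k h).ne hjk
    · exact (hlt k hk j h).ne' hjk
  -- An injective map into a set of the same size is onto.
  have hrange : C.image rank = Finset.range C.card := by
    apply Finset.eq_of_subset_of_card_le
    · intro m hm
      obtain ⟨j, hj, rfl⟩ := Finset.mem_image.mp hm
      rw [Finset.mem_range]
      apply Finset.card_lt_card
      refine ⟨fun l hl => ?_, fun hsub => ?_⟩
      · simp only [hC, Finset.mem_filter, Finset.mem_univ, true_and] at hl ⊢
        exact ⟨hl.1, hl.2.1⟩
      · have := hsub hj
        simp only [Finset.mem_filter, Finset.mem_univ, true_and] at this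
        exact not_closer_self i j this.2.2
    · rw [Finset.card_image_of_injOn hinj, Finset.card_range]
  have hN : neighbors R x i = C.filter fun j => rank j < R := by
    ext j
    simp only [neighbors, hC, hrank, Finset.mem_filter, Finset.mem_univ, true_and, and_assoc]
  have himg : (neighbors R x i).image rank = Finset.range R := by
    ext m
    simp only [hN, Finset.mem_image, Finset.mem_filter, Finset.mem_range]
    constructor
    · rintro ⟨j, ⟨_, h⟩, rfl⟩; exact h
    · intro hm
      have : m ∈ C.image rank := by rw [hrange, Finset.mem_range]; omega
      obtain ⟨j, hj, rfl⟩ := Finset.mem_image.mp this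
      exact ⟨j, ⟨hj, hm⟩, rfl⟩
  have hinj' : Set.InjOn rank (neighbors R x i : Set (Fin n)) := by
    rw [hN]; exact hinj.mono fun j hj => (Finset.mem_filter.mp hj).1
  rw [← Finset.card_image_of_injOn hinj', himg, Finset.card_range]

open Classical in
/-- The units in the window that have at least `R` other units on the same side between
themselves and the end of the window. -/
def interiorUnits (R : ℕ) (h : ℝ) (x : Fin n → ℝ) : Finset (Fin n) :=
  (windowUnits h x).filter fun i =>
    R ≤ ((windowUnits h x).filter fun k => k ≠ i ∧ SameSide (x i) (x k) ∧ |x i| ≤ |x k|).card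

/-- On one side of the cutoff, distances to a unit nearer the cutoff are compared through the
distances to the cutoff. -/
lemma SameSide.abs_sub {a b : ℝ} (h : SameSide a b) (hab : |a| ≤ |b|) : |b - a| = |b| - |a| := by
  unfold SameSide at h
  rcases le_or_gt 0 a with ha | ha
  · have hb := h.mp ha
    rw [abs_of_nonneg ha, abs_of_nonneg hb] at *
    exact abs_of_nonneg (by linarith)
  · have hb : b < 0 := not_le.mp fun hb => absurd (h.mpr hb) (not_le.mpr ha)
    rw [abs_of_neg ha, abs_of_neg hb] at *
    rw [abs_of_nonpos (by linarith)]; ring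

lemma SameSide.mul_pos {a b : ℝ} (h : SameSide a b) (ha : a ≠ 0) (hb : b ≠ 0) : 0 < a * b := by
  unfold SameSide at h
  rcases lt_or_gt_of_ne ha with h0 | h0
  · have hb : b < 0 := not_le.mp fun hb => absurd (h.mpr hb) (not_le.mpr h0)
    exact mul_pos_of_neg_of_neg h0 hb
  · exact _root_.mul_pos h0 (lt_of_le_of_ne (h.mp h0.le) hb.symm)

lemma card_neighbors_of_mem_interior {R : ℕ} {h : ℝ} {i : Fin n}
    (hi : i ∈ interiorUnits R h x) : (neighbors R x i).card = R := by
  classical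
  apply card_neighbors
  simp only [interiorUnits, Finset.mem_filter] at hi
  refine hi.2.trans (Finset.card_le_card fun k hk => ?_)
  simp only [Finset.mem_filter, Finset.mem_univ, true_and] at hk ⊢
  exact ⟨hk.2.1, hk.2.2.1⟩

/-- An interior unit has at least R units between itself and the end of the window. A unit beyond
the window is strictly farther away than all of these, so its rank is at least R. -/
lemma abs_le_of_mem_neighbors {R : ℕ} {h : ℝ} {i j : Fin n}
    (hi : i ∈ interiorUnits R h x) (hj : j ∈ neighbors R x i) : |x j| ≤ h := by
  classical
  by_contra hlt
  rw [not_le] at hlt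
  simp only [interiorUnits, Finset.mem_filter] at hi
  simp only [neighbors, Finset.mem_filter, Finset.mem_univ, true_and] at hj
  have hi0 : |x i| ≤ h := by simpa [windowUnits] using hi.1
  refine absurd (hi.2.trans (Finset.card_le_card fun k hk => ?_)) (not_le.mpr hj.2.2)
  simp only [windowUnits, Finset.mem_filter, Finset.mem_univ, true_and] at hk ⊢
  refine ⟨hk.2.1, hk.2.2.1, Or.inl ?_⟩
  rw [hk.2.2.1.abs_sub hk.2.2.2, hj.2.1.abs_sub (hi0.trans hlt.le)]
  linarith [hk.1]

lemma mem_window_of_mem_interior {R : ℕ} {h : ℝ} {i : Fin n}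
    (hi : i ∈ interiorUnits R h x) : |x i| ≤ h := by
  classical
  have := (Finset.mem_filter.mp hi).1
  simpa [windowUnits] using this

-- On each side, let i be the exceptional unit nearest to the cutoff. The other exceptional units of
-- that side lie beyond i in the window, and there are fewer than R such units. Hence there are at
-- most R per side.
open Classical in
lemma card_sdiff_interior_le (R : ℕ) (h : ℝ) (x : Fin n → ℝ) :
    (windowUnits h x \ interiorUnits R h x).card ≤ 2 * R := by
  set E := windowUnits h x \ interiorUnits R h x with hE
  have key : ∀ F ⊆ E, (∀ i ∈ F, ∀ j ∈ F, SameSide (x i) (x j)) → F.card ≤ R := by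
    intro F hF hside
    rcases F.eq_empty_or_nonempty with rfl | hne
    · simp
    obtain ⟨i, hi, hmin⟩ := F.exists_min_image (fun i => |x i|) hne
    have hiE := hF hi
    simp only [hE, interiorUnits, Finset.mem_sdiff, Finset.mem_filter, not_and, not_le] at hiE
    have h1 := hiE.2 hiE.1
    have h2 : (F.erase i).card ≤ ((windowUnits h x).filter fun k =>
        k ≠ i ∧ SameSide (x i) (x k) ∧ |x i| ≤ |x k|).card := by
      refine Finset.card_le_card fun k hk => ?_
      have hkF := Finset.mem_of_mem_erase hk
      rw [Finset.mem_filter]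
      exact ⟨(Finset.mem_sdiff.mp (hF hkF)).1, Finset.ne_of_mem_erase hk, hside i hi k hkF,
        hmin k hkF⟩
    rw [Finset.card_erase_of_mem hi] at h2
    omega
  have h1 := key (E.filter fun i => 0 ≤ x i) (Finset.filter_subset _ _) (by
    intro i hi j hj
    simp only [Finset.mem_filter] at hi hj
    simp [SameSide, hi.2, hj.2])
  have h2 := key (E.filter fun i => ¬ 0 ≤ x i) (Finset.filter_subset _ _) (by
    intro i hi j hj
    simp only [Finset.mem_filter] at hi hj
    simp [SameSide, hi.2, hj.2])
  have := Finset.card_filter_add_card_filter_not (s := E) (fun i => 0 ≤ x i)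
  omega

end Neighbors

/-! ## A lower bound for the squared standard error -/

open Classical in
/-- Squared weights of the interior units. -/
def intWeight {n : ℕ} (K : ℝ → ℝ) (R : ℕ) (h : ℝ) (x : Fin n → ℝ) (i : Fin n) : ℝ :=
  if i ∈ interiorUnits R h x then weight K h 2 0 x i ^ 2 else 0

open Classical in
/-- Coefficients of the quadratic form `∑ wᵢ² εᵢ R⁻¹ ∑_{j ∈ 𝓡ᵢ} εⱼ` over interior units. -/
def pairWeight {n : ℕ} (K : ℝ → ℝ) (R : ℕ) (h : ℝ) (x : Fin n → ℝ) (i j : Fin n) : ℝ :=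
  if j ∈ neighbors R x i then intWeight K R h x i / R else 0

/-- Total weight of unit `j` in the squared standard error, as itself or as a neighbour. -/
def totalWeight {n : ℕ} (K : ℝ → ℝ) (R : ℕ) (h : ℝ) (x : Fin n → ℝ) (j : Fin n) : ℝ :=
  4 * intWeight K R h x j + ∑ i, 4 * pairWeight K R h x i j

section

variable {n : ℕ} (K : ℝ → ℝ) (R : ℕ) (h : ℝ) (x : Fin n → ℝ)

lemma intWeight_nonneg (i : Fin n) : 0 ≤ intWeight K R h x i := by
  unfold intWeight; split_ifs <;> positivity

lemma intWeight_le (i : Fin n) : intWeight K R h x i ≤ weight K h 2 0 x i ^ 2 := by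
  unfold intWeight; split_ifs
  · exact le_rfl
  · positivity

lemma intWeight_eq_zero {i : Fin n} (hi : h < |x i|) : intWeight K R h x i = 0 := by
  unfold intWeight
  rw [if_neg fun hmem => absurd (mem_window_of_mem_interior hmem) (not_le.mpr hi)]

lemma pairWeight_nonneg (i j : Fin n) : 0 ≤ pairWeight K R h x i j := by
  unfold pairWeight; split_ifs
  · exact div_nonneg (intWeight_nonneg ..) (Nat.cast_nonneg _)
  · exact le_rfl

lemma pairWeight_self (i : Fin n) : pairWeight K R h x i i = 0 := by
  unfold pairWeight
  rw [if_neg fun hmem => (mem_neighbors hmem).1 rfl]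

lemma totalWeight_nonneg (j : Fin n) : 0 ≤ totalWeight K R h x j :=
  add_nonneg (mul_nonneg (by norm_num) (intWeight_nonneg ..))
    (Finset.sum_nonneg fun i _ => mul_nonneg (by norm_num) (pairWeight_nonneg ..))

lemma totalWeight_eq_zero {j : Fin n} (hj : h < |x j|) : totalWeight K R h x j = 0 := by
  unfold totalWeight
  rw [intWeight_eq_zero K R h x hj, mul_zero, zero_add]
  refine Finset.sum_eq_zero fun i _ => ?_
  unfold pairWeight intWeight
  split_ifs with h1 h2
  · exact absurd (abs_le_of_mem_neighbors h2 h1) (not_le.mpr hj)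
  · simp
  · simp

variable {R}

lemma sum_pairWeight (i : Fin n) (f : Fin n → ℝ) :
    ∑ j, pairWeight K R h x i j * f j =
      intWeight K R h x i * (1 / (R : ℝ) * ∑ j ∈ neighbors R x i, f j) := by
  classical
  simp only [pairWeight, ite_mul, zero_mul]
  rw [← Finset.sum_filter, Finset.filter_mem_eq_inter, Finset.univ_inter, Finset.mul_sum,
    Finset.mul_sum]
  refine Finset.sum_congr rfl fun j _ => by ring

/-- An interior unit has exactly R neighbours; for the others both sides are zero. -/
lemma sum_pairWeight_eq (hR : 0 < R) (i : Fin n) :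
    ∑ j, pairWeight K R h x i j = intWeight K R h x i := by
  have h1 := sum_pairWeight (R := R) K h x i 1
  simp only [Pi.one_apply, mul_one, Finset.sum_const, nsmul_eq_mul] at h1
  rw [h1]
  unfold intWeight
  split_ifs with hi
  · rw [card_neighbors_of_mem_interior hi]; field_simp
  · simp

/-- Summing over the neighbours first avoids any bound on how often a unit serves as a neighbour.
The constant is 8 = 4 + 4, one half for the unit itself and one for its role as a neighbour. -/
lemma sum_totalWeight_le (hR : 0 < R) :
    ∑ j, totalWeight K R h x j ≤ 8 * ∑ i, weight K h 2 0 x i ^ 2 := by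
  unfold totalWeight
  rw [Finset.sum_add_distrib, Finset.sum_comm]
  simp_rw [← Finset.mul_sum, sum_pairWeight_eq K h x hR]
  have : ∑ i, intWeight K R h x i ≤ ∑ i, weight K h 2 0 x i ^ 2 :=
    Finset.sum_le_sum fun i _ => intWeight_le ..
  linarith

/-- Each entry is at most its row sum, so the squares in a row sum to at most the squared row sum.
-/
lemma sum_pairWeight_sq_le (hR : 0 < R) :
    ∑ i, ∑ j, pairWeight K R h x i j ^ 2 ≤ ∑ i, weight K h 2 0 x i ^ 4 := by
  refine Finset.sum_le_sum fun i _ => ?_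
  have h1 : ∀ j, pairWeight K R h x i j ^ 2 ≤ pairWeight K R h x i j * intWeight K R h x i := by
    intro j
    rw [sq]
    refine mul_le_mul_of_nonneg_left ?_ (pairWeight_nonneg ..)
    rw [← sum_pairWeight_eq K h x hR i]
    exact Finset.single_le_sum (f := fun j => pairWeight K R h x i j)
      (fun j _ => pairWeight_nonneg ..) (Finset.mem_univ j)
  calc _ ≤ ∑ j, pairWeight K R h x i j * intWeight K R h x i :=
        Finset.sum_le_sum fun j _ => h1 j
    _ = intWeight K R h x i ^ 2 := by rw [← Finset.sum_mul, sum_pairWeight_eq K h x hR, sq]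
    _ ≤ (weight K h 2 0 x i ^ 2) ^ 2 :=
        pow_le_pow_left₀ (intWeight_nonneg ..) (intWeight_le ..) 2
    _ = _ := by ring

end

/-- Young's inequality. With u the noise and v everything else, the remainders enter only through
their squares, at the cost of a factor 1 - δ on the noise. -/
lemma le_sq_add {δ : ℝ} (hδ : 0 < δ) (u v : ℝ) :
    (1 - δ) * u ^ 2 - 1 / δ * v ^ 2 ≤ (u + v) ^ 2 := by
  have : 0 ≤ (δ * u + v) ^ 2 / δ := by positivity
  have h2 : (δ * u + v) ^ 2 / δ = δ * u ^ 2 + 2 * u * v + 1 / δ * v ^ 2 := by field_simp; ring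
  nlinarith [sq_nonneg v]

/-- Residuals of a unit with respect to the average of a set of `R` units. -/
lemma le_sq_sub_average {ι : Type*} (s : Finset ι) {R : ℕ} (hR : 0 < R) (hs : s.card = R)
    {δ M : ℝ} (hδ : 0 < δ) (hδ1 : δ < 1) {y₀ μ₀ ε₀ Δ₀ : ℝ} {y μ ε Δ : ι → ℝ}
    (h0 : y₀ = μ₀ + ε₀ - Δ₀) (h1 : ∀ j ∈ s, y j = μ j + ε j - Δ j)
    (hμ : ∀ j ∈ s, |μ₀ - μ j| ≤ M) :
    (1 - δ) * (ε₀ ^ 2 - 2 * (ε₀ * (1 / (R : ℝ) * ∑ j ∈ s, ε j))) -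
      1 / δ * (2 * M ^ 2 + 4 * Δ₀ ^ 2 + 4 * (1 / (R : ℝ) * ∑ j ∈ s, Δ j ^ 2)) ≤
      (y₀ - 1 / (R : ℝ) * ∑ j ∈ s, y j) ^ 2 := by
  have hR' : (0 : ℝ) < R := by exact_mod_cast hR
  have hsR : (s.card : ℝ) = R := by rw [hs]
  set a := 1 / (R : ℝ) * ∑ j ∈ s, ε j
  set D := 1 / (R : ℝ) * ∑ j ∈ s, Δ j with hD
  set B := 1 / (R : ℝ) * ∑ j ∈ s, (μ₀ - μ j) with hB
  -- The residual splits into noise, a difference of conditional means B, and first-stage errors.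
  -- The units number exactly R, so μ₀ can be moved inside the average.
  have e1 : y₀ - 1 / (R : ℝ) * ∑ j ∈ s, y j = (ε₀ - a) + (B - (Δ₀ - D)) := by
    have : ∑ j ∈ s, y j = ∑ j ∈ s, μ j + ∑ j ∈ s, ε j - ∑ j ∈ s, Δ j := by
      rw [← Finset.sum_add_distrib, ← Finset.sum_sub_distrib]; exact Finset.sum_congr rfl h1
    rw [this, h0]
    simp only [a, hD, hB, Finset.sum_sub_distrib, Finset.sum_const, nsmul_eq_mul, hsR]
    field_simp; ring
  have hB2 : B ^ 2 ≤ M ^ 2 := by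
    apply sq_le_sq'
    all_goals
      have h3 : |∑ j ∈ s, (μ₀ - μ j)| ≤ R * M := by
        refine (Finset.abs_sum_le_sum_abs _ _).trans ?_
        calc _ ≤ ∑ _j ∈ s, M := Finset.sum_le_sum hμ
          _ = R * M := by simp [hs]
      have h4 : |B| ≤ M := by
        rw [hB, abs_mul, abs_of_pos (by positivity : 0 < 1 / (R : ℝ)), one_div,
          inv_mul_le_iff₀ hR']
        exact h3
      have := _root_.abs_le.mp h4
      linarith
  have hD2 : D ^ 2 ≤ 1 / (R : ℝ) * ∑ j ∈ s, Δ j ^ 2 := by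
    have := sq_sum_le_card_mul_sum_sq (s := s) (f := Δ)
    rw [hsR] at this
    calc D ^ 2 = (1 / (R : ℝ)) ^ 2 * (∑ j ∈ s, Δ j) ^ 2 := by rw [hD]; ring
      _ ≤ (1 / (R : ℝ)) ^ 2 * (R * ∑ j ∈ s, Δ j ^ 2) := by gcongr
      _ = _ := by field_simp
  rw [e1]
  refine le_trans ?_ (le_sq_add hδ _ _)
  have h5 : (B - (Δ₀ - D)) ^ 2 ≤ 2 * M ^ 2 + 4 * Δ₀ ^ 2 + 4 * (1 / (R : ℝ) * ∑ j ∈ s, Δ j ^ 2) := by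
    nlinarith [sq_nonneg (B + (Δ₀ - D)), sq_nonneg (Δ₀ + D)]
  -- The squared average of the noise is dropped, since only a lower bound is wanted.
  have h6 : ε₀ ^ 2 - 2 * (ε₀ * a) ≤ (ε₀ - a) ^ 2 := by nlinarith [sq_nonneg a]
  have h7 := mul_le_mul_of_nonneg_left h6 (by linarith : 0 ≤ 1 - δ)
  have h8 := mul_le_mul_of_nonneg_left h5 (by positivity : 0 ≤ 1 / δ)
  linarith

/-- The pointwise bound is summed over the interior units, whose neighbours all lie in the window,
where the decomposition of the outcome is available. The remaining units contribute non-negative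
terms, which are discarded. -/
lemma le_sum_weight_sq_mul_nnVariance {n : ℕ} (K : ℝ → ℝ) {R : ℕ} (hR : 0 < R) (h : ℝ)
    (x : Fin n → ℝ) {δ M : ℝ} (hδ : 0 < δ) (hδ1 : δ < 1) {y μ ε Δ : Fin n → ℝ}
    (hy : ∀ i, |x i| ≤ h → y i = μ i + ε i - Δ i)
    (hμ : ∀ i j, |x i| ≤ h → |x j| ≤ h → SameSide (x i) (x j) → |μ i - μ j| ≤ M) :
    (1 - δ) * (∑ i, intWeight K R h x i * ε i ^ 2 -
        2 * ∑ i, ∑ j, pairWeight K R h x i j * (ε i * ε j)) -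
      1 / δ * (2 * M ^ 2 * ∑ i, intWeight K R h x i + ∑ j, totalWeight K R h x j * Δ j ^ 2) ≤
      ∑ i, weight K h 2 0 x i ^ 2 * nnVariance R x y i := by
  have hterm : ∀ i, intWeight K R h x i *
      ((1 - δ) * (ε i ^ 2 - 2 * (ε i * (1 / (R : ℝ) * ∑ j ∈ neighbors R x i, ε j))) -
      1 / δ * (2 * M ^ 2 + 4 * Δ i ^ 2 + 4 * (1 / (R : ℝ) * ∑ j ∈ neighbors R x i, Δ j ^ 2))) ≤
      weight K h 2 0 x i ^ 2 * nnVariance R x y i := by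
    intro i
    by_cases hi : i ∈ interiorUnits R h x
    · rw [intWeight, if_pos hi]
      refine mul_le_mul_of_nonneg_left ?_ (sq_nonneg _)
      exact le_sq_sub_average _ hR (card_neighbors_of_mem_interior hi) hδ hδ1
        (hy i (mem_window_of_mem_interior hi)) (fun j hj => hy j (abs_le_of_mem_neighbors hi hj))
        (fun j hj => hμ i j (mem_window_of_mem_interior hi) (abs_le_of_mem_neighbors hi hj)
          (mem_neighbors hj).2)
    · rw [intWeight, if_neg hi, zero_mul]
      exact mul_nonneg (sq_nonneg _) (sq_nonneg _)
  refine le_trans (le_of_eq ?_) (Finset.sum_le_sum fun i _ => hterm i)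
  have e1 : ∑ i, ∑ j, pairWeight K R h x i j * (ε i * ε j) =
      ∑ i, intWeight K R h x i * (ε i * (1 / (R : ℝ) * ∑ j ∈ neighbors R x i, ε j)) := by
    refine Finset.sum_congr rfl fun i _ => ?_
    have := sum_pairWeight (R := R) K h x i ε
    calc _ = ε i * ∑ j, pairWeight K R h x i j * ε j := by
          rw [Finset.mul_sum]; exact Finset.sum_congr rfl fun j _ => by ring
      _ = _ := by rw [this]; ring
  have e2 : ∑ j, totalWeight K R h x j * Δ j ^ 2 = ∑ i, intWeight K R h x i * (4 * Δ i ^ 2) +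
      ∑ i, intWeight K R h x i * (4 * (1 / (R : ℝ) * ∑ j ∈ neighbors R x i, Δ j ^ 2)) := by
    have : ∀ i, intWeight K R h x i * (4 * (1 / (R : ℝ) * ∑ j ∈ neighbors R x i, Δ j ^ 2)) =
        ∑ j, 4 * pairWeight K R h x i j * Δ j ^ 2 := fun i => by
      have := sum_pairWeight (R := R) K h x i fun j => Δ j ^ 2
      calc _ = 4 * ∑ j, pairWeight K R h x i j * Δ j ^ 2 := by rw [this]; ring
        _ = _ := by rw [Finset.mul_sum]; exact Finset.sum_congr rfl fun j _ => by ring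
    simp_rw [this]
    rw [Finset.sum_comm, ← Finset.sum_add_distrib]
    refine Finset.sum_congr rfl fun j _ => ?_
    rw [totalWeight, add_mul, Finset.sum_mul]; ring
  rw [e1, e2]
  simp only [mul_sub, mul_add, Finset.sum_sub_distrib, Finset.sum_add_distrib, Finset.mul_sum]
  simp only [← Finset.sum_sub_distrib, ← Finset.sum_add_distrib]
  refine Finset.sum_congr rfl fun i _ => ?_
  ring_nf

/-- The interior units carry all but a small part of the total weight. -/
lemma sum_weight_sq_sub_intWeight_le {n : ℕ} (K : ℝ → ℝ) (hK : IsRDKernel K) (R : ℕ) {h : ℝ}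
    (hh : 0 < h) (x : Fin n → ℝ) {V : Fin n → ℝ} {c B : ℝ} (hB : 0 ≤ B)
    (hw : ∀ i, |weight K h 2 0 x i| ≤ c) (hV : ∀ i, V i ≤ B) :
    ∑ i, weight K h 2 0 x i ^ 2 * V i - ∑ i, intWeight K R h x i * V i ≤
      2 * R * (c ^ 2 * B) := by
  classical
  rw [← Finset.sum_sub_distrib]
  set E := windowUnits h x \ interiorUnits R h x
  have h1 : ∑ i, (weight K h 2 0 x i ^ 2 * V i - intWeight K R h x i * V i) =
      ∑ i ∈ E, (weight K h 2 0 x i ^ 2 * V i - intWeight K R h x i * V i) := by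
    symm; apply Finset.sum_subset (Finset.subset_univ _)
    intro i _ hi
    by_cases hint : i ∈ interiorUnits R h x
    · rw [intWeight, if_pos hint, sub_self]
    · have : i ∉ windowUnits h x := fun hm => hi (Finset.mem_sdiff.mpr ⟨hm, hint⟩)
      have hlt : h < |x i| := by simpa [windowUnits] using this
      rw [weight_eq_zero_of_lt x i hK hh hlt, intWeight_eq_zero K R h x hlt]; simp
  rw [h1]
  have h2 : ∀ i ∈ E, weight K h 2 0 x i ^ 2 * V i - intWeight K R h x i * V i ≤ c ^ 2 * B := by
    intro i hi
    rw [intWeight, if_neg (Finset.mem_sdiff.mp hi).2, zero_mul, sub_zero]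
    refine (mul_le_mul_of_nonneg_left (hV i) (sq_nonneg _)).trans
      (mul_le_mul_of_nonneg_right ?_ hB)
    rw [← sq_abs]
    exact pow_le_pow_left₀ (abs_nonneg _) (hw i) 2
  refine (Finset.sum_le_card_nsmul _ _ _ h2).trans ?_
  rw [nsmul_eq_mul]
  have h3 : (E.card : ℝ) ≤ 2 * R := by exact_mod_cast card_sdiff_interior_le R h x
  have : 0 ≤ c ^ 2 * B := by positivity
  gcongr

/-! ## Deviation bounds on product spaces -/

section ProductMoments

variable {ι : Type*} [Fintype ι] {U : ι → Type*} {mU : ∀ i, MeasurableSpace (U i)}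
  {ν : (i : ι) → Measure (U i)} [∀ i, IsProbabilityMeasure (ν i)]

/-- Chebyshev's inequality for a sum of independent centred variables. -/
lemma measure_le_abs_sum_le {f : (i : ι) → U i → ℝ} (hf : ∀ i, MemLp (f i) 2 (ν i))
    (h0 : ∀ i, ∫ u, f i u ∂(ν i) = 0) {δ M : ℝ} (hδ : 0 < δ)
    (hM : ∑ i, ∫ u, f i u ^ 2 ∂(ν i) ≤ M) :
    Measure.pi ν {u | δ ≤ |∑ i, f i (u i)|} ≤ ENNReal.ofReal (M / δ ^ 2) := by
  set F : ((i : ι) → U i) → ℝ := ∑ i, fun u => f i (u i) with hF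
  have hFi : ∀ i, MemLp (fun u : (i : ι) → U i => f i (u i)) 2 (Measure.pi ν) := fun i =>
    (hf i).comp_measurePreserving (measurePreserving_eval ν i)
  have hFL : MemLp F 2 (Measure.pi ν) := memLp_finsetSum' _ fun i _ => hFi i
  have hmean : ∫ u, F u ∂(Measure.pi ν) = 0 := by
    simp only [hF, Finset.sum_apply]
    rw [integral_finsetSum _ fun i _ => (hFi i).integrable (by norm_num)]
    refine Finset.sum_eq_zero fun i _ => ?_
    rw [integral_comp_eval (hf i).aestronglyMeasurable, h0]
  have hvar : Var[F; Measure.pi ν] ≤ M := by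
    rw [hF, variance_sum_pi hf]
    refine le_trans (Finset.sum_le_sum fun i _ => ?_) hM
    rw [variance_eq_integral (hf i).aestronglyMeasurable.aemeasurable, h0]
    simp
  have := meas_ge_le_variance_div_sq hFL hδ
  rw [hmean] at this
  simp only [sub_zero] at this
  refine le_trans (le_of_eq ?_) (this.trans (ENNReal.ofReal_le_ofReal (by gcongr)))
  simp [hF]

/-- Markov's inequality for a weighted sum of squares. -/
lemma measure_le_sum_mul_sq_le {f : (i : ι) → U i → ℝ} (hf : ∀ i, Measurable (f i))
    {q : ι → ℝ} (hq : ∀ i, 0 ≤ q i) {v δ M : ℝ} (hv : 0 ≤ v) (hδ : 0 < δ)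
    (hfv : ∀ i, q i ≠ 0 → ∫⁻ u, ENNReal.ofReal (f i u ^ 2) ∂(ν i) ≤ ENNReal.ofReal v)
    (hM : ∑ i, q i ≤ M) :
    Measure.pi ν {u | δ ≤ ∑ i, q i * f i (u i) ^ 2} ≤ ENNReal.ofReal (M * v / δ) := by
  have hmeas : ∀ i, Measurable fun u : (i : ι) → U i => ENNReal.ofReal (q i * f i (u i) ^ 2) :=
    fun i => ((((hf i).comp (measurable_pi_apply i)).pow_const 2).const_mul (q i)).ennreal_ofReal
  have hle : ∫⁻ u, ENNReal.ofReal (∑ i, q i * f i (u i) ^ 2) ∂(Measure.pi ν) ≤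
      ENNReal.ofReal (M * v) := by
    simp_rw [ENNReal.ofReal_sum_of_nonneg fun i _ => mul_nonneg (hq i) (sq_nonneg _)]
    rw [lintegral_finsetSum _ fun i _ => hmeas i]
    calc _ ≤ ∑ i, ENNReal.ofReal (q i * v) := by
          refine Finset.sum_le_sum fun i _ => ?_
          simp_rw [ENNReal.ofReal_mul (hq i)]
          rw [lintegral_const_mul' _ _ ENNReal.ofReal_ne_top]
          have h1 : ∫⁻ u : (i : ι) → U i, ENNReal.ofReal (f i (u i) ^ 2) ∂(Measure.pi ν) =
              ∫⁻ u, ENNReal.ofReal (f i u ^ 2) ∂(ν i) :=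
            (measurePreserving_eval ν i).lintegral_comp ((hf i).pow_const 2).ennreal_ofReal
          rw [h1]
          by_cases h0 : q i = 0
          · simp [h0]
          · gcongr; exact hfv i h0
      _ = ENNReal.ofReal (∑ i, q i * v) :=
          (ENNReal.ofReal_sum_of_nonneg fun i _ => mul_nonneg (hq i) hv).symm
      _ ≤ _ := by
          rw [← Finset.sum_mul]
          exact ENNReal.ofReal_le_ofReal (mul_le_mul_of_nonneg_right hM hv)
  have h2 := mul_meas_ge_le_lintegral (μ := Measure.pi ν)
    (f := fun u : (i : ι) → U i => ENNReal.ofReal (∑ i, q i * f i (u i) ^ 2))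
    (Finset.measurable_sum _ fun i _ =>
      (((hf i).comp (measurable_pi_apply i)).pow_const 2).const_mul (q i)).ennreal_ofReal
    (ENNReal.ofReal δ)
  have hsub : {u : (i : ι) → U i | δ ≤ ∑ i, q i * f i (u i) ^ 2} ⊆
      {u | ENNReal.ofReal δ ≤ ENNReal.ofReal (∑ i, q i * f i (u i) ^ 2)} := fun u hu =>
    ENNReal.ofReal_le_ofReal hu
  rw [ENNReal.ofReal_div_of_pos hδ, ENNReal.le_div_iff_mul_le (by simp [hδ]) (by simp), mul_comm]
  exact (mul_le_mul_right (measure_mono hsub) _).trans (h2.trans hle)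

variable [DecidableEq ι]

/-- Mixed moments of four factors, as a product over the index set. -/
lemma mul_four_eq_prod (e : (i : ι) → U i → ℝ) (i j k l : ι) (u : (i : ι) → U i) :
    e i (u i) * e j (u j) * (e k (u k) * e l (u l)) =
      ∏ m, ((if m = i then e m (u m) else 1) * (if m = j then e m (u m) else 1) *
        ((if m = k then e m (u m) else 1) * (if m = l then e m (u m) else 1))) := by
  simp only [Finset.prod_mul_distrib, Finset.prod_ite_eq', Finset.mem_univ, if_true]

/-- With i ≠ j and k ≠ l no index occurs more than twice, so second moments suffice. -/
lemma integrable_mul_four {e : (i : ι) → U i → ℝ} (he : ∀ i, MemLp (e i) 2 (ν i))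
    {i j k l : ι} (hij : i ≠ j) (hkl : k ≠ l) :
    Integrable (fun u : (i : ι) → U i => e i (u i) * e j (u j) * (e k (u k) * e l (u l)))
      (Measure.pi ν) := by
  simp_rw [mul_four_eq_prod e i j k l]
  refine Integrable.fintype_prod_dep (f := fun m w =>
    ((if m = i then e m w else 1) * (if m = j then e m w else 1) *
        ((if m = k then e m w else 1) * (if m = l then e m w else 1)))) fun m => ?_
  have h1 : Integrable (e m) (ν m) := (he m).integrable (by norm_num)
  have h2 : Integrable (fun w => e m w * e m w) (ν m) := (he m).integrable_mul (he m)
  by_cases hi : m = i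
  · have hj : m ≠ j := fun h => hij (hi.symm.trans h)
    by_cases hk : m = k
    · have hl : m ≠ l := fun h => hkl (hk.symm.trans h)
      simp only [if_pos hi, if_neg hj, if_pos hk, if_neg hl, mul_one]
      exact h2
    · by_cases hl : m = l
      · simp only [if_pos hi, if_neg hj, if_neg hk, if_pos hl, mul_one, one_mul]; exact h2
      · simp only [if_pos hi, if_neg hj, if_neg hk, if_neg hl, mul_one]; exact h1
  · by_cases hj : m = j
    · by_cases hk : m = k
      · have hl : m ≠ l := fun h => hkl (hk.symm.trans h)
        simp only [if_neg hi, if_pos hj, if_pos hk, if_neg hl, mul_one, one_mul]; exact h2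
      · by_cases hl : m = l
        · simp only [if_neg hi, if_pos hj, if_neg hk, if_pos hl, one_mul]; exact h2
        · simp only [if_neg hi, if_pos hj, if_neg hk, if_neg hl, mul_one, one_mul]; exact h1
    · by_cases hk : m = k
      · have hl : m ≠ l := fun h => hkl (hk.symm.trans h)
        simp only [if_neg hi, if_neg hj, if_pos hk, if_neg hl, mul_one, one_mul]; exact h1
      · by_cases hl : m = l
        · simp only [if_neg hi, if_neg hj, if_neg hk, if_pos hl, one_mul]; exact h1
        · simp only [if_neg hi, if_neg hj, if_neg hk, if_neg hl, mul_one]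
          exact integrable_const _

/-- The index i occurs exactly once, and its factor integrates to zero. -/
lemma integral_mul_four_eq_zero {e : (i : ι) → U i → ℝ} (h0 : ∀ i, ∫ u, e i u ∂(ν i) = 0)
    {i j k l : ι} (hij : i ≠ j) (hik : i ≠ k) (hil : i ≠ l) :
    ∫ u : (i : ι) → U i, e i (u i) * e j (u j) * (e k (u k) * e l (u l)) ∂(Measure.pi ν) = 0 := by
  simp_rw [mul_four_eq_prod e i j k l]
  rw [integral_fintype_prod_eq_prod (f := fun m w =>
    ((if m = i then e m w else 1) * (if m = j then e m w else 1) *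
        ((if m = k then e m w else 1) * (if m = l then e m w else 1))))]
  apply Finset.prod_eq_zero (Finset.mem_univ i)
  simp [hij, hik, hil, h0]

lemma integral_sq_mul_sq {e : (i : ι) → U i → ℝ} {i j : ι} (hij : i ≠ j) :
    ∫ u : (i : ι) → U i, e i (u i) * e j (u j) * (e i (u i) * e j (u j)) ∂(Measure.pi ν) =
      (∫ u, e i u ^ 2 ∂(ν i)) * ∫ u, e j u ^ 2 ∂(ν j) := by
  simp_rw [mul_four_eq_prod e i j i j]
  rw [integral_fintype_prod_eq_prod (f := fun m w =>
    ((if m = i then e m w else 1) * (if m = j then e m w else 1) *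
        ((if m = i then e m w else 1) * (if m = j then e m w else 1))))]
  have : ∀ m, ∫ w, ((if m = i then e m w else 1) * (if m = j then e m w else 1) *
        ((if m = i then e m w else 1) * (if m = j then e m w else 1))) ∂(ν m) =
      (if m = i then ∫ w, e m w ^ 2 ∂(ν m) else 1) *
        (if m = j then ∫ w, e m w ^ 2 ∂(ν m) else 1) := by
    intro m
    by_cases hi : m = i
    · have hj : m ≠ j := fun h => hij (hi.symm.trans h)
      simp only [if_pos hi, if_neg hj, mul_one, sq]
    · by_cases hj : m = j
      · simp only [if_neg hi, if_pos hj, one_mul, sq]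
      · simp [hi, hj]
  simp_rw [this]
  simp only [Finset.prod_mul_distrib, Finset.prod_ite_eq', Finset.mem_univ, if_true]

/-- Chebyshev's inequality for a quadratic form without diagonal terms. -/
lemma measure_le_abs_quadraticForm_le {e : (i : ι) → U i → ℝ} (he : ∀ i, MemLp (e i) 2 (ν i))
    (h0 : ∀ i, ∫ u, e i u ∂(ν i) = 0) {v : ℝ} (hv : ∀ i, ∫ u, e i u ^ 2 ∂(ν i) ≤ v)
    {a : ι → ι → ℝ} (ha : ∀ i, a i i = 0) {δ M : ℝ} (hδ : 0 < δ)
    (hM : ∑ i, ∑ j, a i j ^ 2 ≤ M) :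
    Measure.pi ν {u | δ ≤ |∑ i, ∑ j, a i j * (e i (u i) * e j (u j))|} ≤
      ENNReal.ofReal (2 * v ^ 2 * M / δ ^ 2) := by
  set Y : ι × ι → ((i : ι) → U i) → ℝ := fun p u => e p.1 (u p.1) * e p.2 (u p.2) with hY
  set b : ι × ι → ℝ := fun p => a p.1 p.2 with hb
  have hsum : ∀ u, ∑ i, ∑ j, a i j * (e i (u i) * e j (u j)) = ∑ p, b p * Y p u := fun u => by
    rw [Fintype.sum_prod_type]
  have hbdiag : ∀ p : ι × ι, p.1 = p.2 → b p = 0 := by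
    rintro ⟨i, j⟩ (h : i = j); subst h; exact ha i
  have hint : ∀ p q, Integrable (fun u => b p * Y p u * (b q * Y q u)) (Measure.pi ν) := by
    intro p q
    by_cases hp : p.1 = p.2
    · simp [hbdiag p hp]
    by_cases hq : q.1 = q.2
    · simp [hbdiag q hq]
    have := (integrable_mul_four he hp hq).const_mul (b p * b q)
    refine this.congr (Filter.Eventually.of_forall fun u => ?_)
    simp only [hY]; ring
  have hv0 : ∀ i, 0 ≤ ∫ u, e i u ^ 2 ∂(ν i) := fun i => integral_nonneg fun u => sq_nonneg _
  -- Products over two index pairs are uncorrelated unless the pairs agree up to order. The diagonal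
  -- q = p and the swap q = p.swap each contribute at most v² M in total, whence the constant 2.
  -- Symmetry of a is not required: the product b p * b q is bounded by the mean of the squares.
  have hcov : ∀ p q, ∫ u, b p * Y p u * (b q * Y q u) ∂(Measure.pi ν) ≤
      v ^ 2 * (if q = p then b p ^ 2 else 0) +
        v ^ 2 * (if q = p.swap then (b p ^ 2 + b q ^ 2) / 2 else 0) := by
    intro p q
    have hnn : 0 ≤ v ^ 2 * (if q = p then b p ^ 2 else 0) +
        v ^ 2 * (if q = p.swap then (b p ^ 2 + b q ^ 2) / 2 else 0) := by
      split_ifs <;> positivity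
    by_cases hp : p.1 = p.2
    · simpa [hbdiag p hp] using hnn
    by_cases hq : q.1 = q.2
    · simpa [hbdiag q hq] using hnn
    have hfac : ∫ u, b p * Y p u * (b q * Y q u) ∂(Measure.pi ν) =
        b p * b q * ∫ u, Y p u * Y q u ∂(Measure.pi ν) := by
      rw [← integral_const_mul]; congr 1; ext u; ring
    rw [hfac]
    have hpp : ∫ u, Y p u * Y p u ∂(Measure.pi ν) ≤ v ^ 2 := by
      simp only [hY]; rw [integral_sq_mul_sq hp, sq]
      exact mul_le_mul (hv _) (hv _) (hv0 _) ((hv0 p.1).trans (hv _))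
    have hpp0 : 0 ≤ ∫ u, Y p u * Y p u ∂(Measure.pi ν) :=
      integral_nonneg fun u => mul_self_nonneg _
    by_cases h1 : q = p
    · subst h1
      rw [if_pos rfl, if_neg (fun h => hq (congrArg Prod.fst h))]
      nlinarith [sq_nonneg (b q)]
    by_cases h2 : q = p.swap
    · have hYq : Y q = Y p := by subst h2; ext u; simp [hY, mul_comm]
      rw [if_neg h1, if_pos h2, hYq]
      have : b p * b q ≤ (b p ^ 2 + b q ^ 2) / 2 := by nlinarith [sq_nonneg (b p - b q)]
      calc _ ≤ (b p ^ 2 + b q ^ 2) / 2 * ∫ u, Y p u * Y p u ∂(Measure.pi ν) := by gcongr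
        _ ≤ (b p ^ 2 + b q ^ 2) / 2 * v ^ 2 := by gcongr
        _ = _ := by ring
    rw [if_neg h1, if_neg h2]
    have hz : ∫ u, Y p u * Y q u ∂(Measure.pi ν) = 0 := by
      simp only [hY]
      -- The unordered pairs differ, so one of the indices of p does not occur in q.
      by_cases ha1 : p.1 = q.1 ∨ p.1 = q.2
      · have hb1 : p.2 ≠ q.1 ∧ p.2 ≠ q.2 := by
          rcases ha1 with h | h
          · refine ⟨fun h' => hp (h.trans h'.symm), fun h' => h1 (Prod.ext h.symm h'.symm)⟩
          · refine ⟨fun h' => h2 (Prod.ext h'.symm h.symm), fun h' => hp (h.trans h'.symm)⟩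
        have := integral_mul_four_eq_zero (ν := ν) h0 (Ne.symm hp) hb1.1 hb1.2
        rw [← this]; congr 1; ext u; ring
      · push Not at ha1
        exact integral_mul_four_eq_zero (ν := ν) h0 hp ha1.1 ha1.2
    rw [hz]; simp
  have hsq : ∀ u, (∑ p, b p * Y p u) ^ 2 = ∑ p, ∑ q, b p * Y p u * (b q * Y q u) := fun u => by
    rw [sq, Finset.sum_mul_sum]
  have hI : Integrable (fun u => (∑ p, b p * Y p u) ^ 2) (Measure.pi ν) := by
    simp_rw [hsq]
    exact integrable_finsetSum _ fun p _ => integrable_finsetSum _ fun q _ => hint p q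
  have hE : ∫ u, (∑ p, b p * Y p u) ^ 2 ∂(Measure.pi ν) ≤ 2 * v ^ 2 * M := by
    simp_rw [hsq]
    rw [integral_finsetSum _ fun p _ => integrable_finsetSum _ fun q _ => hint p q]
    simp_rw [integral_finsetSum Finset.univ fun q _ => hint _ q]
    calc _ ≤ ∑ p, ∑ q, (v ^ 2 * (if q = p then b p ^ 2 else 0) +
        v ^ 2 * (if q = p.swap then (b p ^ 2 + b q ^ 2) / 2 else 0)) :=
          Finset.sum_le_sum fun p _ => Finset.sum_le_sum fun q _ => hcov p q
      _ = ∑ p, (v ^ 2 * b p ^ 2 + v ^ 2 * ((b p ^ 2 + b p.swap ^ 2) / 2)) := by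
          refine Finset.sum_congr rfl fun p _ => ?_
          rw [Finset.sum_add_distrib, ← Finset.mul_sum, ← Finset.mul_sum]
          simp
      _ = 2 * v ^ 2 * ∑ p, b p ^ 2 := by
          have hswap : ∑ p : ι × ι, b p.swap ^ 2 = ∑ p, b p ^ 2 :=
            (Equiv.prodComm ι ι).sum_comp fun p => b p ^ 2
          rw [Finset.sum_add_distrib, ← Finset.mul_sum, ← Finset.mul_sum, ← Finset.sum_div,
            Finset.sum_add_distrib, hswap]
          ring
      _ ≤ _ := by
          rw [Fintype.sum_prod_type]
          gcongr
  have hmk := mul_meas_ge_le_integral_of_nonneg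
    (Filter.Eventually.of_forall fun u => sq_nonneg (∑ p, b p * Y p u)) hI (δ ^ 2)
  have hset : {u : (i : ι) → U i | δ ≤ |∑ i, ∑ j, a i j * (e i (u i) * e j (u j))|} ⊆
      {u | δ ^ 2 ≤ (∑ p, b p * Y p u) ^ 2} := fun u hu => by
    simp only [Set.mem_ofPred_eq, hsum] at hu ⊢
    rw [← sq_abs (∑ p, b p * Y p u)]
    exact pow_le_pow_left₀ hδ.le hu 2
  refine (measure_mono hset).trans ?_
  rw [← ofReal_measureReal]
  apply ENNReal.ofReal_le_ofReal
  rw [le_div_iff₀ (by positivity), mul_comm]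
  exact hmk.trans hE

end ProductMoments

/-! ## Sums over a fold, given the data outside the fold -/

lemma piEquivPiSubtypeProd_symm_of_notMem {ι U : Type*} [DecidableEq ι] [MeasurableSpace U]
    (I : Finset ι) (a : I → U) (b : {i // i ∉ I} → U)
    (i : {i // i ∉ I}) :
    (MeasurableEquiv.piEquivPiSubtypeProd (fun _ => U) (· ∈ I)).symm (a, b) i = b i := by
  change (if h : (i : ι) ∈ I then a ⟨i, h⟩ else b ⟨i, h⟩) = _
  rw [dif_neg i.2]

lemma piEquivPiSubtypeProd_symm_of_mem {ι U : Type*} [DecidableEq ι] [MeasurableSpace U]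
    (I : Finset ι) (a : I → U) (b : {i // i ∉ I} → U)
    (i : I) :
    (MeasurableEquiv.piEquivPiSubtypeProd (fun _ => U) (· ∈ I)).symm (a, b) i = a i := by
  change (if h : (i : ι) ∈ I then a ⟨i, h⟩ else b ⟨i, h⟩) = _
  rw [dif_pos i.2]

section Fold

variable {ι : Type*} [Fintype ι] [DecidableEq ι] {U : Type*} [MeasurableSpace U]
  {ν : ι → Measure U} [∀ i, IsProbabilityMeasure (ν i)]

/-- It suffices to bound a probability conditionally on the coordinates in `I`. -/
lemma measure_fold_le (I : Finset ι) {G : Set (I → U)} {B : Set (ι → U)}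
    (hG : MeasurableSet G) (hB : MeasurableSet B) {η : ℝ≥0∞}
    (hη : ∀ a ∈ G, Measure.pi (fun i : {i // i ∉ I} => ν i)
      {b | (MeasurableEquiv.piEquivPiSubtypeProd (fun _ => U) (· ∈ I)).symm (a, b) ∈ B} ≤ η) :
    Measure.pi ν {u | (fun j : I => u j) ∈ G ∧ u ∈ B} ≤ η := by
  set e := MeasurableEquiv.piEquivPiSubtypeProd (fun _ : ι => U) (· ∈ I) with he
  have hmp := measurePreserving_piEquivPiSubtypeProd ν (· ∈ I)
  set S : Set ((I → U) × ({i // i ∉ I} → U)) := {p | p.1 ∈ G ∧ e.symm p ∈ B} with hS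
  have hSm : MeasurableSet S := (measurable_fst hG).inter (e.symm.measurable hB)
  have hpre : {u : ι → U | (fun j : I => u j) ∈ G ∧ u ∈ B} = e ⁻¹' S := by
    ext u
    have h1 : (e u).1 = fun j : I => u j := rfl
    simp only [hS, Set.mem_preimage, Set.mem_ofPred_eq, h1, MeasurableEquiv.symm_apply_apply]
  rw [hpre, hmp.measure_preimage hSm.nullMeasurableSet, Measure.prod_apply hSm]
  refine (lintegral_mono (g := fun _ => η) fun a => ?_).trans (by simp)
  by_cases ha : a ∈ G
  · refine (measure_mono fun b hb => ?_).trans (hη a ha)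
    exact hb.2
  · have : Prod.mk a ⁻¹' S = ∅ := by
      ext b; simp [hS, ha]
    simp [this]

lemma sum_compl_eq (I : Finset ι) (F : (I → U) → ι → U → ℝ) (a : I → U)
    (b : {i // i ∉ I} → U) :
    (∑ i ∈ Iᶜ, F (fun j : I =>
        (MeasurableEquiv.piEquivPiSubtypeProd (fun _ => U) (· ∈ I)).symm (a, b) j) i
        ((MeasurableEquiv.piEquivPiSubtypeProd (fun _ => U) (· ∈ I)).symm (a, b) i)) =
      ∑ i : {i // i ∉ I}, F a i (b i) := by
  have h1 : (fun j : I =>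
      (MeasurableEquiv.piEquivPiSubtypeProd (fun _ => U) (· ∈ I)).symm (a, b) j) = a :=
    funext fun j => piEquivPiSubtypeProd_symm_of_mem I a b j
  rw [h1, Finset.sum_subtype (p := (· ∉ I)) Iᶜ (by simp)]
  exact Finset.sum_congr rfl fun i _ => by rw [piEquivPiSubtypeProd_symm_of_notMem]

lemma measurable_sum_compl (I : Finset ι) {F : (I → U) → ι → U → ℝ}
    (hF : ∀ i, Measurable fun p : (I → U) × U => F p.1 i p.2) :
    Measurable fun u : ι → U => ∑ i ∈ Iᶜ, F (fun j : I => u j) i (u i) :=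
  Finset.measurable_sum _ fun i _ => by
    have h1 : Measurable fun u : ι → U => ((fun j : I => u j), u i) :=
      (measurable_pi_lambda _ fun j => measurable_pi_apply _).prodMk (measurable_pi_apply i)
    exact (hF i).comp h1

/-- Once the coordinates in I are frozen, f is a fixed function and the sum over the complement has
independent centred terms, so Chebyshev applies uniformly over G. The moment conditions are only
asked for where the coefficient is non-zero, that is, inside the window. -/
lemma measure_fold_sum_le (I : Finset ι) {G : Set (I → U)} (hG : MeasurableSet G)
    {f : (I → U) → ι → U → ℝ} (hf : ∀ i, Measurable fun p : (I → U) × U => f p.1 i p.2)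
    {c : ι → ℝ} {v δ M : ℝ} (hv : 0 ≤ v) (hδ : 0 < δ)
    (h0 : ∀ a ∈ G, ∀ i, c i ≠ 0 → ∫ u, f a i u ∂(ν i) = 0)
    (hfv : ∀ a ∈ G, ∀ i, c i ≠ 0 → ∫⁻ u, ENNReal.ofReal (f a i u ^ 2) ∂(ν i) ≤ ENNReal.ofReal v)
    (hM : ∑ i, c i ^ 2 ≤ M) :
    Measure.pi ν {u | (fun j : I => u j) ∈ G ∧ δ ≤ |∑ i ∈ Iᶜ, c i * f (fun j : I => u j) i (u i)|} ≤
      ENNReal.ofReal (M * v / δ ^ 2) := by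
  have hF : ∀ i, Measurable fun p : (I → U) × U => c i * f p.1 i p.2 := fun i =>
    (hf i).const_mul _
  refine measure_fold_le (ν := ν) I (B := {u | δ ≤ |∑ i ∈ Iᶜ, c i * f (fun j : I => u j) i (u i)|})
    hG (measurableSet_le measurable_const (by
      have := (measurable_sum_compl I (F := fun a i u => c i * f a i u) hF).norm
      simpa only [Real.norm_eq_abs] using this)) fun a ha => ?_
  have hset : {b | (MeasurableEquiv.piEquivPiSubtypeProd (fun _ => U) (· ∈ I)).symm (a, b) ∈
      {u : ι → U | δ ≤ |∑ i ∈ Iᶜ, c i * f (fun j : I => u j) i (u i)|}} =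
      {b | δ ≤ |∑ i : {i // i ∉ I}, c i * f a i (b i)|} := by
    ext b
    simp only [Set.mem_ofPred_eq]
    rw [sum_compl_eq I (fun a i u => c i * f a i u)]
  rw [hset]
  have hmeas : ∀ i, Measurable (f a i) := fun i => (hf i).comp measurable_prodMk_left
  have hL2 : ∀ i, c i ≠ 0 → MemLp (f a i) 2 (ν i) := fun i hi => by
    rw [memLp_two_iff_integrable_sq (hmeas i).aestronglyMeasurable]
    refine ⟨((hmeas i).pow_const 2).aestronglyMeasurable, ?_⟩
    rw [hasFiniteIntegral_iff_ofReal (Eventually.of_forall fun u => sq_nonneg _)]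
    exact (hfv a ha i hi).trans_lt ENNReal.ofReal_lt_top
  refine measure_le_abs_sum_le (ν := fun i : {i // i ∉ I} => ν i)
    (f := fun i u => c i * f a i u) (fun i => ?_) (fun i => ?_) hδ ?_
  · by_cases hi : c i = 0
    · simp [hi]
    · exact (hL2 i hi).const_mul _
  · rw [integral_const_mul]
    by_cases hi : c i = 0
    · simp [hi]
    · rw [h0 a ha i hi, mul_zero]
  · calc _ ≤ ∑ i : {i // i ∉ I}, c i ^ 2 * v := by
          refine Finset.sum_le_sum fun i _ => ?_
          simp_rw [mul_pow]
          rw [integral_const_mul]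
          by_cases hi : c i = 0
          · simp [hi]
          · refine mul_le_mul_of_nonneg_left ?_ (sq_nonneg _)
            rw [integral_eq_lintegral_of_nonneg_ae (Eventually.of_forall fun u => sq_nonneg _)
              ((hmeas i).pow_const 2).aestronglyMeasurable]
            exact ENNReal.toReal_le_of_le_ofReal hv (hfv a ha i hi)
      _ ≤ M * v := by
          rw [← Finset.sum_mul]
          refine mul_le_mul_of_nonneg_right (le_trans ?_ hM) hv
          rw [← Finset.sum_subtype (p := (· ∉ I)) (f := fun i => c i ^ 2) Iᶜ (by simp)]
          exact Finset.sum_le_univ_sum_of_nonneg fun i => sq_nonneg _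

/-- The same conditioning, with Markov's inequality for the sum of squares. -/
lemma measure_fold_sum_sq_le (I : Finset ι) {G : Set (I → U)} (hG : MeasurableSet G)
    {f : (I → U) → ι → U → ℝ} (hf : ∀ i, Measurable fun p : (I → U) × U => f p.1 i p.2)
    {q : ι → ℝ} (hq : ∀ i, 0 ≤ q i) {v δ M : ℝ} (hv : 0 ≤ v) (hδ : 0 < δ)
    (hfv : ∀ a ∈ G, ∀ i, q i ≠ 0 → ∫⁻ u, ENNReal.ofReal (f a i u ^ 2) ∂(ν i) ≤ ENNReal.ofReal v)
    (hM : ∑ i, q i ≤ M) :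
    Measure.pi ν {u | (fun j : I => u j) ∈ G ∧
      δ ≤ ∑ i ∈ Iᶜ, q i * f (fun j : I => u j) i (u i) ^ 2} ≤ ENNReal.ofReal (M * v / δ) := by
  have hF : ∀ i, Measurable fun p : (I → U) × U => q i * f p.1 i p.2 ^ 2 := fun i =>
    ((hf i).pow_const 2).const_mul _
  refine measure_fold_le (ν := ν) I
    (B := {u | δ ≤ ∑ i ∈ Iᶜ, q i * f (fun j : I => u j) i (u i) ^ 2})
    hG (measurableSet_le measurable_const
      (measurable_sum_compl I (F := fun a i u => q i * f a i u ^ 2) hF)) fun a ha => ?_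
  have hset : {b | (MeasurableEquiv.piEquivPiSubtypeProd (fun _ => U) (· ∈ I)).symm (a, b) ∈
      {u : ι → U | δ ≤ ∑ i ∈ Iᶜ, q i * f (fun j : I => u j) i (u i) ^ 2}} =
      {b | δ ≤ ∑ i : {i // i ∉ I}, q i * f a i (b i) ^ 2} := by
    ext b
    simp only [Set.mem_ofPred_eq]
    rw [sum_compl_eq I (fun a i u => q i * f a i u ^ 2)]
  rw [hset]
  refine measure_le_sum_mul_sq_le (ν := fun i : {i // i ∉ I} => ν i)
    (f := fun i u => f a i u) (fun i => (hf i).comp measurable_prodMk_left)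
    (fun i => hq i) hv hδ (fun i hi => hfv a ha i hi) ?_
  refine le_trans ?_ hM
  rw [← Finset.sum_subtype (p := (· ∉ I)) (f := q) Iᶜ (by simp)]
  exact Finset.sum_le_univ_sum_of_nonneg hq

end Fold

/-! ## Characteristic functions of weighted sums -/

/-- For |y| ≤ 1 this is the remainder of the exponential series; for |y| > 1 the terms themselves
add up to at most 2 + |y| + y² / 2, which is below 4 |y|³. -/
lemma norm_exp_I_mul_sub_le (y : ℝ) :
    ‖Complex.exp (y * Complex.I) - (1 + y * Complex.I - y ^ 2 / 2)‖ ≤ 4 * |y| ^ 3 := by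
  have hn : ‖(y : ℂ) * Complex.I‖ = |y| := by simp
  rcases le_or_gt |y| 1 with hy | hy
  · have h1 := Complex.exp_bound (x := y * Complex.I) (by rw [hn]; exact hy) (n := 3) (by norm_num)
    have h2 : ∑ m ∈ Finset.range 3, ((y : ℂ) * Complex.I) ^ m / (m.factorial : ℂ) =
        1 + y * Complex.I - y ^ 2 / 2 := by
      simp [Finset.sum_range_succ, mul_pow, Nat.factorial]; ring
    rw [h2, hn] at h1
    refine h1.trans ?_
    rw [mul_comm]
    gcongr
    norm_num [Nat.factorial]
  · have h1 : ‖Complex.exp (y * Complex.I)‖ = 1 := Complex.norm_exp_ofReal_mul_I y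
    have h2 : ‖(1 : ℂ) + y * Complex.I - y ^ 2 / 2‖ ≤ 1 + |y| + |y| ^ 2 / 2 := by
      refine (norm_sub_le _ _).trans (add_le_add ((norm_add_le _ _).trans (by simp)) ?_)
      simp
    refine (norm_sub_le _ _).trans ?_
    rw [h1]
    nlinarith [pow_le_pow_right₀ hy.le (show 1 ≤ 3 by norm_num),
      pow_le_pow_right₀ hy.le (show 2 ≤ 3 by norm_num), one_le_pow₀ hy.le (n := 3)]

lemma abs_exp_neg_sub_le {z : ℝ} (hz : 0 ≤ z) : |Real.exp (-z) - (1 - z)| ≤ z ^ 2 := by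
  rcases le_or_gt z 1 with h | h
  · have := Real.abs_exp_sub_one_sub_id_le (x := -z) (by rwa [abs_neg, abs_of_nonneg hz])
    rw [neg_sq] at this
    convert this using 2; ring
  · have h1 := Real.exp_pos (-z)
    have h2 : Real.exp (-z) ≤ 1 := Real.exp_le_one_iff.mpr (by linarith)
    rw [abs_le]; constructor <;> nlinarith

/-- Replacing one factor at a time. It compares the characteristic function of a sum with a product
of Gaussian ones. -/
lemma norm_prod_sub_prod_le {ι : Type*} (s : Finset ι) {z w : ι → ℂ} (hz : ∀ i ∈ s, ‖z i‖ ≤ 1)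
    (hw : ∀ i ∈ s, ‖w i‖ ≤ 1) : ‖∏ i ∈ s, z i - ∏ i ∈ s, w i‖ ≤ ∑ i ∈ s, ‖z i - w i‖ := by
  classical
  induction s using Finset.induction_on with
  | empty => simp
  | insert i s hi ih =>
    rw [Finset.prod_insert hi, Finset.prod_insert hi, Finset.sum_insert hi]
    have hz' : ‖∏ j ∈ s, z j‖ ≤ 1 := by
      rw [norm_prod]
      exact Finset.prod_le_one (fun j _ => norm_nonneg _)
        fun j hj => hz j (Finset.mem_insert_of_mem hj)
    have h1 := ih (fun j hj => hz j (Finset.mem_insert_of_mem hj))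
      fun j hj => hw j (Finset.mem_insert_of_mem hj)
    have h2 := hw i (Finset.mem_insert_self _ _)
    calc _ = ‖(z i - w i) * ∏ j ∈ s, z j + w i * (∏ j ∈ s, z j - ∏ j ∈ s, w j)‖ := by
          congr 1; ring
      _ ≤ ‖z i - w i‖ * ‖∏ j ∈ s, z j‖ + ‖w i‖ * ‖∏ j ∈ s, z j - ∏ j ∈ s, w j‖ := by
          refine (norm_add_le _ _).trans ?_
          rw [norm_mul, norm_mul]
      _ ≤ ‖z i - w i‖ * 1 + 1 * ∑ j ∈ s, ‖z j - w j‖ := by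
          gcongr
      _ = _ := by ring

/-- Second-order expansion of the characteristic function of a centred variable. -/
lemma norm_integral_exp_sub_le {U : Type*} [MeasurableSpace U] {ν : Measure U}
    [IsProbabilityMeasure ν] {e : U → ℝ} (he : MemLp e 2 ν) (h0 : ∫ u, e u ∂ν = 0) {β : ℝ}
    (h3 : Integrable (fun u => |e u| ^ 3) ν) (hβ : ∫ u, |e u| ^ 3 ∂ν ≤ β) (s : ℝ) :
    ‖∫ u, Complex.exp ((s * e u : ℝ) * Complex.I) ∂ν -
      Real.exp (-(s ^ 2 * (∫ u, e u ^ 2 ∂ν) / 2))‖ ≤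
      4 * |s| ^ 3 * β + (s ^ 2 * (∫ u, e u ^ 2 ∂ν) / 2) ^ 2 := by
  set v := ∫ u, e u ^ 2 ∂ν with hv
  have hv0 : 0 ≤ v := integral_nonneg fun u => sq_nonneg _
  have hi1 : Integrable e ν := he.integrable (by norm_num)
  have hi2 : Integrable (fun u => e u ^ 2) ν := he.integrable_sq
  have hIexp : Integrable (fun u => Complex.exp ((s * e u : ℝ) * Complex.I)) ν := by
    refine Integrable.of_bound (C := 1) ?_ (Eventually.of_forall fun u =>
      (Complex.norm_exp_ofReal_mul_I _).le)
    have := he.aestronglyMeasurable.aemeasurable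
    exact (by fun_prop :
      AEMeasurable (fun u => Complex.exp ((s * e u : ℝ) * Complex.I)) ν).aestronglyMeasurable
  have hIq :
      Integrable (fun u => (1 : ℂ) + (s * e u : ℝ) * Complex.I - (s * e u : ℝ) ^ 2 / 2) ν := by
    refine ((integrable_const _).add ((hi1.const_mul s).ofReal.mul_const _)).sub ?_
    have := ((hi2.const_mul (s ^ 2)).ofReal (𝕜 := ℂ)).div_const 2
    refine this.congr (Eventually.of_forall fun u => ?_)
    simp; ring
  have hq : ∫ u, ((1 : ℂ) + (s * e u : ℝ) * Complex.I - (s * e u : ℝ) ^ 2 / 2) ∂ν =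
      ((1 - s ^ 2 * v / 2 : ℝ) : ℂ) := by
    have hcx : Integrable (fun u => ((s * e u : ℝ) : ℂ) * Complex.I) ν :=
      (hi1.const_mul s).ofReal.mul_const _
    have hcy : Integrable (fun u => ((s * e u : ℝ) : ℂ) ^ 2 / 2) ν := by
      have := ((hi2.const_mul (s ^ 2)).ofReal (𝕜 := ℂ)).div_const 2
      refine this.congr (Eventually.of_forall fun u => ?_)
      simp; ring
    have hca : Integrable (fun u => (1 : ℂ) + ((s * e u : ℝ) : ℂ) * Complex.I) ν :=
      (integrable_const _).add hcx
    rw [integral_sub hca hcy, integral_add (integrable_const _) hcx,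
      integral_mul_const, integral_complex_ofReal, integral_const_mul, h0, integral_div]
    have h4 : ∫ u, ((s * e u : ℝ) : ℂ) ^ 2 ∂ν = ((s ^ 2 * v : ℝ) : ℂ) := by
      rw [hv, ← integral_const_mul, ← integral_complex_ofReal]
      congr 1; ext u; push_cast; ring
    rw [h4]; simp
  -- Both sides are compared with their common second-order expansion 1 - s² v / 2.
  have hA : ‖∫ u, Complex.exp ((s * e u : ℝ) * Complex.I) ∂ν - ((1 - s ^ 2 * v / 2 : ℝ) : ℂ)‖ ≤
      4 * |s| ^ 3 * β := by
    rw [← hq, ← integral_sub hIexp hIq]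
    calc _ ≤ ∫ u, 4 * |s| ^ 3 * |e u| ^ 3 ∂ν := by
          refine norm_integral_le_of_norm_le (h3.const_mul _) (Eventually.of_forall fun u => ?_)
          refine (norm_exp_I_mul_sub_le (s * e u)).trans (le_of_eq ?_)
          rw [abs_mul]; ring
      _ = 4 * |s| ^ 3 * ∫ u, |e u| ^ 3 ∂ν := integral_const_mul _ _
      _ ≤ _ := by gcongr
  have hB : ‖((1 - s ^ 2 * v / 2 : ℝ) : ℂ) - (Real.exp (-(s ^ 2 * v / 2)) : ℝ)‖ ≤
      (s ^ 2 * v / 2) ^ 2 := by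
    rw [← Complex.ofReal_sub, Complex.norm_real, Real.norm_eq_abs, abs_sub_comm]
    exact abs_exp_neg_sub_le (by positivity)
  calc _ ≤ _ := norm_sub_le_norm_sub_add_norm_sub _ ((1 - s ^ 2 * v / 2 : ℝ) : ℂ) _
    _ ≤ _ := add_le_add hA hB

/-- Gaussian approximation of the characteristic function of a standardized weighted sum of
independent centred variables. -/
lemma norm_integral_exp_sum_sub_le {ι : Type*} [Fintype ι] {U : ι → Type*}
    {mU : ∀ i, MeasurableSpace (U i)} {ν : (i : ι) → Measure (U i)}
    [∀ i, IsProbabilityMeasure (ν i)] {e : (i : ι) → U i → ℝ} (he : ∀ i, MemLp (e i) 2 (ν i))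
    (h0 : ∀ i, ∫ u, e i u ∂(ν i) = 0) {β v α c : ℝ}
    (h3 : ∀ i, Integrable (fun u => |e i u| ^ 3) (ν i)) (hβ : ∀ i, ∫ u, |e i u| ^ 3 ∂(ν i) ≤ β)
    (hβ0 : 0 ≤ β)
    (hv : ∀ i, ∫ u, e i u ^ 2 ∂(ν i) ≤ v) {a : ι → ℝ}
    (ha : ∑ i, a i ^ 2 * ∫ u, e i u ^ 2 ∂(ν i) = 1) (hα : ∀ i, |a i| ≤ α) (hα0 : 0 ≤ α)
    (hα1 : α ≤ 1) (hc : ∑ i, a i ^ 2 ≤ c) (t : ℝ) :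
    ‖∫ u : (i : ι) → U i, Complex.exp ((t * ∑ i, a i * e i (u i) : ℝ) * Complex.I) ∂(Measure.pi ν) -
      Real.exp (-(t ^ 2 / 2))‖ ≤ α * c * (4 * |t| ^ 3 * β + t ^ 4 * v ^ 2) := by
  have e1 : ∫ u : (i : ι) → U i, Complex.exp ((t * ∑ i, a i * e i (u i) : ℝ) * Complex.I)
      ∂(Measure.pi ν) = ∏ i, ∫ u, Complex.exp ((t * a i * e i u : ℝ) * Complex.I) ∂(ν i) := by
    rw [← integral_fintype_prod_eq_prod
      (f := fun i u => Complex.exp ((t * a i * e i u : ℝ) * Complex.I))]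
    congr 1; ext u
    rw [← Complex.exp_sum]
    congr 1
    rw [Finset.mul_sum]; push_cast
    rw [Finset.sum_mul]
    exact Finset.sum_congr rfl fun i _ => by ring
  -- The variances of the summands add up to one, so the Gaussian characteristic function splits
  -- into factors with matching variances.
  have e2 : ((Real.exp (-(t ^ 2 / 2)) : ℝ) : ℂ) =
      ∏ i, ((Real.exp (-((t * a i) ^ 2 * (∫ u, e i u ^ 2 ∂(ν i)) / 2)) : ℝ) : ℂ) := by
    rw [← Complex.ofReal_prod, ← Real.exp_sum]
    congr 2
    rw [Finset.sum_neg_distrib, ← Finset.sum_div]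
    congr 2
    calc t ^ 2 = t ^ 2 * ∑ i, a i ^ 2 * ∫ u, e i u ^ 2 ∂(ν i) := by rw [ha, mul_one]
      _ = _ := by rw [Finset.mul_sum]; exact Finset.sum_congr rfl fun i _ => by ring
  rw [e1, e2]
  have hv0 : ∀ i, 0 ≤ ∫ u, e i u ^ 2 ∂(ν i) := fun i => integral_nonneg fun u => sq_nonneg _
  refine (norm_prod_sub_prod_le _ (fun i _ => ?_) (fun i _ => ?_)).trans ?_
  · refine (norm_integral_le_integral_norm _).trans ?_
    simp_rw [Complex.norm_exp_ofReal_mul_I]; simp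
  · rw [Complex.norm_real, Real.norm_eq_abs, abs_of_pos (Real.exp_pos _)]
    have := hv0 i
    exact Real.exp_le_one_iff.mpr (neg_nonpos.mpr (by positivity))
  calc _ ≤ ∑ i, a i ^ 2 * (α * (4 * |t| ^ 3 * β + t ^ 4 * v ^ 2)) := by
        refine Finset.sum_le_sum fun i _ => ?_
        refine (norm_integral_exp_sub_le (he i) (h0 i) (h3 i) (hβ i) (t * a i)).trans ?_
        -- From the third- and fourth-order remainders a factor α is taken out, leaving a i ^ 2,
        -- whose sum is at most c.
        have hai : |a i| ^ 3 ≤ a i ^ 2 * α := by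
          rw [← sq_abs, pow_succ]; exact mul_le_mul_of_nonneg_left (hα i) (by positivity)
        have hai4 : a i ^ 4 ≤ a i ^ 2 * α := by
          have h5 : a i ^ 2 ≤ α := by
            rw [← sq_abs]; nlinarith [abs_nonneg (a i), hα i]
          calc a i ^ 4 = a i ^ 2 * a i ^ 2 := by ring
            _ ≤ _ := mul_le_mul_of_nonneg_left h5 (sq_nonneg _)
        have hv2 : (∫ u, e i u ^ 2 ∂(ν i)) ^ 2 ≤ v ^ 2 := pow_le_pow_left₀ (hv0 i) (hv i) 2
        calc _ = 4 * |t| ^ 3 * β * |a i| ^ 3 +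
              t ^ 4 * (a i ^ 4 * (∫ u, e i u ^ 2 ∂(ν i)) ^ 2) / 4 := by
              rw [abs_mul]; ring
          _ ≤ 4 * |t| ^ 3 * β * (a i ^ 2 * α) + t ^ 4 * (a i ^ 2 * α * v ^ 2) := by
              have h6 : t ^ 4 * (a i ^ 4 * (∫ u, e i u ^ 2 ∂(ν i)) ^ 2) ≤
                  t ^ 4 * (a i ^ 2 * α * v ^ 2) := by gcongr
              have h7 : 0 ≤ t ^ 4 * (a i ^ 4 * (∫ u, e i u ^ 2 ∂(ν i)) ^ 2) := by positivity
              have h8 : 4 * |t| ^ 3 * β * |a i| ^ 3 ≤ 4 * |t| ^ 3 * β * (a i ^ 2 * α) := by gcongr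
              linarith
          _ = _ := by ring
    _ = (∑ i, a i ^ 2) * (α * (4 * |t| ^ 3 * β + t ^ 4 * v ^ 2)) := by rw [Finset.sum_mul]
    _ ≤ c * (α * (4 * |t| ^ 3 * β + t ^ 4 * v ^ 2)) := by gcongr
    _ = _ := by ring

/-! ## The design is well behaved with high probability -/

section Design

variable {PX : Measure ℝ} {f : ℝ → ℝ}

lemma integral_withDensity_ofReal (hf : Measurable f) (hf0 : ∀ x, 0 ≤ f x) (g : ℝ → ℝ) :
    ∫ x, g x ∂(volume.withDensity fun x => ENNReal.ofReal (f x)) = ∫ x, f x * g x := by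
  rw [integral_withDensity_eq_integral_toReal_smul hf.ennreal_ofReal
    (Eventually.of_forall fun x => ENNReal.ofReal_lt_top)]
  simp only [ENNReal.toReal_ofReal (hf0 _), smul_eq_mul]

lemma integrable_of_bounded_support {φ : ℝ → ℝ} (hφ : Measurable φ) {b : ℝ} (hb : ∀ u, |φ u| ≤ b)
    (hs : ∀ u, 1 < |u| → φ u = 0) : Integrable φ := by
  have h1 : IntegrableOn φ (Set.Icc (-1) 1) :=
    Measure.integrableOn_of_bounded (M := b) (by simp) hφ.aestronglyMeasurable
      (Eventually.of_forall fun u => hb u)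
  rw [← integrableOn_univ]
  refine h1.of_forall_sdiff_eq_zero MeasurableSet.univ fun u hu => hs u ?_
  by_contra h
  exact hu.2 (_root_.abs_le.mp (not_lt.mp h))

/-- Kernel smoothing of a density that is continuous at the cutoff. -/
lemma tendsto_integral_kernel (hf : Measurable f) (hf0 : ∀ x, 0 ≤ f x) (hfc : ContinuousAt f 0)
    (hPX : PX = volume.withDensity fun x => ENNReal.ofReal (f x)) {φ : ℝ → ℝ} (hφ : Measurable φ)
    {b : ℝ} (hb : ∀ u, |φ u| ≤ b) (hs : ∀ u, 1 < |u| → φ u = 0) {h : ℕ → ℝ} (hh : ∀ n, 0 < h n)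
    (hh0 : Tendsto h atTop (𝓝 0)) :
    Tendsto (fun n => ∫ x, φ (x / h n) / h n ∂PX) atTop (𝓝 (f 0 * ∫ u, φ u)) := by
  -- Change of variables x = h u; the density is then evaluated ever closer to the cutoff.
  have hcv : ∀ n, ∫ x, φ (x / h n) / h n ∂PX = ∫ u, f (h n * u) * φ u := fun n => by
    rw [hPX, integral_withDensity_ofReal hf hf0]
    have := Measure.integral_comp_mul_left (fun x => f x * (φ (x / h n) / h n)) (h n)
    have h2 : ∀ u, f (h n * u) * (φ (h n * u / h n) / h n) = (h n)⁻¹ * (f (h n * u) * φ u) := by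
      intro u
      rw [mul_div_cancel_left₀ _ (hh n).ne']; ring
    simp_rw [h2] at this
    rw [integral_const_mul, abs_of_pos (inv_pos.mpr (hh n)), smul_eq_mul] at this
    exact (mul_left_cancel₀ (inv_pos.mpr (hh n)).ne' this).symm
  simp_rw [hcv]
  rw [← integral_const_mul]
  obtain ⟨ε, hε, hfε⟩ := Metric.continuousAt_iff.mp hfc 1 one_pos
  refine tendsto_integral_filter_of_dominated_convergence (fun u => (f 0 + 1) * |φ u|)
    (Eventually.of_forall fun n =>
      ((hf.comp (measurable_const.mul measurable_id)).mul hφ).aestronglyMeasurable) ?_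
    ((integrable_of_bounded_support hφ hb hs).abs.const_mul _) ?_
  · filter_upwards [hh0.eventually (gt_mem_nhds hε)] with n hn
    refine Eventually.of_forall fun u => ?_
    by_cases hu : 1 < |u|
    · simp [hs u hu]
    · have h1 : dist (h n * u) 0 < ε := by
        rw [Real.dist_eq, sub_zero, abs_mul, abs_of_pos (hh n)]
        nlinarith [hh n, not_lt.mp hu, abs_nonneg u]
      have h2 := hfε h1
      rw [Real.dist_eq] at h2
      rw [norm_mul, Real.norm_eq_abs, Real.norm_eq_abs, abs_of_nonneg (hf0 _)]
      gcongr
      linarith [(_root_.abs_lt.mp h2).2]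
  · refine Eventually.of_forall fun u => ?_
    have h1 : Tendsto (fun n => h n * u) atTop (𝓝 0) := by simpa using hh0.mul_const u
    exact (hfc.tendsto.comp h1).mul_const _

lemma wMoment_eq {n : ℕ} (b : Fin n → ℝ) (φ : ℝ → ℝ) (h : ℝ) (k : ℕ) (x : Fin n → ℝ) :
    wMoment b φ h k x = ∑ i, 1 / (n : ℝ) * (b i * (φ (x i / h) * (x i / h) ^ k / h)) := by
  rw [wMoment, Finset.mul_sum]
  exact Finset.sum_congr rfl fun i _ => by ring

lemma measurable_wMoment {n : ℕ} (b : Fin n → ℝ) {φ : ℝ → ℝ} (hφ : Measurable φ) (h : ℝ) (k : ℕ) :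
    Measurable (wMoment b φ h k) := by
  unfold wMoment
  fun_prop

lemma abs_mul_pow_le {φ : ℝ → ℝ} {b : ℝ} (hb : ∀ u, |φ u| ≤ b)
    (hs : ∀ u, 1 < |u| → φ u = 0) (k : ℕ) (u : ℝ) : |φ u * u ^ k| ≤ b := by
  by_cases hu : 1 < |u|
  · simpa [hs u hu] using (abs_nonneg _).trans (hb u)
  · rw [abs_mul, abs_pow]
    calc _ ≤ b * 1 := mul_le_mul (hb u) (pow_le_one₀ (abs_nonneg _) (not_lt.mp hu)) (by positivity)
          ((abs_nonneg _).trans (hb u))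
      _ = b := mul_one b

/-- Concentration of weighted rescaled moments around their means. -/
lemma exists_measure_wMoment_le [IsProbabilityMeasure PX] (hf : Measurable f) (hf0 : ∀ x, 0 ≤ f x)
    (hfc : ContinuousAt f 0) (hPX : PX = volume.withDensity fun x => ENNReal.ofReal (f x))
    {φ : ℝ → ℝ} (hφ : Measurable φ) {b : ℝ} (hb : ∀ u, |φ u| ≤ b) (hs : ∀ u, 1 < |u| → φ u = 0)
    {h : ℕ → ℝ} (hh : ∀ n, 0 < h n) (hh0 : Tendsto h atTop (𝓝 0)) (k : ℕ) :
    ∃ C : ℝ, 0 ≤ C ∧ ∀ᶠ n in atTop, ∀ a : Fin n → ℝ, (∀ i, |a i| ≤ 1) → ∀ δ : ℝ, 0 < δ →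
      Measure.pi (fun _ : Fin n => PX) {x | δ ≤ |wMoment a φ (h n) k x -
        (1 / (n : ℝ)) * (∑ i, a i) * ∫ y, φ (y / h n) * (y / h n) ^ k / h n ∂PX|} ≤
      ENNReal.ofReal (C / (n * h n * δ ^ 2)) := by
  set g : ℝ → ℝ := fun u => φ u * u ^ k with hg
  have hgm : Measurable g := hφ.mul (measurable_id.pow_const k)
  have hgb : ∀ u, |g u| ≤ b := abs_mul_pow_le hb hs k
  have hgs : ∀ u, 1 < |u| → g u = 0 := fun u hu => by simp [hg, hs u hu]
  have hb0 : 0 ≤ b := (abs_nonneg _).trans (hb 0)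
  have hlim := tendsto_integral_kernel hf hf0 hfc hPX (φ := fun u => |g u|)
    (by simpa [Real.norm_eq_abs] using hgm.norm)
    (b := b) (fun u => by simpa using hgb u) (fun u hu => by simp [hgs u hu]) hh hh0
  set L := f 0 * ∫ u, |g u| with hL
  have hL0 : 0 ≤ L := mul_nonneg (hf0 0) (integral_nonneg fun u => abs_nonneg _)
  refine ⟨b * (L + 1), by positivity, ?_⟩
  filter_upwards [hlim.eventually (gt_mem_nhds (lt_add_one L)), eventually_gt_atTop 0]
    with n hn hn0 a ha δ hδ
  have hn' : (0 : ℝ) < n := by exact_mod_cast hn0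
  have hhn := hh n
  set ψ : ℝ → ℝ := fun y => g (y / h n) / h n with hψ
  have hψm : Measurable ψ := (hgm.comp (measurable_id.div_const _)).div_const _
  have hψb : ∀ y, |ψ y| ≤ b / h n := fun y => by
    rw [hψ]; simp only [abs_div, abs_of_pos hhn]
    gcongr; exact hgb _
  have hψL : MemLp ψ 2 PX := MemLp.of_bound hψm.aestronglyMeasurable _
    (Eventually.of_forall hψb)
  have hψi : Integrable ψ PX := hψL.integrable (by norm_num)
  set m := ∫ y, ψ y ∂PX with hm
  -- One factor ψ is bounded by b / h and the other has a bounded first absolute moment. The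
  -- variance is thus O(1/h), and that of the average O(1/(nh)).
  have hsq : ∫ y, (ψ y - m) ^ 2 ∂PX ≤ b / h n * (L + 1) := by
    have h1 : ∫ y, (ψ y - m) ^ 2 ∂PX = Var[ψ; PX] :=
      (variance_eq_integral hψm.aemeasurable).symm
    rw [h1]
    calc Var[ψ; PX] ≤ ∫ y, (ψ ^ 2) y ∂PX := variance_le_expectation_sq hψm.aestronglyMeasurable
      _ ≤ ∫ y, b / h n * |ψ y| ∂PX := by
          refine integral_mono hψL.integrable_sq (hψi.abs.const_mul _) fun y => ?_
          simp only [Pi.pow_apply]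
          rw [← sq_abs, sq]
          exact mul_le_mul_of_nonneg_right (hψb y) (abs_nonneg _)
      _ = b / h n * ∫ y, |g (y / h n)| / h n ∂PX := by
          rw [integral_const_mul]
          simp only [hψ, abs_div, abs_of_pos hhn]
      _ ≤ _ := by gcongr
  have key := measure_le_abs_sum_le (ν := fun _ : Fin n => PX)
    (f := fun i y => 1 / (n : ℝ) * (a i * (ψ y - m)))
    (fun i => ((hψL.sub (memLp_const m)).const_mul _).const_mul _)
    (fun i => by
      rw [integral_const_mul, integral_const_mul, integral_sub hψi (integrable_const _)]
      simp [hm]) hδ (M := b * (L + 1) / (n * h n)) (by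
        calc _ ≤ ∑ _i : Fin n, (1 / (n : ℝ)) ^ 2 * (b / h n * (L + 1)) := by
              refine Finset.sum_le_sum fun i _ => ?_
              have h2 : ∀ y, (1 / (n : ℝ) * (a i * (ψ y - m))) ^ 2 =
                (1 / (n : ℝ)) ^ 2 * (a i ^ 2 * (ψ y - m) ^ 2) := fun y => by ring
              simp_rw [h2]
              rw [integral_const_mul, integral_const_mul]
              have h3 : a i ^ 2 ≤ 1 := by
                rw [← sq_abs]; exact pow_le_one₀ (abs_nonneg _) (ha i)
              have h4 : 0 ≤ ∫ y, (ψ y - m) ^ 2 ∂PX := integral_nonneg fun y => sq_nonneg _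
              refine mul_le_mul_of_nonneg_left ?_ (by positivity)
              nlinarith
          _ = _ := by simp; field_simp)
  refine le_trans (le_of_eq ?_) (key.trans (le_of_eq ?_))
  · congr 1
    ext x
    simp only [Set.mem_ofPred_eq]
    rw [wMoment_eq]
    have : ∑ i, 1 / (n : ℝ) * (a i * (ψ (x i) - m)) =
        ∑ i, 1 / (n : ℝ) * (a i * ψ (x i)) - 1 / (n : ℝ) * (∑ i, a i) * m := by
      rw [Finset.mul_sum, Finset.sum_mul, ← Finset.sum_sub_distrib]
      exact Finset.sum_congr rfl fun i _ => by ring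
    rw [this]
  · congr 1
    rw [div_div]

/-- Matrices close to an invertible one have inverses with bounded entries. -/
lemma exists_inv_bound (Γ : Matrix (Fin 3) (Fin 3) ℝ) (hΓ : Γ.det ≠ 0) :
    ∃ A δ : ℝ, 0 < δ ∧ ∀ G : Matrix (Fin 3) (Fin 3) ℝ, (∀ a b, |G a b - Γ a b| < δ) →
      G.det ≠ 0 ∧ ∀ a, |G⁻¹ 0 a| ≤ A := by
  let F : (Fin 3 → Fin 3 → ℝ) → Matrix (Fin 3) (Fin 3) ℝ := fun G => Matrix.of G
  have hF : Continuous F := continuous_id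
  have hdet : Continuous fun G => (F G).det := hF.matrix_det
  have hinv : ∀ a, ContinuousAt (fun G => (F G)⁻¹ 0 a) (fun i j => Γ i j) := fun a => by
    have h1 : (fun G => (F G)⁻¹ 0 a) = fun G => ((F G).det)⁻¹ * (F G).adjugate 0 a := by
      ext G
      rw [Matrix.inv_def, Ring.inverse_eq_inv', Matrix.smul_apply, smul_eq_mul]
    rw [h1]
    refine (hdet.continuousAt.inv₀ hΓ).mul ?_
    exact (hF.matrix_adjugate.matrix_elem 0 a).continuousAt
  set A := ∑ a, |Γ⁻¹ 0 a| + 1 with hA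
  have hev : ∀ᶠ G in 𝓝 (fun i j => Γ i j), (F G).det ≠ 0 ∧ ∀ a, |(F G)⁻¹ 0 a| < A := by
    refine (hdet.continuousAt.eventually_ne hΓ).and (eventually_all.mpr fun a => ?_)
    have hlt : |Γ⁻¹ 0 a| < A := by
      have h2 : |Γ⁻¹ 0 a| ≤ ∑ a, |Γ⁻¹ 0 a| := Finset.single_le_sum (f := fun a => |Γ⁻¹ 0 a|)
        (fun a _ => abs_nonneg _) (Finset.mem_univ a)
      linarith
    exact (hinv a).abs.eventually (gt_mem_nhds hlt)
  obtain ⟨δ, hδ, hball⟩ := Metric.eventually_nhds_iff.mp hev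
  refine ⟨A, δ, hδ, fun G hG => ?_⟩
  have hd : dist (fun i j => G i j) (fun i j => Γ i j) < δ := by
    rw [dist_pi_lt_iff hδ]; intro i
    rw [dist_pi_lt_iff hδ]; intro j
    rw [Real.dist_eq]; exact hG i j
  exact ⟨(hball hd).1, fun a => ((hball hd).2 a).le⟩

/-- The moment matrix of a nonzero kernel is invertible. -/
lemma det_momentMatrix_ne_zero {φ : ℝ → ℝ} (hφ : Measurable φ) (hφ0 : ∀ u, 0 ≤ φ u) {b : ℝ}
    (hb : ∀ u, |φ u| ≤ b) (hs : ∀ u, 1 < |u| → φ u = 0) (hpos : ∫ u, φ u ≠ 0) {c : ℝ}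
    (hc : c ≠ 0) :
    (Matrix.of fun i j : Fin 3 => c * ∫ u, φ u * u ^ ((i : ℕ) + j)).det ≠ 0 := by
  intro hdet
  obtain ⟨a, ha, hma⟩ := Matrix.exists_mulVec_eq_zero_iff.mpr hdet
  have hint : ∀ k : ℕ, Integrable fun u => φ u * u ^ k := fun k =>
    integrable_of_bounded_support (hφ.mul (measurable_id.pow_const k)) (abs_mul_pow_le hb hs k)
      fun u hu => by simp [hs u hu]
  set p : Polynomial ℝ := ∑ i : Fin 3, Polynomial.C (a i) * Polynomial.X ^ (i : ℕ) with hp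
  have hpe : ∀ u, p.eval u = ∑ i : Fin 3, a i * u ^ (i : ℕ) := fun u => by
    simp [hp, Polynomial.eval_finsetSum]
  -- The quadratic form of the moment matrix at a is the integral of φ p², with p the polynomial
  -- with coefficients a. A null vector would force p to vanish where φ does not.
  have hquad : ∫ u, φ u * p.eval u ^ 2 = 0 := by
    have h1 : ∀ u, φ u * p.eval u ^ 2 =
        ∑ i : Fin 3, ∑ j : Fin 3, a i * a j * (φ u * u ^ ((i : ℕ) + j)) := fun u => by
      rw [hpe, sq, Finset.sum_mul_sum, Finset.mul_sum]
      refine Finset.sum_congr rfl fun i _ => ?_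
      rw [Finset.mul_sum]
      exact Finset.sum_congr rfl fun j _ => by rw [pow_add]; ring
    simp_rw [h1]
    rw [integral_finsetSum _ fun i _ => integrable_finsetSum _ fun j _ => (hint _).const_mul _]
    refine Finset.sum_eq_zero fun i _ => ?_
    rw [integral_finsetSum _ fun j _ => (hint _).const_mul _]
    have h2 := congrFun hma i
    simp only [Matrix.mulVec, dotProduct, Matrix.of_apply, Pi.zero_apply] at h2
    have h3 : c * ∑ j : Fin 3, (∫ u, φ u * u ^ ((i : ℕ) + j)) * a j = 0 := by
      rw [Finset.mul_sum, ← h2]; exact Finset.sum_congr rfl fun j _ => by ring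
    have h4 := (mul_eq_zero.mp h3).resolve_left hc
    simp_rw [integral_const_mul]
    calc _ = a i * ∑ j : Fin 3, (∫ u, φ u * u ^ ((i : ℕ) + j)) * a j := by
          rw [Finset.mul_sum]; exact Finset.sum_congr rfl fun j _ => by ring
      _ = 0 := by rw [h4, mul_zero]
  have hquadI : Integrable fun u => φ u * p.eval u ^ 2 := by
    have h1 : (fun u => φ u * p.eval u ^ 2) = fun u =>
        ∑ i : Fin 3, ∑ j : Fin 3, a i * a j * (φ u * u ^ ((i : ℕ) + j)) := by
      ext u
      rw [hpe, sq, Finset.sum_mul_sum, Finset.mul_sum]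
      refine Finset.sum_congr rfl fun i _ => ?_
      rw [Finset.mul_sum]
      exact Finset.sum_congr rfl fun j _ => by rw [pow_add]; ring
    rw [h1]
    exact integrable_finsetSum _ fun i _ => integrable_finsetSum _ fun j _ => (hint _).const_mul _
  have hae := (integral_eq_zero_iff_of_nonneg
    (fun u => mul_nonneg (hφ0 u) (sq_nonneg _)) hquadI).mp hquad
  have hp0 : p ≠ 0 := by
    intro h0
    apply ha
    ext i
    have : p.coeff i = a i := by
      simp only [hp, Polynomial.finsetSum_coeff, Polynomial.coeff_C_mul, Polynomial.coeff_X_pow]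
      rw [Finset.sum_eq_single i]
      · simp
      · intro j _ hj
        have : (i : ℕ) ≠ j := fun h => hj (Fin.ext h.symm)
        simp [this]
      · simp
    rw [h0] at this
    simpa using this.symm
  -- A non-zero polynomial has a null set of roots, so φ = 0 almost everywhere, against its positive
  -- mass.
  have hfin : {u : ℝ | p.IsRoot u}.Finite := Polynomial.finite_setOfPred_isRoot hp0
  have hroots : ∀ᵐ u : ℝ, ¬ p.IsRoot u := by
    rw [ae_iff]; simpa using hfin.measure_zero volume
  apply hpos
  refine integral_eq_zero_of_ae ?_
  filter_upwards [hae, hroots] with u hu hr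
  simp only [Pi.zero_apply, mul_eq_zero] at hu ⊢
  exact hu.resolve_right (pow_ne_zero 2 hr)

lemma IsRDKernel.measurable_rightPart {K : ℝ → ℝ} (hK : IsRDKernel K) :
    Measurable (rightPart K) :=
  Measurable.ite measurableSet_Ici hK.measurable measurable_const

lemma IsRDKernel.measurable_leftPart {K : ℝ → ℝ} (hK : IsRDKernel K) :
    Measurable (leftPart K) :=
  Measurable.ite measurableSet_Iio hK.measurable measurable_const

/-- By symmetry each half of the kernel has mass 1/2, so neither one-sided moment matrix
degenerates. -/
lemma IsRDKernel.integral_parts {K : ℝ → ℝ} (hK : IsRDKernel K) :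
    ∫ u, rightPart K u = ∫ u, leftPart K u ∧
      (∫ u, rightPart K u) + ∫ u, leftPart K u = 1 := by
  obtain ⟨b, hb⟩ := hK.bounded
  have hr : Integrable (rightPart K) := integrable_of_bounded_support hK.measurable_rightPart
    (abs_rightPart_le (hK.abs_le hb)) fun u hu => hK.rightPart_eq_zero hu
  have hl : Integrable (leftPart K) := integrable_of_bounded_support hK.measurable_leftPart
    (abs_leftPart_le (hK.abs_le hb)) fun u hu => hK.leftPart_eq_zero hu
  constructor
  · rw [← integral_neg_eq_self (leftPart K)]
    refine integral_congr_ae ?_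
    have h0 : ∀ᵐ u : ℝ, u ≠ 0 := by simp [ae_iff]
    filter_upwards [h0] with u hu
    unfold rightPart leftPart
    rcases lt_or_gt_of_ne hu with h | h
    · rw [if_neg (not_le.mpr h), if_neg (by linarith)]
    · rw [if_pos h.le, if_pos (by linarith), hK.symmetric]
  · rw [← integral_add hr hl, ← hK.integral_eq_one]
    congr 1; ext u
    unfold rightPart leftPart
    by_cases h : 0 ≤ u
    · rw [if_pos h, if_neg (not_lt.mpr h), add_zero]
    · rw [if_neg h, if_pos (not_le.mp h), zero_add]

/-- One-sided Gram matrices are well conditioned with probability tending to one. -/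
lemma exists_tendsto_measure_gram [IsProbabilityMeasure PX] (hf : Measurable f)
    (hf0 : ∀ x, 0 ≤ f x) (hfc : ContinuousAt f 0) (hfpos : f 0 ≠ 0)
    (hPX : PX = volume.withDensity fun x => ENNReal.ofReal (f x))
    {φ : ℝ → ℝ} (hφ : Measurable φ) (hφ0 : ∀ u, 0 ≤ φ u) {b : ℝ} (hb : ∀ u, |φ u| ≤ b)
    (hs : ∀ u, 1 < |u| → φ u = 0) (hpos : ∫ u, φ u ≠ 0) {h : ℕ → ℝ} (hh : IsBandwidth h) :
    ∃ A : ℝ, Tendsto (fun n => Measure.pi (fun _ : Fin n => PX)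
      {x | ¬ ((scaledGram φ (h n) x).det ≠ 0 ∧ ∀ a, |(scaledGram φ (h n) x)⁻¹ 0 a| ≤ A)})
      atTop (𝓝 0) := by
  obtain ⟨A, δ, hδ, hA⟩ := exists_inv_bound _ (det_momentMatrix_ne_zero hφ hφ0 hb hs hpos hfpos)
  refine ⟨A, ?_⟩
  have hk : ∀ k : ℕ, Tendsto (fun n => Measure.pi (fun _ : Fin n => PX)
      {x | δ ≤ |wMoment 1 φ (h n) k x - f 0 * ∫ u, φ u * u ^ k|}) atTop (𝓝 0) := by
    intro k
    obtain ⟨C, hC0, hC⟩ := exists_measure_wMoment_le hf hf0 hfc hPX hφ hb hs hh.pos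
      hh.tendsto_zero k
    have hlim := tendsto_integral_kernel hf hf0 hfc hPX (φ := fun u => φ u * u ^ k)
      (hφ.mul (measurable_id.pow_const k)) (abs_mul_pow_le hb hs k)
      (fun u hu => by simp [hs u hu]) hh.pos hh.tendsto_zero
    have hz : Tendsto (fun n : ℕ => ENNReal.ofReal (C / (n * h n * (δ / 2) ^ 2))) atTop (𝓝 0) := by
      rw [← ENNReal.ofReal_zero]
      refine ENNReal.tendsto_ofReal (Tendsto.const_div_atTop ?_ _)
      exact hh.tendsto_mul.atTop_mul_const (by positivity)
    refine tendsto_of_tendsto_of_tendsto_of_le_of_le' tendsto_const_nhds hz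
      (Eventually.of_forall fun n => zero_le) ?_
    filter_upwards [hC, eventually_gt_atTop 0,
      (Metric.tendsto_nhds.mp hlim) (δ / 2) (by positivity)] with n hn hn0 hn1
    refine (measure_mono fun x hx => ?_).trans (hn 1 (by simp) (δ / 2) (by positivity))
    have hn' : (n : ℝ) ≠ 0 := by positivity
    simp only [Set.mem_ofPred_eq, Pi.one_apply, Finset.sum_const, Finset.card_univ,
      Fintype.card_fin, nsmul_eq_mul, mul_one, one_div_mul_cancel hn', one_mul] at hx ⊢
    rw [Real.dist_eq] at hn1
    have := abs_sub_le (wMoment 1 φ (h n) k x)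
      (∫ y, φ (y / h n) * (y / h n) ^ k / h n ∂PX) (f 0 * ∫ u, φ u * u ^ k)
    linarith
  -- The entries of the 3 × 3 matrix are moments of orders 0 to 4.
  have hsum : Tendsto (fun n => ∑ k ∈ Finset.range 5, Measure.pi (fun _ : Fin n => PX)
      {x | δ ≤ |wMoment 1 φ (h n) k x - f 0 * ∫ u, φ u * u ^ k|}) atTop (𝓝 0) := by
    simpa using tendsto_finsetSum (Finset.range 5) fun k _ => hk k
  refine tendsto_of_tendsto_of_tendsto_of_le_of_le tendsto_const_nhds hsum
    (fun n => zero_le) fun n => ?_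
  refine (measure_mono fun x hx => ?_).trans (measure_biUnion_finset_le (Finset.range 5) _)
  by_contra hcon
  apply hx
  apply hA
  intro i j
  by_contra hij
  apply hcon
  simp only [Set.mem_iUnion]
  exact ⟨(i : ℕ) + j, by rw [Finset.mem_range]; omega, not_lt.mp hij⟩

/-- Besides the two Gram matrices, the number of units in the window is n h times the zeroth moment
of the indicator of [-1, 1], which concentrates as well. No unit sits at the cutoff, since PX has a
density. -/
lemma exists_tendsto_measure_goodDesign [IsProbabilityMeasure PX] (hX : HasRunningDensity PX)
    {K : ℝ → ℝ} (hK : IsRDKernel K) {h : ℕ → ℝ} (hh : IsBandwidth h) :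
    ∃ A : ℝ, 0 < A ∧ Tendsto (fun n => Measure.pi (fun _ : Fin n => PX)
      {x | ¬ GoodDesign K (h n) A x}) atTop (𝓝 0) := by
  obtain ⟨f, hf, hf0, hPX, U, hUo, h0U, hfU, c, hc, hcU⟩ := hX
  have hfc : ContinuousAt f 0 := hfU.continuousAt (hUo.mem_nhds h0U)
  have hfpos : f 0 ≠ 0 := (hc.trans_le (hcU 0 h0U)).ne'
  obtain ⟨b, hb⟩ := hK.bounded
  have hparts := hK.integral_parts
  obtain ⟨A₁, hA₁⟩ := exists_tendsto_measure_gram hf hf0 hfc hfpos hPX hK.measurable_rightPart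
    (fun u => by unfold rightPart; split_ifs; exacts [hK.nonneg u, le_rfl])
    (abs_rightPart_le (hK.abs_le hb)) (fun u hu => hK.rightPart_eq_zero hu)
    (fun h0 => by linarith) hh
  obtain ⟨A₂, hA₂⟩ := exists_tendsto_measure_gram hf hf0 hfc hfpos hPX hK.measurable_leftPart
    (fun u => by unfold leftPart; split_ifs; exacts [hK.nonneg u, le_rfl])
    (abs_leftPart_le (hK.abs_le hb)) (fun u hu => hK.leftPart_eq_zero hu)
    (fun h0 => by linarith) hh
  set φ : ℝ → ℝ := Set.indicator (Set.Icc (-1) 1) 1 with hφ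
  have hφm : Measurable φ := measurable_one.indicator measurableSet_Icc
  have hφb : ∀ u, |φ u| ≤ 1 := fun u => by
    by_cases hu : u ∈ Set.Icc (-1 : ℝ) 1 <;> simp [hφ, hu]
  have hφs : ∀ u, 1 < |u| → φ u = 0 := fun u hu => by
    rw [hφ, Set.indicator_of_notMem]
    exact fun hm => absurd (_root_.abs_le.mpr hm) (not_le.mpr hu)
  obtain ⟨C, hC0, hC⟩ := exists_measure_wMoment_le hf hf0 hfc hPX hφm hφb hφs hh.pos
    hh.tendsto_zero 0
  have hlim := tendsto_integral_kernel hf hf0 hfc hPX hφm hφb hφs hh.pos hh.tendsto_zero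
  set L := f 0 * ∫ u, φ u with hL
  -- In L + 2, one unit covers the distance of the mean count from its limit L and one the deviation
  -- from the mean. The last 1 makes A positive.
  set A := max (max A₁ A₂) (max (L + 2) 1) with hA
  have hAp : 0 < A := lt_of_lt_of_le one_pos ((le_max_right _ _).trans (le_max_right _ _))
  refine ⟨A, hAp, ?_⟩
  have hz : Tendsto (fun n : ℕ => ENNReal.ofReal (C / (n * h n * 1 ^ 2))) atTop (𝓝 0) := by
    rw [← ENNReal.ofReal_zero]
    refine ENNReal.tendsto_ofReal (Tendsto.const_div_atTop ?_ _)
    simpa using hh.tendsto_mul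
  have hsum := (hA₁.add hA₂).add hz
  rw [add_zero, add_zero] at hsum
  refine tendsto_of_tendsto_of_tendsto_of_le_of_le' tendsto_const_nhds hsum
    (Eventually.of_forall fun n => zero_le) ?_
  filter_upwards [hC, eventually_gt_atTop 0, hlim.eventually (gt_mem_nhds (lt_add_one L))]
    with n hn hn0 hn1
  have hn' : (0 : ℝ) < n := by exact_mod_cast hn0
  have hhn := hh.pos n
  have hcount := hn 1 (by simp) 1 one_pos
  have hPX0 : PX {0} = 0 := by
    rw [hPX]; exact (withDensity_absolutelyContinuous _ _) (by simp)
  have hzero : Measure.pi (fun _ : Fin n => PX) (⋃ i, Function.eval i ⁻¹' {0}) = 0 :=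
    measure_iUnion_null fun i => Measure.pi_eval_preimage_null _ hPX0
  have hsub : {x : Fin n → ℝ | ¬ GoodDesign K (h n) A x} ⊆
      (({x | ¬ ((scaledGram (rightPart K) (h n) x).det ≠ 0 ∧
          ∀ a, |(scaledGram (rightPart K) (h n) x)⁻¹ 0 a| ≤ A₁)} ∪
        {x | ¬ ((scaledGram (leftPart K) (h n) x).det ≠ 0 ∧
          ∀ a, |(scaledGram (leftPart K) (h n) x)⁻¹ 0 a| ≤ A₂)}) ∪
        {x | 1 ≤ |wMoment 1 φ (h n) 0 x -
          (1 / (n : ℝ)) * (∑ i : Fin n, (1 : Fin n → ℝ) i) *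
            ∫ y, φ (y / h n) * (y / h n) ^ 0 / h n ∂PX|}) ∪
        (⋃ i, Function.eval i ⁻¹' {0}) := by
    intro x hx
    by_contra hcon
    simp only [Set.mem_union, not_or, Set.mem_ofPred_eq, not_not, Set.mem_iUnion, not_exists,
      Set.mem_preimage, Function.eval, Set.mem_singleton_iff, not_le] at hcon
    obtain ⟨⟨⟨hr, hl⟩, hw⟩, hne⟩ := hcon
    apply hx
    refine ⟨hr.1, hl.1, fun a => (hr.2 a).trans ((le_max_left _ _).trans (le_max_left _ _)),
      fun a => (hl.2 a).trans ((le_max_right _ _).trans (le_max_left _ _)), ?_, hne⟩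
    simp only [Pi.one_apply, Finset.sum_const, Finset.card_univ, Fintype.card_fin, nsmul_eq_mul,
      mul_one, one_div_mul_cancel hn'.ne', one_mul, pow_zero] at hw
    have h1 : wMoment 1 φ (h n) 0 x = (windowUnits (h n) x).card / (n * h n) := by
      have hφx : ∀ i, φ (x i / h n) = if |x i| ≤ h n then 1 else 0 := fun i => by
        have : x i / h n ∈ Set.Icc (-1 : ℝ) 1 ↔ |x i| ≤ h n := by
          rw [Set.mem_Icc, ← _root_.abs_le, abs_div, abs_of_pos hhn, div_le_one hhn]
        rw [hφ, Set.indicator_apply]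
        simp only [this, Pi.one_apply]
      simp only [wMoment, Pi.one_apply, one_mul, pow_zero, mul_one, hφx]
      rw [← Finset.sum_div, Finset.sum_boole, windowUnits]
      field_simp
    have h2 : (windowUnits (h n) x).card / (n * h n) ≤ A := by
      rw [← h1]
      have := (_root_.abs_lt.mp hw).2
      have h3 : L + 2 ≤ A := (le_max_left _ _).trans (le_max_right _ _)
      linarith
    rwa [div_le_iff₀ (by positivity)] at h2
  refine (measure_mono hsub).trans ((measure_union_le _ _).trans ?_)
  rw [hzero, add_zero]
  refine (measure_union_le _ _).trans (add_le_add (measure_union_le _ _) hcount)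

/-- Fold sums of rescaled moments concentrate around the corresponding share of the full sum. -/
lemma exists_measure_fold_wMoment_le [IsProbabilityMeasure PX] (hX : HasRunningDensity PX)
    {φ : ℝ → ℝ} (hφ : Measurable φ) {b : ℝ} (hb : ∀ u, |φ u| ≤ b) (hs : ∀ u, 1 < |u| → φ u = 0)
    {h : ℕ → ℝ} (hh : IsBandwidth h) (k : ℕ) :
    ∃ C : ℝ, 0 ≤ C ∧ ∀ᶠ n in atTop, ∀ a : Fin n → ℝ, (∀ i, |a i| ≤ 1) → ∑ i, a i = 0 →
      ∀ δ : ℝ, 0 < δ → Measure.pi (fun _ : Fin n => PX) {x | δ ≤ |wMoment a φ (h n) k x|} ≤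
      ENNReal.ofReal (C / (n * h n * δ ^ 2)) := by
  obtain ⟨f, hf, hf0, hPX, U, hUo, h0U, hfU, -⟩ := hX
  obtain ⟨C, hC0, hC⟩ := exists_measure_wMoment_le hf hf0 (hfU.continuousAt (hUo.mem_nhds h0U))
    hPX hφ hb hs hh.pos hh.tendsto_zero k
  refine ⟨C, hC0, ?_⟩
  filter_upwards [hC] with n hn a ha ha0 δ hδ
  simpa [ha0] using hn a ha δ hδ

end Design

/-! ## Conditioning on the running variable -/

section Conditioning

variable {n : ℕ} {U : Type*} [MeasurableSpace U]

/-- Pair up the running variables with the remaining components of the observations. -/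
def zipObs (x : Fin n → ℝ) (u : Fin n → U) (i : Fin n) : ℝ × U := (x i, u i)

@[fun_prop]
lemma measurable_zipObs : Measurable fun p : (Fin n → ℝ) × (Fin n → U) => zipObs p.1 p.2 :=
  measurable_pi_lambda _ fun i => by unfold zipObs; fun_prop

/-- The conditional law of `(u₁, …, uₙ)` given `(x₁, …, xₙ)`. -/
def piKernel (Q : Kernel ℝ U) [IsMarkovKernel Q] (n : ℕ) : Kernel (Fin n → ℝ) (Fin n → U) where
  toFun x := Measure.pi fun i => Q (x i)
  measurable' := by
    refine Measurable.measure_of_isPiSystem_of_isProbabilityMeasure generateFrom_pi.symm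
      isPiSystem_pi ?_
    rintro _ ⟨s, hs, rfl⟩
    simp_rw [Measure.pi_pi]
    refine Finset.measurable_prod _ fun i _ => ?_
    exact (Q.measurable_coe (hs i (Set.mem_univ i))).comp (measurable_pi_apply i)

lemma piKernel_apply (Q : Kernel ℝ U) [IsMarkovKernel Q] (x : Fin n → ℝ) :
    piKernel Q n x = Measure.pi fun i => Q (x i) := rfl

instance (Q : Kernel ℝ U) [IsMarkovKernel Q] : IsMarkovKernel (piKernel Q n) :=
  ⟨fun x => by rw [piKernel_apply]; infer_instance⟩

lemma lintegral_pi_prod {ι : Type*} [Fintype ι] {E : Type*} [MeasurableSpace E] (μ : Measure E)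
    [IsProbabilityMeasure μ] {g : ι → E → ℝ≥0∞} (hg : ∀ i, Measurable (g i)) :
    ∫⁻ x : ι → E, ∏ i, g i (x i) ∂(Measure.pi fun _ => μ) = ∏ i, ∫⁻ y, g i y ∂μ := by
  have hind : iIndepFun (fun i (x : ι → E) => g i (x i)) (Measure.pi fun _ => μ) :=
    iIndepFun_pi (μ := fun _ : ι => μ) (X := g) fun i => (hg i).aemeasurable
  have h1 := lintegral_prod_eq_prod_lintegral_of_indepFun Finset.univ
    (fun i (x : ι → E) => g i (x i)) hind (fun i => (hg i).comp (measurable_pi_apply i))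
  rw [h1]
  exact Finset.prod_congr rfl fun i _ =>
    (measurePreserving_eval (fun _ : ι => μ) i).lintegral_comp (hg i)

/-- The joint law of an i.i.d. sample, disintegrated along the running variables. -/
lemma map_zipObs_compProd (PX : Measure ℝ) [IsProbabilityMeasure PX] (Q : Kernel ℝ U)
    [IsMarkovKernel Q] :
    ((Measure.pi fun _ : Fin n => PX) ⊗ₘ piKernel Q n).map (fun p => zipObs p.1 p.2) =
      Measure.pi fun _ : Fin n => PX ⊗ₘ Q := by
  symm
  apply Measure.pi_eq
  intro s hs
  rw [Measure.map_apply measurable_zipObs (MeasurableSet.univ_pi hs),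
    Measure.compProd_apply (measurable_zipObs (MeasurableSet.univ_pi hs))]
  have h1 : ∀ x : Fin n → ℝ, piKernel Q n x (Prod.mk x ⁻¹'
      ((fun p : (Fin n → ℝ) × (Fin n → U) => zipObs p.1 p.2) ⁻¹' (Set.univ.pi s))) =
      ∏ i, Q (x i) (Prod.mk (x i) ⁻¹' s i) := fun x => by
    rw [piKernel_apply, ← Measure.pi_pi]
    congr 1
  simp_rw [h1]
  rw [lintegral_pi_prod PX (g := fun i y => Q y (Prod.mk y ⁻¹' s i))
    fun i => Kernel.measurable_kernel_prodMk_left (hs i)]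
  exact Finset.prod_congr rfl fun i _ => (Measure.compProd_apply (hs i)).symm

/-- The bound is integrated over the designs; outside D the event is empty. -/
lemma measure_pi_le_of_conditional (PX : Measure ℝ) [IsProbabilityMeasure PX] (Q : Kernel ℝ U)
    [IsMarkovKernel Q] {D : Set (Fin n → ℝ)} (hD : MeasurableSet D) {B : Set (Fin n → ℝ × U)}
    (hB : MeasurableSet B) {η : ℝ≥0∞}
    (hη : ∀ x ∈ D, Measure.pi (fun i => Q (x i)) {u | zipObs x u ∈ B} ≤ η) :
    Measure.pi (fun _ : Fin n => PX ⊗ₘ Q) {w | (fun i => (w i).1) ∈ D ∧ w ∈ B} ≤ η := by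
  have hfst : Measurable fun w : Fin n → ℝ × U => fun i => (w i).1 := by fun_prop
  have hS : MeasurableSet {w : Fin n → ℝ × U | (fun i => (w i).1) ∈ D ∧ w ∈ B} :=
    (hfst hD).inter hB
  rw [← map_zipObs_compProd PX Q, Measure.map_apply measurable_zipObs hS,
    Measure.compProd_apply (measurable_zipObs hS)]
  refine (lintegral_mono (g := fun _ => η) fun x => ?_).trans (by simp)
  by_cases hx : x ∈ D
  · refine (measure_mono fun u hu => ?_).trans (hη x hx)
    exact hu.2
  · have : Prod.mk x ⁻¹' ((fun p : (Fin n → ℝ) × (Fin n → U) => zipObs p.1 p.2) ⁻¹'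
        {w : Fin n → ℝ × U | (fun i => (w i).1) ∈ D ∧ w ∈ B}) = ∅ := by
      ext u
      simp only [zipObs, Set.mem_preimage, Set.mem_ofPred_eq, Set.mem_empty_iff_false, iff_false,
        not_and]
      exact fun h => absurd h hx
    rw [this]; simp

lemma map_fst_pi (PX : Measure ℝ) [IsProbabilityMeasure PX] (Q : Kernel ℝ U) [IsMarkovKernel Q]
    {D : Set (Fin n → ℝ)} (hD : MeasurableSet D) :
    Measure.pi (fun _ : Fin n => PX ⊗ₘ Q) {w | (fun i => (w i).1) ∈ D} =
      Measure.pi (fun _ : Fin n => PX) D := by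
  have hmp : MeasurePreserving (Prod.fst : ℝ × U → ℝ) (PX ⊗ₘ Q) PX :=
    ⟨measurable_fst, Measure.fst_compProd PX Q⟩
  exact (measurePreserving_pi (fun _ : Fin n => PX ⊗ₘ Q) (fun _ : Fin n => PX)
    fun _ => hmp).measure_preimage hD.nullMeasurableSet

/-- Conditional approximation of the mean of a bounded function, off a set of designs. -/
lemma norm_integral_pi_sub_le (PX : Measure ℝ) [IsProbabilityMeasure PX] (Q : Kernel ℝ U)
    [IsMarkovKernel Q] {D : Set (Fin n → ℝ)} (hD : MeasurableSet D)
    {g : (Fin n → ℝ × U) → ℂ} (hg : Measurable g) (hg1 : ∀ w, ‖g w‖ ≤ 1) {c : ℂ} (hc : ‖c‖ ≤ 1)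
    {η : ℝ} (hη0 : 0 ≤ η)
    (hη : ∀ x ∈ D, ‖∫ u, g (zipObs x u) ∂(Measure.pi fun i => Q (x i)) - c‖ ≤ η) :
    ‖∫ w, g w ∂(Measure.pi fun _ : Fin n => PX ⊗ₘ Q) - c‖ ≤
      η + 2 * (Measure.pi fun _ : Fin n => PX).real Dᶜ := by
  have hint : Integrable (fun p : (Fin n → ℝ) × (Fin n → U) => g (zipObs p.1 p.2))
      ((Measure.pi fun _ : Fin n => PX) ⊗ₘ piKernel Q n) :=
    Integrable.of_bound (hg.comp measurable_zipObs).aestronglyMeasurable 1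
      (Eventually.of_forall fun p => hg1 _)
  rw [← map_zipObs_compProd PX Q, integral_map measurable_zipObs.aemeasurable
    hg.aestronglyMeasurable, Measure.integral_compProd hint]
  have hI : Integrable (fun x => ∫ u, g (zipObs x u) ∂(piKernel Q n x))
      (Measure.pi fun _ : Fin n => PX) := hint.integral_compProd
  have h1 : (∫ x, ∫ u, g (zipObs x u) ∂(piKernel Q n x) ∂(Measure.pi fun _ : Fin n => PX)) - c =
      ∫ x, ((∫ u, g (zipObs x u) ∂(piKernel Q n x)) - c) ∂(Measure.pi fun _ : Fin n => PX) := by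
    rw [integral_sub hI (integrable_const _)]; simp
  rw [h1]
  -- Off D the difference of two numbers in the unit disc is at most 2.
  have h2 : ∀ x, ‖(∫ u, g (zipObs x u) ∂(piKernel Q n x)) - c‖ ≤
      η + Dᶜ.indicator (fun _ => (2 : ℝ)) x := fun x => by
    by_cases hx : x ∈ D
    · rw [Set.indicator_of_notMem (by simpa using hx), add_zero, piKernel_apply]
      exact hη x hx
    · rw [Set.indicator_of_mem (by simpa using hx)]
      have h3 : ‖∫ u, g (zipObs x u) ∂(piKernel Q n x)‖ ≤ 1 := by
        refine (norm_integral_le_of_norm_le_const (C := 1)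
          (Eventually.of_forall fun u => hg1 _)).trans ?_
        simp
      calc _ ≤ _ := norm_sub_le _ _
        _ ≤ η + 2 := by linarith
  refine (norm_integral_le_of_norm_le ((integrable_const _).add
    ((integrable_const _).indicator hD.compl)) (Eventually.of_forall h2)).trans (le_of_eq ?_)
  rw [integral_add' (integrable_const _) ((integrable_const _).indicator hD.compl),
    integral_indicator_const _ hD.compl]
  simp [mul_comm]

end Conditioning

/-- A probability that depends on the data and an independent fold assignment can be bounded
separately for each assignment. -/
lemma measure_split_le {Ω' E F : Type*} [MeasurableSpace Ω'] [MeasurableSpace E]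
    [MeasurableSpace F] [Fintype F] [MeasurableSingletonClass F] {P : Measure Ω'}
    [IsProbabilityMeasure P] {W : Ω' → E} {s : Ω' → F} (hs : Measurable s)
    (hind : IndepFun W s P) {B : F → Set E} (hB : ∀ σ, MeasurableSet (B σ)) {η : ℝ≥0∞}
    (hW : Measurable W) (hη : ∀ σ, P.map W (B σ) ≤ η) : P {ω | W ω ∈ B (s ω)} ≤ η := by
  have h1 : {ω | W ω ∈ B (s ω)} ⊆ ⋃ σ ∈ (Finset.univ : Finset F), W ⁻¹' (B σ) ∩ s ⁻¹' {σ} := by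
    intro ω hω
    simp only [Finset.mem_univ, Set.iUnion_true, Set.mem_iUnion]
    exact ⟨s ω, hω, rfl⟩
  have h2 : ∑ σ, P (s ⁻¹' {σ}) = 1 := by
    have h3 : ∑ σ ∈ (Finset.univ : Finset F), P (s ⁻¹' {σ}) = P (s ⁻¹' (Finset.univ : Finset F)) :=
      sum_measure_preimage_singleton _ fun σ _ => hs (measurableSet_singleton σ)
    rw [h3]; simp
  calc _ ≤ ∑ σ, P (W ⁻¹' (B σ) ∩ s ⁻¹' {σ}) :=
        (measure_mono h1).trans (measure_biUnion_finset_le _ _)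
    _ = ∑ σ, P.map W (B σ) * P (s ⁻¹' {σ}) := by
        refine Finset.sum_congr rfl fun σ _ => ?_
        rw [hind.measure_inter_preimage_eq_mul _ _ (hB σ) (measurableSet_singleton σ),
          Measure.map_apply hW (hB σ)]
    _ ≤ ∑ σ, η * P (s ⁻¹' {σ}) := Finset.sum_le_sum fun σ _ => by gcongr; exact hη σ
    _ = η := by rw [← Finset.mul_sum, h2, mul_one]

lemma IsSample.map_eq {d : ℕ → ℕ} {S : ℕ} {Ω : ℕ → Type*} [∀ n, MeasurableSpace (Ω n)]
    {P : (n : ℕ) → Measure (Ω n)} [∀ n, IsProbabilityMeasure (P n)] {PX : Measure ℝ}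
    {Q : (n : ℕ) → Kernel ℝ (ℝ × (Fin (d n) → ℝ))}
    {W : (n : ℕ) → Fin n → Ω n → Obs (d n)} {s : (n : ℕ) → Ω n → Fin n → Fin S}
    (hs : IsSample P PX Q W s) (n : ℕ) :
    (P n).map (fun ω i => W n i ω) = Measure.pi fun _ : Fin n => PX ⊗ₘ Q n := by
  rw [(iIndepFun_iff_map_fun_eq_pi_map fun i => (hs.measurable_obs n i).aemeasurable).mp
    (hs.indep_obs n)]
  simp_rw [hs.law_obs n]

/-! ## Measurability in the running variables -/

section Measurability

variable {n : ℕ}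

/-- By the cofactor formula, which with 0⁻¹ = 0 also covers singular matrices. -/
lemma measurable_matrix_inv_apply {α : Type*} [MeasurableSpace α]
    {F : α → Matrix (Fin 3) (Fin 3) ℝ} (hF : ∀ a b, Measurable fun x => F x a b) (a b : Fin 3) :
    Measurable fun x => (F x)⁻¹ a b := by
  let J : (Fin 3 → Fin 3 → ℝ) → Matrix (Fin 3) (Fin 3) ℝ := fun G => Matrix.of G
  have hJ : Continuous J := continuous_id
  have hm : Measurable fun x => (fun i j => F x i j : Fin 3 → Fin 3 → ℝ) :=
    measurable_pi_lambda _ fun i => measurable_pi_lambda _ fun j => hF i j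
  have h1 : (fun x => (F x)⁻¹ a b) = fun x => ((F x).det)⁻¹ * (F x).adjugate a b := by
    ext x
    rw [Matrix.inv_def, Ring.inverse_eq_inv', Matrix.smul_apply, smul_eq_mul]
  rw [h1]
  exact ((hJ.matrix_det.measurable.comp hm).inv).mul
    ((hJ.matrix_adjugate.matrix_elem a b).measurable.comp hm)

lemma measurable_det {α : Type*} [MeasurableSpace α]
    {F : α → Matrix (Fin 3) (Fin 3) ℝ} (hF : ∀ a b, Measurable fun x => F x a b) :
    Measurable fun x => (F x).det := by
  let J : (Fin 3 → Fin 3 → ℝ) → Matrix (Fin 3) (Fin 3) ℝ := fun G => Matrix.of G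
  have hJ : Continuous J := continuous_id
  have hm : Measurable fun x => (fun i j => F x i j : Fin 3 → Fin 3 → ℝ) :=
    measurable_pi_lambda _ fun i => measurable_pi_lambda _ fun j => hF i j
  exact hJ.matrix_det.measurable.comp hm

lemma measurable_sideWeight {k : ℝ → ℝ} (hk : Measurable k) (i : Fin n) :
    Measurable fun x : Fin n → ℝ => sideWeight k 2 0 x i := by
  have hg : ∀ a b, Measurable fun x : Fin n → ℝ => gram k 2 x a b := fun a b => by
    simp only [gram, Matrix.sum_apply, Matrix.smul_apply, Matrix.vecMulVec_apply, polyVec,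
      smul_eq_mul]
    fun_prop
  simp only [sideWeight, Matrix.mulVec, dotProduct, Pi.smul_apply, polyVec, smul_eq_mul]
  refine Finset.measurable_sum _ fun b _ => (measurable_matrix_inv_apply hg 0 b).mul ?_
  fun_prop

@[fun_prop]
lemma measurable_abs_real : Measurable fun y : ℝ => |y| := continuous_abs.measurable

lemma IsRDKernel.measurable_weight {K : ℝ → ℝ} (hK : IsRDKernel K) (h : ℝ) (i : Fin n) :
    Measurable fun x : Fin n → ℝ => weight K h 2 0 x i := by
  have hKm := hK.measurable
  have h1 : Measurable (kernelRight K h) :=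
    Measurable.ite measurableSet_Ici (by fun_prop) measurable_const
  have h2 : Measurable (kernelLeft K h) :=
    Measurable.ite measurableSet_Iio (by fun_prop) measurable_const
  exact (measurable_sideWeight h1 i).sub (measurable_sideWeight h2 i)

lemma measurableSet_sameSide (i k : Fin n) :
    MeasurableSet {x : Fin n → ℝ | SameSide (x i) (x k)} := by
  have h1 : MeasurableSet {x : Fin n → ℝ | 0 ≤ x i} :=
    measurableSet_le measurable_const (measurable_pi_apply i)
  have h2 : MeasurableSet {x : Fin n → ℝ | 0 ≤ x k} :=
    measurableSet_le measurable_const (measurable_pi_apply k)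
  have : {x : Fin n → ℝ | SameSide (x i) (x k)} =
      ({x | 0 ≤ x i} ∩ {x | 0 ≤ x k}) ∪ ({x | 0 ≤ x i}ᶜ ∩ {x | 0 ≤ x k}ᶜ) := by
    ext x
    simp only [SameSide, Set.mem_ofPred_eq, Set.mem_union, Set.mem_inter_iff, Set.mem_compl_iff]
    tauto
  rw [this]
  exact (h1.inter h2).union (h1.compl.inter h2.compl)

lemma measurableSet_closer (i k j : Fin n) :
    MeasurableSet {x : Fin n → ℝ | Closer x i k j} := by
  have h1 : MeasurableSet {x : Fin n → ℝ | |x k - x i| < |x j - x i|} :=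
    measurableSet_lt (by fun_prop) (by fun_prop)
  have h2 : MeasurableSet {x : Fin n → ℝ | |x k - x i| = |x j - x i|} :=
    measurableSet_eq_fun (by fun_prop) (by fun_prop)
  have : {x : Fin n → ℝ | Closer x i k j} =
      {x | |x k - x i| < |x j - x i|} ∪ ({x | |x k - x i| = |x j - x i|} ∩ {_x | k < j}) := by
    ext x; simp [Closer]
  rw [this]
  exact h1.union (h2.inter (MeasurableSet.const _))

lemma measurable_card_filter {α ι : Type*} [MeasurableSpace α] (s : Finset ι)
    {p : α → ι → Prop} [∀ x, DecidablePred (p x)] (hp : ∀ i, MeasurableSet {x | p x i}) :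
    Measurable fun x => (s.filter (p x)).card := by
  simp_rw [Finset.card_filter]
  refine Finset.measurable_sum _ fun i _ => ?_
  exact Measurable.ite (hp i) measurable_const measurable_const

lemma measurableSet_mem_neighbors (R : ℕ) (i j : Fin n) :
    MeasurableSet {x : Fin n → ℝ | j ∈ neighbors R x i} := by
  classical
  have h1 : Measurable fun x : Fin n → ℝ =>
      (Finset.univ.filter fun k => k ≠ i ∧ SameSide (x i) (x k) ∧ Closer x i k j).card :=
    measurable_card_filter _ fun k => (MeasurableSet.const (k ≠ i)).inter
      ((measurableSet_sameSide i k).inter (measurableSet_closer i k j))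
  have h2 := (MeasurableSet.const (α := Fin n → ℝ) (j ≠ i)).inter
    ((measurableSet_sameSide i j).inter
    (measurableSet_lt h1 (measurable_const (a := R))))
  convert h2 using 1
  ext x
  simp only [neighbors, Finset.mem_filter, Finset.mem_univ, true_and, Set.mem_inter_iff,
    Set.mem_ofPred_eq]

lemma measurableSet_mem_interior (R : ℕ) (h : ℝ) (i : Fin n) :
    MeasurableSet {x : Fin n → ℝ | i ∈ interiorUnits R h x} := by
  classical
  have hw : ∀ k : Fin n, MeasurableSet {x : Fin n → ℝ | |x k| ≤ h} := fun k =>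
    measurableSet_le (by fun_prop) measurable_const
  have hik : ∀ k : Fin n, MeasurableSet {x : Fin n → ℝ | |x i| ≤ |x k|} := fun k =>
    measurableSet_le (by fun_prop) (by fun_prop)
  have h1 : Measurable fun x : Fin n → ℝ => (Finset.univ.filter fun k =>
      |x k| ≤ h ∧ k ≠ i ∧ SameSide (x i) (x k) ∧ |x i| ≤ |x k|).card :=
    measurable_card_filter _ fun k => (hw k).inter ((MeasurableSet.const (k ≠ i)).inter
      ((measurableSet_sameSide i k).inter (hik k)))
  have h2 := (hw i).inter (measurableSet_le (measurable_const (a := R)) h1)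
  convert h2 using 1
  ext x
  simp only [interiorUnits, windowUnits, Finset.mem_filter, Finset.mem_univ, true_and,
    Set.mem_inter_iff, Set.mem_ofPred_eq, Finset.filter_filter]

lemma IsRDKernel.measurable_intWeight {K : ℝ → ℝ} (hK : IsRDKernel K) (R : ℕ) (h : ℝ)
    (i : Fin n) : Measurable fun x : Fin n → ℝ => intWeight K R h x i := by
  classical
  exact Measurable.ite (measurableSet_mem_interior R h i) ((hK.measurable_weight h i).pow_const 2)
    measurable_const

lemma IsRDKernel.measurable_pairWeight {K : ℝ → ℝ} (hK : IsRDKernel K) (R : ℕ) (h : ℝ)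
    (i j : Fin n) : Measurable fun x : Fin n → ℝ => pairWeight K R h x i j := by
  classical
  exact Measurable.ite (measurableSet_mem_neighbors R i j)
    ((hK.measurable_intWeight R h i).div_const _) measurable_const

lemma IsRDKernel.measurable_totalWeight {K : ℝ → ℝ} (hK : IsRDKernel K) (R : ℕ) (h : ℝ)
    (j : Fin n) : Measurable fun x : Fin n → ℝ => totalWeight K R h x j :=
  ((hK.measurable_intWeight R h j).const_mul _).add
    (Finset.measurable_sum _ fun i _ => (hK.measurable_pairWeight R h i j).const_mul _)

lemma IsRDKernel.measurableSet_goodDesign {K : ℝ → ℝ} (hK : IsRDKernel K) (h A : ℝ) :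
    MeasurableSet {x : Fin n → ℝ | GoodDesign K h A x} := by
  classical
  have hr : ∀ a b, Measurable fun x : Fin n → ℝ => scaledGram (rightPart K) h x a b :=
    fun a b => measurable_wMoment 1 hK.measurable_rightPart h _
  have hl : ∀ a b, Measurable fun x : Fin n → ℝ => scaledGram (leftPart K) h x a b :=
    fun a b => measurable_wMoment 1 hK.measurable_leftPart h _
  have hcard : Measurable fun x : Fin n → ℝ => ((windowUnits h x).card : ℝ) :=
    measurable_from_top.comp (measurable_card_filter Finset.univ
      (p := fun (x : Fin n → ℝ) i => |x i| ≤ h)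
      fun i => measurableSet_le (by fun_prop) measurable_const)
  have m1 : MeasurableSet {x : Fin n → ℝ | (scaledGram (rightPart K) h x).det ≠ 0} :=
    (measurable_det hr) (measurableSet_singleton 0).compl
  have m2 : MeasurableSet {x : Fin n → ℝ | (scaledGram (leftPart K) h x).det ≠ 0} :=
    (measurable_det hl) (measurableSet_singleton 0).compl
  have m3 : MeasurableSet {x : Fin n → ℝ | ∀ a, |(scaledGram (rightPart K) h x)⁻¹ 0 a| ≤ A} := by
    rw [Set.ofPred_forall]
    exact MeasurableSet.iInter fun a => measurableSet_le
      (measurable_abs_real.comp (measurable_matrix_inv_apply hr 0 a)) measurable_const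
  have m4 : MeasurableSet {x : Fin n → ℝ | ∀ a, |(scaledGram (leftPart K) h x)⁻¹ 0 a| ≤ A} := by
    rw [Set.ofPred_forall]
    exact MeasurableSet.iInter fun a => measurableSet_le
      (measurable_abs_real.comp (measurable_matrix_inv_apply hl 0 a)) measurable_const
  have m5 : MeasurableSet {x : Fin n → ℝ | ((windowUnits h x).card : ℝ) ≤ A * (n * h)} :=
    measurableSet_le hcard measurable_const
  have m6 : MeasurableSet {x : Fin n → ℝ | ∀ i, x i ≠ 0} := by
    rw [Set.ofPred_forall]
    exact MeasurableSet.iInter fun i =>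
      (measurableSet_eq_fun (measurable_pi_apply i) measurable_const).compl
  convert m1.inter (m2.inter (m3.inter (m4.inter (m5.inter m6)))) using 1
  ext x
  exact ⟨fun hx => ⟨hx.1, hx.2, hx.3, hx.4, hx.5, hx.6⟩,
    fun hx => ⟨hx.1, hx.2.1, hx.2.2.1, hx.2.2.2.1, hx.2.2.2.2.1, hx.2.2.2.2.2⟩⟩

end Measurability

/-! ## Residuals in the window -/

section Residuals

variable {d : ℕ}

/-- `E[M(η) | X = x]`. -/
def condMean (Q : Kernel ℝ (ℝ × (Fin d → ℝ))) (η : (Fin d → ℝ) → ℝ) (x : ℝ) : ℝ :=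
  ∫ u, adjOutcome η u ∂(Q x)

/-- The residual `M(η) - E[M(η) | X = x]`, set to zero outside the window. -/
def resid (Q : Kernel ℝ (ℝ × (Fin d → ℝ))) (η : (Fin d → ℝ) → ℝ) (h x : ℝ)
    (u : ℝ × (Fin d → ℝ)) : ℝ :=
  if |x| ≤ h then adjOutcome η u - condMean Q η x else 0

/-- The conditional variance of the residual. -/
def residVar (Q : Kernel ℝ (ℝ × (Fin d → ℝ))) (η : (Fin d → ℝ) → ℝ) (h x : ℝ) : ℝ :=
  ∫ u, resid Q η h x u ^ 2 ∂(Q x)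

/-- Fourth conditional moments bounded by `B` and conditional variances at least `1 / C` in the
window. -/
structure WindowMoments (Q : Kernel ℝ (ℝ × (Fin d → ℝ))) (η : (Fin d → ℝ) → ℝ) (h B C : ℝ) :
    Prop where
  measurable : Measurable η
  integrable : ∀ x, |x| ≤ h → Integrable (adjOutcome η) (Q x)
  fourth : ∀ x, |x| ≤ h → ∫⁻ u, ENNReal.ofReal ((adjOutcome η u - condMean Q η x) ^ 4) ∂(Q x) ≤
    ENNReal.ofReal B
  variance_ge : ∀ x, |x| ≤ h → x ≠ 0 → 1 / C ≤ variance (adjOutcome η) (Q x)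

variable {Q : Kernel ℝ (ℝ × (Fin d → ℝ))} [IsMarkovKernel Q] {η : (Fin d → ℝ) → ℝ} {h B C : ℝ}

lemma measurable_adjOutcome (hη : Measurable η) : Measurable (adjOutcome η) := by
  unfold adjOutcome; fun_prop

lemma measurable_condMean (hη : Measurable η) : Measurable (condMean Q η) := by
  have h1 : StronglyMeasurable (Function.uncurry fun (_ : ℝ) u => adjOutcome η u) :=
    ((measurable_adjOutcome hη).comp measurable_snd).stronglyMeasurable
  exact (h1.integral_kernel_prod_right (κ := Q)).measurable

lemma measurable_resid (hη : Measurable η) (h : ℝ) :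
    Measurable fun p : ℝ × (ℝ × (Fin d → ℝ)) => resid Q η h p.1 p.2 := by
  have h1 := measurable_adjOutcome hη
  have h2 := measurable_condMean (Q := Q) hη
  exact Measurable.ite (measurableSet_le (by fun_prop) measurable_const) (by fun_prop)
    measurable_const

lemma measurable_residVar (hη : Measurable η) (h : ℝ) : Measurable (residVar Q η h) := by
  have h1 : StronglyMeasurable (Function.uncurry fun (x : ℝ) u => resid Q η h x u ^ 2) :=
    ((measurable_resid hη h).pow_const 2).stronglyMeasurable
  exact (h1.integral_kernel_prod_right (κ := Q)).measurable

namespace WindowMoments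

lemma measurable_resid_apply (hw : WindowMoments Q η h B C) (x : ℝ) : Measurable (resid Q η h x) :=
  (measurable_resid hw.measurable h).comp measurable_prodMk_left

lemma integrable_pow_four (hw : WindowMoments Q η h B C) (x : ℝ) :
    Integrable (fun u => resid Q η h x u ^ 4) (Q x) := by
  by_cases hx : |x| ≤ h
  · have hm := hw.measurable_resid_apply x
    refine ⟨(hm.pow_const 4).aestronglyMeasurable, ?_⟩
    rw [hasFiniteIntegral_iff_ofReal (Eventually.of_forall fun u => by positivity)]
    refine lt_of_le_of_lt ?_ ((hw.fourth x hx).trans_lt ENNReal.ofReal_lt_top)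
    refine lintegral_mono fun u => ?_
    simp only [resid, if_pos hx]; exact le_rfl
  · simp [resid, hx]

lemma integral_pow_four_le (hw : WindowMoments Q η h B C) (x : ℝ) :
    ∫ u, resid Q η h x u ^ 4 ∂(Q x) ≤ |B| := by
  by_cases hx : |x| ≤ h
  · rw [integral_eq_lintegral_of_nonneg_ae (Eventually.of_forall fun u => by positivity)
      (hw.integrable_pow_four x).aestronglyMeasurable]
    refine ENNReal.toReal_le_of_le_ofReal (abs_nonneg _) ?_
    refine le_trans ?_ ((hw.fourth x hx).trans (ENNReal.ofReal_le_ofReal (le_abs_self B)))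
    refine lintegral_mono fun u => ?_
    simp only [resid, if_pos hx]; exact le_rfl
  · simp [resid, hx]

lemma integrable_abs_pow (hw : WindowMoments Q η h B C) (x : ℝ) {k : ℕ} (hk : k ≤ 4) :
    Integrable (fun u => |resid Q η h x u| ^ k) (Q x) := by
  have hm := hw.measurable_resid_apply x
  refine ((integrable_const (1 : ℝ)).add (hw.integrable_pow_four x)).mono'
    ((measurable_abs_real.comp hm).pow_const k).aestronglyMeasurable
    (Eventually.of_forall fun u => ?_)
  simp only [norm_pow, norm_abs_eq_norm, Real.norm_eq_abs, Pi.add_apply]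
  have h4 : resid Q η h x u ^ 4 = |resid Q η h x u| ^ 4 := by
    rw [← abs_pow, abs_of_nonneg (by positivity)]
  rw [h4]
  rcases le_total |resid Q η h x u| 1 with h1 | h1
  · have := pow_le_one₀ (abs_nonneg _) h1 (n := k)
    have : 0 ≤ |resid Q η h x u| ^ 4 := by positivity
    linarith
  · have := pow_le_pow_right₀ h1 hk
    linarith

lemma integral_abs_pow_le (hw : WindowMoments Q η h B C) (x : ℝ) {k : ℕ} (hk : k ≤ 4) :
    ∫ u, |resid Q η h x u| ^ k ∂(Q x) ≤ 1 + |B| := by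
  calc _ ≤ ∫ u, (1 + resid Q η h x u ^ 4) ∂(Q x) := by
        refine integral_mono (hw.integrable_abs_pow x hk)
          ((integrable_const (1 : ℝ)).add (hw.integrable_pow_four x)) fun u => ?_
        have h4 : resid Q η h x u ^ 4 = |resid Q η h x u| ^ 4 := by
          rw [← abs_pow, abs_of_nonneg (by positivity)]
        simp only
        rw [h4]
        rcases le_total |resid Q η h x u| 1 with h1 | h1
        · have := pow_le_one₀ (abs_nonneg _) h1 (n := k)
          have : 0 ≤ |resid Q η h x u| ^ 4 := by positivity
          linarith
        · have := pow_le_pow_right₀ h1 hk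
          linarith
    _ = 1 + ∫ u, resid Q η h x u ^ 4 ∂(Q x) := by
        rw [integral_add (integrable_const _) (hw.integrable_pow_four x)]; simp
    _ ≤ _ := by linarith [hw.integral_pow_four_le x]

lemma memLp_resid (hw : WindowMoments Q η h B C) (x : ℝ) : MemLp (resid Q η h x) 2 (Q x) := by
  rw [memLp_two_iff_integrable_sq (hw.measurable_resid_apply x).aestronglyMeasurable]
  simpa using hw.integrable_abs_pow x (k := 2) (by norm_num)

lemma integral_resid (hw : WindowMoments Q η h B C) (x : ℝ) : ∫ u, resid Q η h x u ∂(Q x) = 0 := by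
  by_cases hx : |x| ≤ h
  · simp only [resid, if_pos hx]
    rw [integral_sub (hw.integrable x hx) (integrable_const _)]
    simp [condMean]
  · simp [resid, hx]

lemma residVar_le (hw : WindowMoments Q η h B C) (x : ℝ) : residVar Q η h x ≤ 1 + |B| := by
  simpa [residVar] using hw.integral_abs_pow_le x (k := 2) (by norm_num)

lemma memLp_resid_sq_sub (hw : WindowMoments Q η h B C) (x : ℝ) :
    MemLp (fun u => resid Q η h x u ^ 2 - residVar Q η h x) 2 (Q x) := by
  refine MemLp.sub ?_ (memLp_const _)
  rw [memLp_two_iff_integrable_sq ((hw.measurable_resid_apply x).pow_const 2).aestronglyMeasurable]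
  refine (hw.integrable_pow_four x).congr (Eventually.of_forall fun _ => by simp; ring)

lemma integral_resid_sq_sub (hw : WindowMoments Q η h B C) (x : ℝ) :
    ∫ u, (resid Q η h x u ^ 2 - residVar Q η h x) ∂(Q x) = 0 := by
  rw [integral_sub (hw.memLp_resid x).integrable_sq (integrable_const _)]
  simp [residVar]

lemma integral_resid_sq_sub_sq_le (hw : WindowMoments Q η h B C) (x : ℝ) :
    ∫ u, (resid Q η h x u ^ 2 - residVar Q η h x) ^ 2 ∂(Q x) ≤ 1 + |B| := by
  have h1 : ∫ u, (resid Q η h x u ^ 2 - residVar Q η h x) ^ 2 ∂(Q x) =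
      Var[fun u => resid Q η h x u ^ 2; Q x] :=
    (variance_eq_integral ((hw.measurable_resid_apply x).pow_const 2).aemeasurable).symm
  rw [h1]
  refine (variance_le_expectation_sq
    ((hw.measurable_resid_apply x).pow_const 2).aestronglyMeasurable).trans ?_
  have h2 : ∫ u, ((fun u => resid Q η h x u ^ 2) ^ 2) u ∂(Q x) =
      ∫ u, resid Q η h x u ^ 4 ∂(Q x) := by
    congr 1; ext u; simp only [Pi.pow_apply]; ring
  rw [h2]
  linarith [hw.integral_pow_four_le x]

end WindowMoments

end Residuals

lemma WindowMoments.le_residVar {d : ℕ} {Q : Kernel ℝ (ℝ × (Fin d → ℝ))} {η : (Fin d → ℝ) → ℝ}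
    {h B C : ℝ} (hw : WindowMoments Q η h B C) (x : ℝ) (hx : |x| ≤ h) (hx0 : x ≠ 0) :
    1 / C ≤ residVar Q η h x := by
  refine (hw.variance_ge x hx hx0).trans (le_of_eq ?_)
  rw [variance_eq_integral (measurable_adjOutcome hw.measurable).aemeasurable]
  simp [residVar, resid, hx, condMean]

/-! ## Asymptotic normality of the oracle estimator -/

section Oracle

variable {n d : ℕ}

/-- Conditional variance of the oracle estimator given the running variables. -/
def designVar (K : ℝ → ℝ) (Q : Kernel ℝ (ℝ × (Fin d → ℝ))) (η : (Fin d → ℝ) → ℝ) (h : ℝ)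
    (x : Fin n → ℝ) : ℝ :=
  ∑ i, weight K h 2 0 x i ^ 2 * residVar Q η h (x i)

/-- Stochastic part of the oracle estimator. -/
def oracleNoise (K : ℝ → ℝ) (Q : Kernel ℝ (ℝ × (Fin d → ℝ))) (η : (Fin d → ℝ) → ℝ) (h : ℝ)
    (w : Fin n → Obs d) : ℝ :=
  ∑ i, weight K h 2 0 (fun k => (w k).1) i * resid Q η h (w i).1 (w i).2

open Classical in
/-- The standardized stochastic part, set to zero for ill-behaved designs. -/
def stdNoise (K : ℝ → ℝ) (Q : Kernel ℝ (ℝ × (Fin d → ℝ))) (η : (Fin d → ℝ) → ℝ) (h A : ℝ)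
    (w : Fin n → Obs d) : ℝ :=
  if GoodDesign K h A (fun k => (w k).1) then
    oracleNoise K Q η h w / √(designVar K Q η h fun k => (w k).1)
  else 0

variable {K : ℝ → ℝ} {Q : Kernel ℝ (ℝ × (Fin d → ℝ))} {η : (Fin d → ℝ) → ℝ} {h A B C b : ℝ}

lemma measurable_designVar [IsMarkovKernel Q] (hK : IsRDKernel K) (hη : Measurable η) (h : ℝ) :
    Measurable fun x : Fin n → ℝ => designVar K Q η h x :=
  Finset.measurable_sum _ fun i _ => ((hK.measurable_weight h i).pow_const 2).mul
    ((measurable_residVar hη h).comp (measurable_pi_apply i))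

lemma measurable_obsFst : Measurable fun w : Fin n → Obs d => fun k => (w k).1 := by fun_prop

lemma measurable_oracleNoise [IsMarkovKernel Q] (hK : IsRDKernel K) (hη : Measurable η) (h : ℝ) :
    Measurable fun w : Fin n → Obs d => oracleNoise K Q η h w :=
  Finset.measurable_sum _ fun i _ => ((hK.measurable_weight h i).comp measurable_obsFst).mul
    ((measurable_resid hη h).comp (measurable_pi_apply i))

lemma measurable_stdNoise [IsMarkovKernel Q] (hK : IsRDKernel K) (hη : Measurable η) (h A : ℝ) :
    Measurable fun w : Fin n → Obs d => stdNoise K Q η h A w := by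
  classical
  exact Measurable.ite (measurable_obsFst (hK.measurableSet_goodDesign h A))
    ((measurable_oracleNoise hK hη h).div
      (((measurable_designVar hK hη h).comp measurable_obsFst).sqrt)) measurable_const

lemma GoodDesign.sum_weight_sq_le_mul_designVar {x : Fin n → ℝ} (hx : GoodDesign K h A x)
    (hK : IsRDKernel K) (hh : 0 < h) (hC : 0 < C) (hw : WindowMoments Q η h B C) :
    ∑ i, weight K h 2 0 x i ^ 2 ≤ C * designVar K Q η h x := by
  unfold designVar
  rw [Finset.mul_sum]
  refine Finset.sum_le_sum fun i _ => ?_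
  rcases lt_or_ge h |x i| with hi | hi
  · rw [weight_eq_zero_of_lt x i hK hh hi]; simp
  · have h1 := hw.le_residVar (x i) hi (hx.ne_zero i)
    have h2 : 1 ≤ C * residVar Q η h (x i) := by
      rwa [div_le_iff₀ hC, mul_comm] at h1
    nlinarith [sq_nonneg (weight K h 2 0 x i)]

/-- The lower bound on the conditional variance against which every remainder is measured. -/
lemma GoodDesign.one_le_mul_designVar {x : Fin n → ℝ} (hx : GoodDesign K h A x)
    (hK : IsRDKernel K) (hA : 0 < A) (hn : 0 < n) (hh : 0 < h) (hC : 0 < C)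
    (hw : WindowMoments Q η h B C) :
    1 ≤ A * C * (n * h) * designVar K Q η h x := by
  have h1 := hx.one_le_mul_sum_weight_sq hK hn hh
  have h2 := hx.sum_weight_sq_le_mul_designVar hK hh hC hw
  have hn' : (0 : ℝ) < n := by exact_mod_cast hn
  calc 1 ≤ _ := h1
    _ ≤ A * (n * h) * (C * designVar K Q η h x) := by gcongr
    _ = _ := by ring

lemma GoodDesign.designVar_pos {x : Fin n → ℝ} (hx : GoodDesign K h A x)
    (hK : IsRDKernel K) (hA : 0 < A) (hn : 0 < n) (hh : 0 < h) (hC : 0 < C)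
    (hw : WindowMoments Q η h B C) : 0 < designVar K Q η h x := by
  have h1 := hx.one_le_mul_designVar hK hA hn hh hC hw
  have hn' : (0 : ℝ) < n := by exact_mod_cast hn
  by_contra hneg
  have : A * C * (n * h) * designVar K Q η h x ≤ 0 :=
    mul_nonpos_of_nonneg_of_nonpos (by positivity) (not_lt.mp hneg)
  linarith

/-- The standardized weights are at most α, because a weight is O(1/(nh)) while the standard
deviation is at least of order (nh)^{-1/2}. Their squares sum to at most C, and 1 + |B| bounds the
residual moments of orders two and three. -/
lemma GoodDesign.norm_integral_exp_stdNoise_sub_le [IsMarkovKernel Q] {x : Fin n → ℝ}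
    (hx : GoodDesign K h A x) (hK : IsRDKernel K) (hb : ∀ u, K u ≤ b) (hA : 0 < A) (hn : 0 < n)
    (hh : 0 < h) (hC : 0 < C) (hw : WindowMoments Q η h B C) {α : ℝ}
    (hα : α = 3 * A * b * √(A * C) / √(n * h)) (hα1 : α ≤ 1) (t : ℝ) :
    ‖∫ u, Complex.exp ((t * stdNoise K Q η h A (zipObs x u) : ℝ) * Complex.I)
        ∂(Measure.pi fun i => Q (x i)) - Real.exp (-(t ^ 2 / 2))‖ ≤
      α * C * (4 * |t| ^ 3 * (1 + |B|) + t ^ 4 * (1 + |B|) ^ 2) := by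
  have hn' : (0 : ℝ) < n := by exact_mod_cast hn
  have hb0 : 0 ≤ b := (hK.nonneg 0).trans (hb 0)
  have hV := hx.designVar_pos hK hA hn hh hC hw
  set V := designVar K Q η h x with hVdef
  have hsV : 0 < √V := Real.sqrt_pos.mpr hV
  set a : Fin n → ℝ := fun i => weight K h 2 0 x i / √V with ha
  have hstd : ∀ u, stdNoise K Q η h A (zipObs x u) = ∑ i, a i * resid Q η h (x i) (u i) := by
    intro u
    have h1 : (fun k => (zipObs x u k).1) = x := rfl
    rw [stdNoise, if_pos (by rw [h1]; exact hx), oracleNoise, h1, ← hVdef, Finset.sum_div]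
    refine Finset.sum_congr rfl fun i _ => ?_
    simp only [ha, zipObs]; ring
  simp_rw [hstd]
  have ha2 : ∀ i, a i ^ 2 = weight K h 2 0 x i ^ 2 / V := fun i => by
    rw [ha]; simp only [div_pow, Real.sq_sqrt hV.le]
  refine norm_integral_exp_sum_sub_le (ν := fun i => Q (x i)) (e := fun i => resid Q η h (x i))
    (fun i => hw.memLp_resid (x i)) (fun i => hw.integral_resid (x i))
    (fun i => hw.integrable_abs_pow (x i) (by norm_num))
    (fun i => hw.integral_abs_pow_le (x i) (by norm_num)) (by positivity)
    (fun i => hw.residVar_le (x i)) ?_ (fun i => ?_) (by rw [hα]; positivity) hα1 ?_ t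
  · change ∑ i, a i ^ 2 * residVar Q η h (x i) = 1
    simp_rw [ha2, div_mul_eq_mul_div]
    rw [← Finset.sum_div]
    exact div_self hV.ne'
  · have h1 := hx.abs_weight_le hK hb hn hh i
    have h2 := hx.one_le_mul_designVar hK hA hn hh hC hw
    have h3 : 1 ≤ √(A * C) * √(n * h) * √V := by
      rw [← Real.sqrt_mul (by positivity), ← Real.sqrt_mul (by positivity)]
      exact Real.one_le_sqrt.mpr h2
    simp only [ha]
    rw [abs_div, abs_of_pos hsV, hα, div_le_iff₀ hsV]
    have hs : √((n : ℝ) * h) * √(n * h) = n * h := Real.mul_self_sqrt (by positivity)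
    have hsp : 0 < √((n : ℝ) * h) := Real.sqrt_pos.mpr (by positivity)
    calc _ ≤ 3 * A * b / (n * h) := h1
      _ = 3 * A * b / (n * h) * 1 := (mul_one _).symm
      _ ≤ 3 * A * b / (n * h) * (√(A * C) * √(n * h) * √V) := by gcongr
      _ = 3 * A * b * √(A * C) * √V * (√(n * h) / (√(n * h) * √(n * h))) := by rw [hs]; ring
      _ = _ := by field_simp
  · simp_rw [ha2]
    rw [← Finset.sum_div, div_le_iff₀ hV]
    exact hx.sum_weight_sq_le_mul_designVar hK hh hC hw

/-- Asymptotic normality of the standardized stochastic part. -/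
lemma eventually_measure_stdNoise_le {d : ℕ → ℕ} {PX : Measure ℝ} [IsProbabilityMeasure PX]
    {Q : (n : ℕ) → Kernel ℝ (ℝ × (Fin (d n) → ℝ))} [∀ n, IsMarkovKernel (Q n)]
    {η : (n : ℕ) → (Fin (d n) → ℝ) → ℝ} (hη : ∀ n, Measurable (η n)) (hK : IsRDKernel K)
    {h : ℕ → ℝ} (hh : IsBandwidth h) (hA : 0 < A) (hC : 0 < C)
    (hgood : Tendsto (fun n => Measure.pi (fun _ : Fin n => PX) {x | ¬ GoodDesign K (h n) A x})
      atTop (𝓝 0))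
    (hw : ∀ᶠ n in atTop, WindowMoments (Q n) (η n) (h n) B C) {y ε : ℝ} (hε : 0 < ε) :
    ∀ᶠ n in atTop, Measure.pi (fun _ : Fin n => PX ⊗ₘ Q n)
      {w | y ≤ |stdNoise K (Q n) (η n) (h n) A w|} ≤
      gaussianReal 0 1 {z | y ≤ |z|} + ENNReal.ofReal ε := by
  obtain ⟨b, hb⟩ := hK.bounded
  have hb0 : 0 ≤ b := (hK.nonneg 0).trans (hb 0)
  set T : (n : ℕ) → (Fin n → Obs (d n)) → ℝ := fun n w => stdNoise K (Q n) (η n) (h n) A w with hT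
  have hTm : ∀ n, Measurable (T n) := fun n => measurable_stdNoise hK (hη n) (h n) A
  set μ : ℕ → ProbabilityMeasure ℝ := fun n =>
    ⟨(Measure.pi fun _ : Fin n => PX ⊗ₘ Q n).map (T n),
      Measure.isProbabilityMeasure_map (hTm n).aemeasurable⟩ with hμ
  set γ : ProbabilityMeasure ℝ := ⟨gaussianReal 0 1, inferInstance⟩ with hγ
  have hconv : Tendsto μ atTop (𝓝 γ) := by
    -- Lévy's continuity theorem; the bad designs cost twice their vanishing probability.
    refine ProbabilityMeasure.tendsto_of_tendsto_charFun fun t => ?_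
    have hcγ : charFun (γ : Measure ℝ) t = Real.exp (-(t ^ 2 / 2)) := by
      simp only [hγ, ProbabilityMeasure.coe_mk]
      rw [charFun_gaussianReal]
      push_cast
      congr 1
      simp
    have hcμ : ∀ n, charFun (μ n : Measure ℝ) t =
        ∫ w, Complex.exp ((t * T n w : ℝ) * Complex.I)
          ∂(Measure.pi fun _ : Fin n => PX ⊗ₘ Q n) := by
      intro n
      simp only [hμ, ProbabilityMeasure.coe_mk]
      rw [charFun_apply_real, integral_map (hTm n).aemeasurable (by fun_prop)]
      simp
    rw [hcγ]
    simp_rw [hcμ]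
    rw [tendsto_iff_norm_sub_tendsto_zero]
    set α : ℕ → ℝ := fun n => 3 * A * b * √(A * C) / √(n * h n) with hα
    have hα0 : Tendsto α atTop (𝓝 0) :=
      Tendsto.const_div_atTop (Real.tendsto_sqrt_atTop.comp hh.tendsto_mul) _
    set D : (n : ℕ) → Set (Fin n → ℝ) := fun n => {x | GoodDesign K (h n) A x}
    have hDreal : Tendsto (fun n => (Measure.pi fun _ : Fin n => PX).real (D n)ᶜ) atTop (𝓝 0) := by
      have := (ENNReal.tendsto_toReal ENNReal.zero_ne_top).comp hgood
      simpa [Measure.real, D, Function.comp_def, Set.compl_def] using this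
    have hbound : Tendsto (fun n => α n * C * (4 * |t| ^ 3 * (1 + |B|) + t ^ 4 * (1 + |B|) ^ 2) +
        2 * (Measure.pi fun _ : Fin n => PX).real (D n)ᶜ) atTop (𝓝 0) := by
      simpa using ((hα0.mul_const C).mul_const
        (4 * |t| ^ 3 * (1 + |B|) + t ^ 4 * (1 + |B|) ^ 2)).add (hDreal.const_mul 2)
    refine squeeze_zero' (Eventually.of_forall fun n => norm_nonneg _) ?_ hbound
    filter_upwards [hw, hα0.eventually (ge_mem_nhds one_pos), eventually_gt_atTop 0]
      with n hn hn1 hn0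
    refine norm_integral_pi_sub_le PX (Q n) (hK.measurableSet_goodDesign (h n) A)
      (g := fun w => Complex.exp ((t * T n w : ℝ) * Complex.I)) ?_
      (fun w => (Complex.norm_exp_ofReal_mul_I _).le) ?_ ?_ fun x hx => ?_
    · have := hTm n
      fun_prop
    · rw [Complex.norm_real, Real.norm_eq_abs, abs_of_pos (Real.exp_pos _)]
      exact Real.exp_le_one_iff.mpr (by nlinarith [sq_nonneg t])
    · have : 0 ≤ α n := by rw [hα]; positivity
      positivity
    · exact GoodDesign.norm_integral_exp_stdNoise_sub_le hx hK hb hA hn0 (hh.pos n) hC hn rfl hn1 t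
  -- For closed sets the portmanteau theorem bounds the limsup, which is the direction needed.
  have hclosed : IsClosed {z : ℝ | y ≤ |z|} := isClosed_le continuous_const continuous_abs
  have hlim := ProbabilityMeasure.limsup_measure_closed_le_of_tendsto hconv hclosed
  have hlt : (γ : Measure ℝ) {z | y ≤ |z|} < gaussianReal 0 1 {z | y ≤ |z|} + ENNReal.ofReal ε :=
    ENNReal.lt_add_right (measure_ne_top _ _) (by simpa using hε)
  filter_upwards [eventually_lt_of_limsup_lt (hlim.trans_lt hlt)] with n hn
  refine le_trans (le_of_eq ?_) hn.le
  simp only [hμ, ProbabilityMeasure.coe_mk]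
  rw [Measure.map_apply (hTm n) hclosed.measurableSet]
  rfl

end Oracle

/-! ## Conditional deviation bounds for the noise terms -/

section FirstStage

variable {n d : ℕ}

/-- `η̂(Z) - η̄(Z)`, where `η̂` is computed from the data `a` of the units in `I`. -/
def stageError (est : FirstStageEstimator n d) (η : (Fin d → ℝ) → ℝ) (I : Finset (Fin n))
    (a : I → Obs d) (u : ℝ × (Fin d → ℝ)) : ℝ :=
  est I a u.2 - η u.2

/-- `E[η̂(Z) - η̄(Z) | X = x]` for a given first-stage estimate. -/
def stageErrorMean (Q : Kernel ℝ (ℝ × (Fin d → ℝ))) (est : FirstStageEstimator n d)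
    (η : (Fin d → ℝ) → ℝ) (I : Finset (Fin n)) (a : I → Obs d) (x : ℝ) : ℝ :=
  ∫ u, stageError est η I a u ∂(Q x)

/-- The conditional mean squared first-stage error is at most `V` at the sampled points of the
window. -/
def StageErrorBound (Q : Kernel ℝ (ℝ × (Fin d → ℝ))) (est : FirstStageEstimator n d)
    (η : (Fin d → ℝ) → ℝ) (h V : ℝ) (I : Finset (Fin n)) (a : I → Obs d) (x : Fin n → ℝ) : Prop :=
  ∀ i, |x i| ≤ h → ∫⁻ u, ENNReal.ofReal (stageError est η I a u ^ 2) ∂(Q (x i)) ≤ ENNReal.ofReal V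

variable {Q : Kernel ℝ (ℝ × (Fin d → ℝ))} [IsMarkovKernel Q] {est : FirstStageEstimator n d}
  {η : (Fin d → ℝ) → ℝ} {I : Finset (Fin n)}

lemma measurable_stageError
    (hest : Measurable fun p : (I → Obs d) × (Fin d → ℝ) => est I p.1 p.2) (hη : Measurable η) :
    Measurable fun p : (I → Obs d) × (ℝ × (Fin d → ℝ)) => stageError est η I p.1 p.2 := by
  have h1 : Measurable fun p : (I → Obs d) × (ℝ × (Fin d → ℝ)) => est I p.1 p.2.2 :=
    hest.comp (measurable_fst.prodMk (measurable_snd.comp measurable_snd))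
  exact h1.sub (hη.comp (measurable_snd.comp measurable_snd))

lemma measurable_stageErrorMean
    (hest : Measurable fun p : (I → Obs d) × (Fin d → ℝ) => est I p.1 p.2) (hη : Measurable η) :
    Measurable fun p : (I → Obs d) × ℝ => stageErrorMean Q est η I p.1 p.2 := by
  have h1 : Measurable (Function.uncurry fun (p : (I → Obs d) × ℝ) (u : ℝ × (Fin d → ℝ)) =>
      stageError est η I p.1 u) :=
    (measurable_stageError hest hη).comp
      ((measurable_fst.comp measurable_fst).prodMk measurable_snd)
  exact (h1.stronglyMeasurable.integral_kernel_prod_right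
    (κ := Q.comap (Prod.snd : (I → Obs d) × ℝ → ℝ) measurable_snd)).measurable

lemma measurable_lintegral_stageError
    (hest : Measurable fun p : (I → Obs d) × (Fin d → ℝ) => est I p.1 p.2) (hη : Measurable η) :
    Measurable fun p : (I → Obs d) × ℝ =>
      ∫⁻ u, ENNReal.ofReal (stageError est η I p.1 u ^ 2) ∂(Q p.2) := by
  have h1 : Measurable (Function.uncurry fun (p : (I → Obs d) × ℝ) (u : ℝ × (Fin d → ℝ)) =>
      ENNReal.ofReal (stageError est η I p.1 u ^ 2)) :=
    (((measurable_stageError hest hη).comp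
      ((measurable_fst.comp measurable_fst).prodMk measurable_snd)).pow_const 2).ennreal_ofReal
  exact h1.lintegral_kernel_prod_right
    (κ := Q.comap (Prod.snd : (I → Obs d) × ℝ → ℝ) measurable_snd)

lemma measurableSet_stageErrorBound
    (hest : Measurable fun p : (I → Obs d) × (Fin d → ℝ) => est I p.1 p.2) (hη : Measurable η)
    (h V : ℝ) :
    MeasurableSet {p : (I → Obs d) × (Fin n → ℝ) | StageErrorBound Q est η h V I p.1 p.2} := by
  simp only [StageErrorBound, Set.ofPred_forall]
  refine MeasurableSet.iInter fun i => ?_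
  have h1 : Measurable fun p : (I → Obs d) × (Fin n → ℝ) => p.2 i :=
    (measurable_pi_apply i).comp measurable_snd
  have h2 : Measurable fun p : (I → Obs d) × (Fin n → ℝ) =>
      ∫⁻ u, ENNReal.ofReal (stageError est η I p.1 u ^ 2) ∂(Q (p.2 i)) :=
    (measurable_lintegral_stageError hest hη).comp (measurable_fst.prodMk h1)
  have h3 : MeasurableSet {p : (I → Obs d) × (Fin n → ℝ) | |p.2 i| ≤ h} :=
    measurableSet_le (measurable_abs_real.comp h1) measurable_const
  have h4 : {p : (I → Obs d) × (Fin n → ℝ) | |p.2 i| ≤ h → ∫⁻ u,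
      ENNReal.ofReal (stageError est η I p.1 u ^ 2) ∂(Q (p.2 i)) ≤ ENNReal.ofReal V} =
      {p : (I → Obs d) × (Fin n → ℝ) | |p.2 i| ≤ h}ᶜ ∪ {p | ∫⁻ u,
      ENNReal.ofReal (stageError est η I p.1 u ^ 2) ∂(Q (p.2 i)) ≤ ENNReal.ofReal V} := by
    ext p; simp [imp_iff_not_or]
  rw [h4]
  exact h3.compl.union (measurableSet_le h2 measurable_const)

end FirstStage

section NoiseEvents

variable {n d : ℕ}

/-- Deviation of the weighted squared residuals from their conditional means. -/
def sqNoise (K : ℝ → ℝ) (Q : Kernel ℝ (ℝ × (Fin d → ℝ))) (η : (Fin d → ℝ) → ℝ) (R : ℕ) (h : ℝ)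
    (w : Fin n → Obs d) : ℝ :=
  ∑ i, intWeight K R h (fun k => (w k).1) i *
    (resid Q η h (w i).1 (w i).2 ^ 2 - residVar Q η h (w i).1)

/-- Cross products of the residuals of neighbouring units. -/
def pairNoise (K : ℝ → ℝ) (Q : Kernel ℝ (ℝ × (Fin d → ℝ))) (η : (Fin d → ℝ) → ℝ) (R : ℕ) (h : ℝ)
    (w : Fin n → Obs d) : ℝ :=
  ∑ i, ∑ j, pairWeight K R h (fun k => (w k).1) i j *
    (resid Q η h (w i).1 (w i).2 * resid Q η h (w j).1 (w j).2)

/-- Weighted squared first-stage errors over the units that are not in `I`. -/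
def sqStageNoise (K : ℝ → ℝ) (est : FirstStageEstimator n d) (η : (Fin d → ℝ) → ℝ) (R : ℕ) (h : ℝ)
    (I : Finset (Fin n)) (w : Fin n → Obs d) : ℝ :=
  ∑ i ∈ Iᶜ, totalWeight K R h (fun k => (w k).1) i *
    stageError est η I (fun j => w j) (w i).2 ^ 2

/-- Weighted centred first-stage errors over the units that are not in `I`. -/
def stageNoise (K : ℝ → ℝ) (Q : Kernel ℝ (ℝ × (Fin d → ℝ))) (est : FirstStageEstimator n d)
    (η : (Fin d → ℝ) → ℝ) (h : ℝ) (I : Finset (Fin n)) (w : Fin n → Obs d) : ℝ :=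
  ∑ i ∈ Iᶜ, weight K h 2 0 (fun k => (w k).1) i *
    (stageError est η I (fun j => w j) (w i).2 -
      stageErrorMean Q est η I (fun j => w j) (w i).1)

variable {K : ℝ → ℝ} {Q : Kernel ℝ (ℝ × (Fin d → ℝ))} [IsMarkovKernel Q]
  {η : (Fin d → ℝ) → ℝ} {est : FirstStageEstimator n d} {I : Finset (Fin n)} {h A B C b V : ℝ}

lemma measurable_resid_obs (hη : Measurable η) (h : ℝ) (i : Fin n) :
    Measurable fun w : Fin n → Obs d => resid Q η h (w i).1 (w i).2 :=
  (measurable_resid hη h).comp (measurable_pi_apply i)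

lemma measurable_sqNoise (hK : IsRDKernel K) (hη : Measurable η) (R : ℕ) (h : ℝ) :
    Measurable fun w : Fin n → Obs d => sqNoise K Q η R h w :=
  Finset.measurable_sum _ fun i _ => ((hK.measurable_intWeight R h i).comp measurable_obsFst).mul
    (((measurable_resid_obs hη h i).pow_const 2).sub
      ((measurable_residVar hη h).comp (measurable_fst.comp (measurable_pi_apply i))))

lemma measurable_pairNoise (hK : IsRDKernel K) (hη : Measurable η) (R : ℕ) (h : ℝ) :
    Measurable fun w : Fin n → Obs d => pairNoise K Q η R h w :=
  Finset.measurable_sum _ fun i _ => Finset.measurable_sum _ fun j _ =>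
    ((hK.measurable_pairWeight R h i j).comp measurable_obsFst).mul
      ((measurable_resid_obs hη h i).mul (measurable_resid_obs hη h j))

lemma measurable_restrict_obs (I : Finset (Fin n)) :
    Measurable fun w : Fin n → Obs d => fun j : I => w j :=
  measurable_pi_lambda _ fun _ => measurable_pi_apply _

lemma measurable_sqStageNoise (hK : IsRDKernel K)
    (hest : Measurable fun p : (I → Obs d) × (Fin d → ℝ) => est I p.1 p.2) (hη : Measurable η)
    (R : ℕ) (h : ℝ) : Measurable fun w : Fin n → Obs d => sqStageNoise K est η R h I w :=
  Finset.measurable_sum _ fun i _ =>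
    ((hK.measurable_totalWeight R h i).comp measurable_obsFst).mul
      (((measurable_stageError hest hη).comp ((measurable_restrict_obs I).prodMk
        (measurable_snd.comp (measurable_pi_apply i)))).pow_const 2)

lemma measurable_stageNoise (hK : IsRDKernel K)
    (hest : Measurable fun p : (I → Obs d) × (Fin d → ℝ) => est I p.1 p.2) (hη : Measurable η)
    (h : ℝ) : Measurable fun w : Fin n → Obs d => stageNoise K Q est η h I w :=
  Finset.measurable_sum _ fun i _ =>
    ((hK.measurable_weight h i).comp measurable_obsFst).mul
      (((measurable_stageError hest hη).comp ((measurable_restrict_obs I).prodMk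
        (measurable_snd.comp (measurable_pi_apply i)))).sub
      ((measurable_stageErrorMean hest hη).comp ((measurable_restrict_obs I).prodMk
        (measurable_fst.comp (measurable_pi_apply i)))))

lemma measurableSet_stageErrorBound_obs
    (hest : Measurable fun p : (I → Obs d) × (Fin d → ℝ) => est I p.1 p.2) (hη : Measurable η)
    (h V : ℝ) :
    MeasurableSet {w : Fin n → Obs d |
      StageErrorBound Q est η h V I (fun j => w j) fun k => (w k).1} :=
  ((measurable_restrict_obs I).prodMk measurable_obsFst)
    (measurableSet_stageErrorBound hest hη h V)

/-! ### Noise bounds given a good design -/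

section Bounds

variable {x : Fin n → ℝ}

/-- Chebyshev: the squared residuals have variances bounded through the fourth moments, and the
fourth powers of the weights sum to O((nh)^{-3}). -/
lemma GoodDesign.measure_sqNoise_le (hx : GoodDesign K h A x) (hK : IsRDKernel K)
    (hb : ∀ u, K u ≤ b) (hn : 0 < n) (hh : 0 < h) (hw : WindowMoments Q η h B C) (R : ℕ) {δ : ℝ}
    (hδ : 0 < δ) :
    Measure.pi (fun i => Q (x i)) {u | δ ≤ |sqNoise K Q η R h (zipObs x u)|} ≤
      ENNReal.ofReal (A * (n * h) * (3 * A * b / (n * h)) ^ 4 * (1 + |B|) / δ ^ 2) := by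
  refine measure_le_abs_sum_le (ν := fun i => Q (x i))
    (f := fun i u => intWeight K R h x i * (resid Q η h (x i) u ^ 2 - residVar Q η h (x i)))
    (fun i => (hw.memLp_resid_sq_sub (x i)).const_mul _)
    (fun i => by rw [integral_const_mul, hw.integral_resid_sq_sub, mul_zero]) hδ ?_
  calc _ ≤ ∑ i, |weight K h 2 0 x i| ^ 4 * (1 + |B|) := by
        refine Finset.sum_le_sum fun i _ => ?_
        simp_rw [mul_pow]
        rw [integral_const_mul]
        have h1 : intWeight K R h x i ^ 2 ≤ |weight K h 2 0 x i| ^ 4 := by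
          calc _ ≤ (weight K h 2 0 x i ^ 2) ^ 2 :=
                pow_le_pow_left₀ (intWeight_nonneg ..) (intWeight_le ..) 2
            _ = _ := by rw [← sq_abs (weight K h 2 0 x i)]; ring
        exact mul_le_mul h1 (hw.integral_resid_sq_sub_sq_le (x i))
          (integral_nonneg fun _ => sq_nonneg _) (by positivity)
    _ ≤ _ := by
        rw [← Finset.sum_mul]
        exact mul_le_mul_of_nonneg_right (hx.sum_abs_weight_pow_le hK hb hn hh (by norm_num))
          (by positivity)

lemma GoodDesign.measure_pairNoise_le (hx : GoodDesign K h A x) (hK : IsRDKernel K)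
    (hb : ∀ u, K u ≤ b) (hn : 0 < n) (hh : 0 < h) (hw : WindowMoments Q η h B C) {R : ℕ}
    (hR : 0 < R) {δ : ℝ} (hδ : 0 < δ) :
    Measure.pi (fun i => Q (x i)) {u | δ ≤ |pairNoise K Q η R h (zipObs x u)|} ≤
      ENNReal.ofReal (2 * (1 + |B|) ^ 2 * (A * (n * h) * (3 * A * b / (n * h)) ^ 4) / δ ^ 2) := by
  refine measure_le_abs_quadraticForm_le (ν := fun i => Q (x i)) (e := fun i => resid Q η h (x i))
    (fun i => hw.memLp_resid (x i)) (fun i => hw.integral_resid (x i))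
    (fun i => hw.residVar_le (x i)) (a := fun i j => pairWeight K R h x i j)
    (fun i => pairWeight_self ..) hδ ?_
  refine (sum_pairWeight_sq_le K h x hR).trans ?_
  have := hx.sum_abs_weight_pow_le hK hb hn hh (k := 4) (by norm_num)
  simpa only [Even.pow_abs (by decide : Even 4)] using this

lemma GoodDesign.sum_weight_sq_le (hx : GoodDesign K h A x) (hK : IsRDKernel K)
    (hb : ∀ u, K u ≤ b) (hn : 0 < n) (hh : 0 < h) :
    ∑ i, weight K h 2 0 x i ^ 2 ≤ A * (3 * A * b) ^ 2 / (n * h) := by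
  have hn' : (0 : ℝ) < n := by exact_mod_cast hn
  have h1 := hx.sum_abs_weight_pow_le hK hb hn hh (k := 2) (by norm_num)
  simp only [sq_abs] at h1
  refine h1.trans (le_of_eq ?_)
  field_simp

/-- Markov's inequality given the data in I: the total weight is O(1/(nh)) and each mean square is
at most V. Units outside the window, about which `StageErrorBound` says nothing, carry no weight. -/
lemma GoodDesign.measure_sqStageNoise_le (hx : GoodDesign K h A x) (hK : IsRDKernel K)
    (hb : ∀ u, K u ≤ b) (hn : 0 < n) (hh : 0 < h) (hη : Measurable η)
    (hest : Measurable fun p : (I → Obs d) × (Fin d → ℝ) => est I p.1 p.2) {R : ℕ} (hR : 0 < R)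
    (hV : 0 ≤ V) {δ : ℝ} (hδ : 0 < δ) :
    Measure.pi (fun i => Q (x i)) {u |
        StageErrorBound Q est η h V I (fun j => zipObs x u j) (fun k => (zipObs x u k).1) ∧
        δ ≤ sqStageNoise K est η R h I (zipObs x u)} ≤
      ENNReal.ofReal (8 * (A * (3 * A * b) ^ 2 / (n * h)) * V / δ) := by
  have hz : Measurable fun a : I → ℝ × (Fin d → ℝ) => fun j : I => ((x j, a j) : Obs d) :=
    measurable_pi_lambda _ fun j => by fun_prop
  refine measure_fold_sum_sq_le (ν := fun i => Q (x i)) I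
    (G := {a | StageErrorBound Q est η h V I (fun j => (x j, a j)) x})
    ((hz.prodMk measurable_const) (measurableSet_stageErrorBound hest hη h V))
    (f := fun a _ u => stageError est η I (fun j => (x j, a j)) u)
    (fun i => (measurable_stageError hest hη).comp
      ((hz.comp measurable_fst).prodMk measurable_snd))
    (q := totalWeight K R h x) (fun i => totalWeight_nonneg ..) hV hδ ?_ ?_
  · intro a ha i hi
    refine ha i ?_
    by_contra hlt
    exact hi (totalWeight_eq_zero K R h x (not_le.mp hlt))
  · exact (sum_totalWeight_le K h x hR).trans
      (mul_le_mul_of_nonneg_left (hx.sum_weight_sq_le hK hb hn hh) (by norm_num))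

/-- Given the data in I the summands are independent and centred, with variances at most V because
centring reduces the second moment. -/
lemma GoodDesign.measure_stageNoise_le (hx : GoodDesign K h A x) (hK : IsRDKernel K)
    (hb : ∀ u, K u ≤ b) (hn : 0 < n) (hh : 0 < h) (hη : Measurable η)
    (hest : Measurable fun p : (I → Obs d) × (Fin d → ℝ) => est I p.1 p.2)
    (hV : 0 ≤ V) {δ : ℝ} (hδ : 0 < δ) :
    Measure.pi (fun i => Q (x i)) {u |
        StageErrorBound Q est η h V I (fun j => zipObs x u j) (fun k => (zipObs x u k).1) ∧
        δ ≤ |stageNoise K Q est η h I (zipObs x u)|} ≤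
      ENNReal.ofReal (A * (3 * A * b) ^ 2 / (n * h) * V / δ ^ 2) := by
  have hz : Measurable fun a : I → ℝ × (Fin d → ℝ) => fun j : I => ((x j, a j) : Obs d) :=
    measurable_pi_lambda _ fun j => by fun_prop
  have hL2 : ∀ a ∈ {a : I → ℝ × (Fin d → ℝ) |
      StageErrorBound Q est η h V I (fun j => (x j, a j)) x},
      ∀ i, weight K h 2 0 x i ≠ 0 →
      ∫⁻ u, ENNReal.ofReal (stageError est η I (fun j => (x j, a j)) u ^ 2) ∂(Q (x i)) ≤
        ENNReal.ofReal V := by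
    intro a ha i hi
    refine ha i ?_
    by_contra hlt
    exact hi (weight_eq_zero_of_lt x i hK hh (not_le.mp hlt))
  have hmeas : ∀ a : I → Obs d, Measurable (stageError est η I a) := fun a =>
    (measurable_stageError hest hη).comp measurable_prodMk_left
  have hmem : ∀ a ∈ {a : I → ℝ × (Fin d → ℝ) |
      StageErrorBound Q est η h V I (fun j => (x j, a j)) x},
      ∀ i, weight K h 2 0 x i ≠ 0 →
        MemLp (stageError est η I (fun j => (x j, a j))) 2 (Q (x i)) := by
    intro a ha i hi
    rw [memLp_two_iff_integrable_sq (hmeas _).aestronglyMeasurable]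
    refine ⟨((hmeas _).pow_const 2).aestronglyMeasurable, ?_⟩
    rw [hasFiniteIntegral_iff_ofReal (Eventually.of_forall fun u => sq_nonneg _)]
    exact (hL2 a ha i hi).trans_lt ENNReal.ofReal_lt_top
  refine measure_fold_sum_le (ν := fun i => Q (x i)) I
    (G := {a | StageErrorBound Q est η h V I (fun j => (x j, a j)) x})
    ((hz.prodMk measurable_const) (measurableSet_stageErrorBound hest hη h V))
    (f := fun a i u => stageError est η I (fun j => (x j, a j)) u -
      stageErrorMean Q est η I (fun j => (x j, a j)) (x i))
    (fun i => ((measurable_stageError hest hη).comp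
      ((hz.comp measurable_fst).prodMk measurable_snd)).sub
      ((measurable_stageErrorMean hest hη).comp ((hz.comp measurable_fst).prodMk measurable_const)))
    (c := weight K h 2 0 x) hV hδ ?_ ?_ (hx.sum_weight_sq_le hK hb hn hh)
  · intro a ha i hi
    rw [integral_sub ((hmem a ha i hi).integrable (by norm_num)) (integrable_const _)]
    simp [stageErrorMean]
  · intro a ha i hi
    refine le_trans ?_ (hL2 a ha i hi)
    have hm := hmem a ha i hi
    have hm' : MemLp (fun u => stageError est η I (fun j => (x j, a j)) u -
        stageErrorMean Q est η I (fun j => (x j, a j)) (x i)) 2 (Q (x i)) :=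
      hm.sub (memLp_const _)
    rw [← ofReal_integral_eq_lintegral_ofReal hm'.integrable_sq
        (Eventually.of_forall fun _ => sq_nonneg _),
      ← ofReal_integral_eq_lintegral_ofReal hm.integrable_sq
        (Eventually.of_forall fun _ => sq_nonneg _)]
    refine ENNReal.ofReal_le_ofReal ?_
    have h1 := variance_le_expectation_sq (μ := Q (x i))
      (hmeas fun j => (x j, a j)).aestronglyMeasurable
    rw [variance_eq_integral (hmeas _).aemeasurable] at h1
    exact h1

end Bounds

end NoiseEvents

/-- Transfer of a conditional bound, uniform over good designs and over fold assignments, to the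
sample. -/
lemma IsSample.measure_le {d : ℕ → ℕ} {S : ℕ} {Ω : ℕ → Type*} [∀ n, MeasurableSpace (Ω n)]
    {P : (n : ℕ) → Measure (Ω n)} [∀ n, IsProbabilityMeasure (P n)] {PX : Measure ℝ}
    [IsProbabilityMeasure PX] {Q : (n : ℕ) → Kernel ℝ (ℝ × (Fin (d n) → ℝ))}
    [∀ n, IsMarkovKernel (Q n)]
    {W : (n : ℕ) → Fin n → Ω n → Obs (d n)} {s : (n : ℕ) → Ω n → Fin n → Fin S}
    (hs : IsSample P PX Q W s) (n : ℕ) {D : Set (Fin n → ℝ)} (hD : MeasurableSet D)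
    {B : (Fin n → Fin S) → Set (Fin n → Obs (d n))} (hB : ∀ σ, MeasurableSet (B σ)) {η : ℝ≥0∞}
    (hη : ∀ σ, ∀ x ∈ D, Measure.pi (fun i => Q n (x i)) {u | zipObs x u ∈ B σ} ≤ η) :
    P n {ω | (fun i => (W n i ω).1) ∈ D ∧ (fun i => W n i ω) ∈ B (s n ω)} ≤ η := by
  refine measure_split_le (W := fun ω i => W n i ω) (s := s n)
    (B := fun σ => {w | (fun i => (w i).1) ∈ D ∧ w ∈ B σ}) (hs.measurable_split n)
    (hs.indep_split n) (fun σ => (measurable_obsFst hD).inter (hB σ))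
    (measurable_pi_lambda _ fun i => hs.measurable_obs n i) fun σ => ?_
  rw [hs.map_eq n]
  exact measure_pi_le_of_conditional PX (Q n) hD (hB σ) (hη σ)

/-! ## Sums of weights over folds -/

section FoldSums

variable {n : ℕ}

/-- The indicator of a set of units, centred by the share of the set. -/
def foldCoef (J : Finset (Fin n)) (i : Fin n) : ℝ := (if i ∈ J then 1 else 0) - (J.card : ℝ) / n

lemma abs_foldCoef_le (J : Finset (Fin n)) (i : Fin n) : |foldCoef J i| ≤ 1 := by
  have hn : (0 : ℝ) < n := by exact_mod_cast (Nat.pos_of_ne_zero fun h => by subst h; exact i.elim0)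
  have h1 : (J.card : ℝ) / n ≤ 1 := by
    rw [div_le_one hn]
    exact_mod_cast (J.card_le_univ.trans (by simp))
  have h0 : 0 ≤ (J.card : ℝ) / n := by positivity
  unfold foldCoef
  rw [_root_.abs_le]
  split_ifs <;> constructor <;> linarith

lemma sum_foldCoef (J : Finset (Fin n)) : ∑ i, foldCoef J i = 0 := by
  rcases Nat.eq_zero_or_pos n with h | hn
  · subst h; simp
  · have hn' : (n : ℝ) ≠ 0 := by positivity
    unfold foldCoef
    rw [Finset.sum_sub_distrib]
    simp only [Finset.sum_ite_mem, Finset.univ_inter, Finset.sum_const, Finset.card_univ,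
      Fintype.card_fin, nsmul_eq_mul, mul_one]
    field_simp
    ring

lemma sum_eq_sum_foldCoef_add (J : Finset (Fin n)) (f : Fin n → ℝ) :
    ∑ i ∈ J, f i = ∑ i, foldCoef J i * f i + (J.card : ℝ) / n * ∑ i, f i := by
  simp only [foldCoef, sub_mul, Finset.sum_sub_distrib, ite_mul, one_mul, zero_mul,
    Finset.sum_ite_mem, Finset.univ_inter, Finset.mul_sum]
  ring

variable {K : ℝ → ℝ} {h A b δ : ℝ} {x : Fin n → ℝ} {J : Finset (Fin n)}

/-- Over all units the right and left sums cancel (1 - 1 for k = 0, and 0 - 0 otherwise), so only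
the centred fold indicator contributes. Moments of order a + k ≤ 4 are involved, and 6 = 3 + 3 adds
the two sides. -/
lemma GoodDesign.abs_sum_fold_mul_pow_le (hx : GoodDesign K h A x) (hn : 0 < n) (hh : 0 < h)
    (hr : ∀ k < 5, |wMoment (foldCoef J) (rightPart K) h k x| ≤ δ)
    (hl : ∀ k < 5, |wMoment (foldCoef J) (leftPart K) h k x| ≤ δ) (k : Fin 3) :
    |∑ i ∈ J, weight K h 2 0 x i * x i ^ (k : ℕ)| ≤ h ^ (k : ℕ) * (6 * A * δ) := by
  have hsum : ∑ i, weight K h 2 0 x i * x i ^ (k : ℕ) = 0 := by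
    simp only [weight, sub_mul, Finset.sum_sub_distrib]
    rw [hx.sum_rightWeight_mul_pow hn hh k, hx.sum_leftWeight_mul_pow hn hh k, sub_self]
  rw [sum_eq_sum_foldCoef_add, hsum, mul_zero, add_zero]
  have h1 := abs_sum_mul_sideWeight_mul_pow_le hn (rightPart K) hh x hx.det_right hx.inv_right
    (foldCoef J) k (δ := δ) fun a => hr _ (by omega)
  have h2 := abs_sum_mul_sideWeight_mul_pow_le hn (leftPart K) hh x hx.det_left hx.inv_left
    (foldCoef J) k (δ := δ) fun a => hl _ (by omega)
  rw [← kernelRight_eq K hh] at h1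
  rw [← kernelLeft_eq K hh] at h2
  have h3 : ∑ i, foldCoef J i * (weight K h 2 0 x i * x i ^ (k : ℕ)) =
      ∑ i, foldCoef J i * sideWeight (kernelRight K h) 2 0 x i * x i ^ (k : ℕ) -
      ∑ i, foldCoef J i * sideWeight (kernelLeft K h) 2 0 x i * x i ^ (k : ℕ) := by
    rw [← Finset.sum_sub_distrib]
    exact Finset.sum_congr rfl fun i _ => by rw [weight]; ring
  rw [h3]
  calc _ ≤ _ := abs_sub _ _
    _ ≤ h ^ (k : ℕ) * (3 * A * δ) + h ^ (k : ℕ) * (3 * A * δ) := add_le_add h1 h2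
    _ = _ := by ring

lemma GoodDesign.sum_abs_weight_le (hx : GoodDesign K h A x) (hK : IsRDKernel K)
    (hb : ∀ u, K u ≤ b) (hn : 0 < n) (hh : 0 < h) :
    ∑ i, |weight K h 2 0 x i| ≤ 3 * A ^ 2 * b := by
  have hn' : (0 : ℝ) < n := by exact_mod_cast hn
  have h1 := hx.sum_abs_weight_pow_le hK hb hn hh (k := 1) (by norm_num)
  simp only [pow_one] at h1
  refine h1.trans (le_of_eq ?_)
  field_simp

/-- Weighted fold sums of a function that is close to a small quadratic polynomial are small. -/
lemma GoodDesign.abs_sum_fold_mul_le (hx : GoodDesign K h A x) (hK : IsRDKernel K)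
    (hb : ∀ u, K u ≤ b) (hn : 0 < n) (hh : 0 < h) (hA : 0 ≤ A) (hδ : 0 ≤ δ)
    (hr : ∀ k < 5, |wMoment (foldCoef J) (rightPart K) h k x| ≤ δ)
    (hl : ∀ k < 5, |wMoment (foldCoef J) (leftPart K) h k x| ≤ δ) {g : ℝ → ℝ} {a₀ a₁ a₂ ρ M : ℝ}
    (h0 : |a₀| ≤ ρ) (h1 : |a₁| * h ≤ ρ) (h2 : |a₂| * h ^ 2 ≤ ρ) (hM : 0 ≤ M)
    (hg : ∀ y, y ≠ 0 → |y| ≤ h → |g y - (a₀ + a₁ * y + a₂ * y ^ 2)| ≤ M) :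
    |∑ i ∈ J, weight K h 2 0 x i * g (x i)| ≤ 18 * A * δ * ρ + 3 * A ^ 2 * b * M := by
  set w := weight K h 2 0 x with hw
  have hsplit : ∑ i ∈ J, w i * g (x i) = a₀ * ∑ i ∈ J, w i * x i ^ 0 + a₁ * ∑ i ∈ J, w i * x i ^ 1
      + a₂ * ∑ i ∈ J, w i * x i ^ 2 +
      ∑ i ∈ J, w i * (g (x i) - (a₀ + a₁ * x i + a₂ * x i ^ 2)) := by
    simp only [Finset.mul_sum, ← Finset.sum_add_distrib]
    exact Finset.sum_congr rfl fun i _ => by ring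
  have e0 := hx.abs_sum_fold_mul_pow_le hn hh hr hl 0
  have e1 := hx.abs_sum_fold_mul_pow_le hn hh hr hl 1
  have e2 := hx.abs_sum_fold_mul_pow_le hn hh hr hl 2
  simp only [Fin.val_zero, Fin.val_one, Fin.val_two, ← hw] at e0 e1 e2
  have hAδ : 0 ≤ 6 * A * δ := by positivity
  -- The factor h ^ k of the fold sum combines with the coefficient of degree k, so the three
  -- degrees contribute equally.
  have f0 : |a₀ * ∑ i ∈ J, w i * x i ^ 0| ≤ 6 * A * δ * ρ := by
    rw [abs_mul]
    calc _ ≤ ρ * (h ^ 0 * (6 * A * δ)) := mul_le_mul h0 e0 (abs_nonneg _) ((abs_nonneg _).trans h0)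
      _ = _ := by ring
  have f1 : |a₁ * ∑ i ∈ J, w i * x i ^ 1| ≤ 6 * A * δ * ρ := by
    rw [abs_mul]
    calc _ ≤ |a₁| * (h ^ 1 * (6 * A * δ)) := mul_le_mul_of_nonneg_left e1 (abs_nonneg _)
      _ = (|a₁| * h) * (6 * A * δ) := by ring
      _ ≤ ρ * (6 * A * δ) := mul_le_mul_of_nonneg_right h1 hAδ
      _ = _ := by ring
  have f2 : |a₂ * ∑ i ∈ J, w i * x i ^ 2| ≤ 6 * A * δ * ρ := by
    rw [abs_mul]
    calc _ ≤ |a₂| * (h ^ 2 * (6 * A * δ)) := mul_le_mul_of_nonneg_left e2 (abs_nonneg _)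
      _ = (|a₂| * h ^ 2) * (6 * A * δ) := by ring
      _ ≤ ρ * (6 * A * δ) := mul_le_mul_of_nonneg_right h2 hAδ
      _ = _ := by ring
  have f3 : |∑ i ∈ J, w i * (g (x i) - (a₀ + a₁ * x i + a₂ * x i ^ 2))| ≤ 3 * A ^ 2 * b * M := by
    calc _ ≤ ∑ i ∈ J, |w i| * M := by
          refine (Finset.abs_sum_le_sum_abs _ _).trans (Finset.sum_le_sum fun i _ => ?_)
          rw [abs_mul]
          rcases lt_or_ge h |x i| with hi | hi
          · rw [hw, weight_eq_zero_of_lt x i hK hh hi]; simp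
          · exact mul_le_mul_of_nonneg_left (hg _ (hx.ne_zero i) hi) (abs_nonneg _)
      _ ≤ (∑ i, |w i|) * M := by
          rw [← Finset.sum_mul]
          exact mul_le_mul_of_nonneg_right (Finset.sum_le_univ_sum_of_nonneg fun i => abs_nonneg _)
            hM
      _ ≤ _ := mul_le_mul_of_nonneg_right (hx.sum_abs_weight_le hK hb hn hh) hM
  rw [hsplit]
  refine (abs_add_le _ _).trans ?_
  have := (abs_add_le (a₀ * ∑ i ∈ J, w i * x i ^ 0 + a₁ * ∑ i ∈ J, w i * x i ^ 1)
    (a₂ * ∑ i ∈ J, w i * x i ^ 2)).trans (add_le_add_left (abs_add_le _ _) _)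
  linarith

end FoldSums

/-! ## Approximation on the event of good noise -/

/-- The event on which the design, the first-stage estimates and all remainder terms behave. -/
structure GoodEvent {n d S : ℕ} (K : ℝ → ℝ) (Q : Kernel ℝ (ℝ × (Fin d → ℝ)))
    (est : FirstStageEstimator n d) (η : (Fin d → ℝ) → ℝ) (T : Set ((Fin d → ℝ) → ℝ)) (R : ℕ)
    (h A δ D : ℝ) (σ : Fin n → Fin S) (w : Fin n → Obs d) : Prop where
  design : GoodDesign K h A fun k => (w k).1
  mem : ∀ t, crossFit est σ w t ∈ T
  sq : |sqNoise K Q η R h w| < δ / (n * h)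
  pair : |pairNoise K Q η R h w| < δ / (n * h)
  sqStage : ∀ t, sqStageNoise K est η R h (outsideFold σ t) w < δ / (n * h)
  stage : ∀ t, |stageNoise K Q est η h (outsideFold σ t) w| < δ / √(n * h)
  fold_right : ∀ t, ∀ k < 5, |wMoment (foldCoef (outsideFold σ t)ᶜ) (rightPart K) h k
    fun k => (w k).1| ≤ D / √(n * h)
  fold_left : ∀ t, ∀ k < 5, |wMoment (foldCoef (outsideFold σ t)ᶜ) (leftPart K) h k
    fun k => (w k).1| ≤ D / √(n * h)

section GoodEvents

variable {n d S : ℕ} {K : ℝ → ℝ} {Q : Kernel ℝ (ℝ × (Fin d → ℝ))} {η : (Fin d → ℝ) → ℝ}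
  {est : FirstStageEstimator n d} {T : Set ((Fin d → ℝ) → ℝ)} {R : ℕ} {h A B C b δ D : ℝ}
  {σ : Fin n → Fin S} {w : Fin n → Obs d}

lemma sum_sum_outsideFold (σ : Fin n → Fin S) (f : Fin S → Fin n → ℝ) :
    ∑ t, ∑ i ∈ (outsideFold σ t)ᶜ, f t i = ∑ i, f (σ i) i := by
  have h1 : ∀ t, (outsideFold σ t)ᶜ = Finset.univ.filter fun i => σ i = t := fun t => by
    ext i; simp [outsideFold]
  simp_rw [h1]
  rw [← Finset.sum_fiberwise (s := Finset.univ) (g := σ)]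
  refine Finset.sum_congr rfl fun t _ => Finset.sum_congr rfl fun i hi => ?_
  rw [(Finset.mem_filter.mp hi).2]

lemma crossOutcome_eq {i : Fin n} (hi : |(w i).1| ≤ h) :
    crossOutcome est σ w i = condMean Q η (w i).1 + resid Q η h (w i).1 (w i).2 -
      stageError est η (outsideFold σ (σ i)) (fun j => w j) (w i).2 := by
  simp only [crossOutcome, resid, if_pos hi, stageError, crossFit, adjOutcome]
  ring

/-- The first-stage error is centred at its conditional mean given X for the estimate frozen outside
the fold. Units outside the window have weight zero, so the truncated residuals may be used. -/
lemma localPoly_crossOutcome_eq (hK : IsRDKernel K) (hh : 0 < h) :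
    localPoly K h 2 0 (fun k => (w k).1) (crossOutcome est σ w) =
      ∑ i, weight K h 2 0 (fun k => (w k).1) i * condMean Q η (w i).1 + oracleNoise K Q η h w -
      ∑ t, (stageNoise K Q est η h (outsideFold σ t) w +
        ∑ i ∈ (outsideFold σ t)ᶜ, weight K h 2 0 (fun k => (w k).1) i *
          stageErrorMean Q est η (outsideFold σ t) (fun j => w j) (w i).1) := by
  simp only [stageNoise, ← Finset.sum_add_distrib]
  rw [sum_sum_outsideFold σ fun t i => weight K h 2 0 (fun k => (w k).1) i *
    (stageError est η (outsideFold σ t) (fun j => w j) (w i).2 -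
      stageErrorMean Q est η (outsideFold σ t) (fun j => w j) (w i).1) +
    weight K h 2 0 (fun k => (w k).1) i *
      stageErrorMean Q est η (outsideFold σ t) (fun j => w j) (w i).1]
  rw [localPoly, oracleNoise, ← Finset.sum_add_distrib, ← Finset.sum_sub_distrib]
  refine Finset.sum_congr rfl fun i _ => ?_
  rcases lt_or_ge h |(w i).1| with hi | hi
  · rw [weight_eq_zero_of_lt (fun k => (w k).1) i hK hh hi]; simp
  · rw [crossOutcome_eq (Q := Q) (η := η) hi]; ring

/-- Apart from the oracle noise there are three contributions: the oracle bias, and for each fold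
the centred first-stage noise and the fold sum of a nearly quadratic mean error. -/
lemma GoodEvent.abs_localPoly_sub_le (hg : GoodEvent K Q est η T R h A δ D σ w)
    (hK : IsRDKernel K) (hb : ∀ u, K u ≤ b) (hn : 0 < n) (hh : 0 < h) (hA : 0 ≤ A) (hD : 0 ≤ D)
    {τ β ρ M : ℝ} (hM : 0 ≤ M)
    (hβ : |∑ i, weight K h 2 0 (fun k => (w k).1) i * condMean Q η (w i).1 - τ| ≤ β)
    (hT : ∀ f ∈ T, ∃ a₀ a₁ a₂ : ℝ, |a₀| ≤ ρ ∧ |a₁| * h ≤ ρ ∧ |a₂| * h ^ 2 ≤ ρ ∧ ∀ y, y ≠ 0 →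
      |y| ≤ h → |∫ u, (f u.2 - η u.2) ∂(Q y) - (a₀ + a₁ * y + a₂ * y ^ 2)| ≤ M) :
    |localPoly K h 2 0 (fun k => (w k).1) (crossOutcome est σ w) - τ - oracleNoise K Q η h w| ≤
      β + S * (δ / √(n * h) + (18 * A * (D / √(n * h)) * ρ + 3 * A ^ 2 * b * M)) := by
  rw [localPoly_crossOutcome_eq (Q := Q) (η := η) hK hh]
  have h1 : ∀ t, |stageNoise K Q est η h (outsideFold σ t) w +
        ∑ i ∈ (outsideFold σ t)ᶜ, weight K h 2 0 (fun k => (w k).1) i *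
          stageErrorMean Q est η (outsideFold σ t) (fun j => w j) (w i).1| ≤
      δ / √(n * h) + (18 * A * (D / √(n * h)) * ρ + 3 * A ^ 2 * b * M) := by
    intro t
    obtain ⟨a₀, a₁, a₂, h0, h1, h2, h3⟩ := hT _ (hg.mem t)
    refine (abs_add_le _ _).trans (add_le_add (hg.stage t).le ?_)
    exact hg.design.abs_sum_fold_mul_le hK hb hn hh hA (by positivity) (hg.fold_right t)
      (hg.fold_left t) (g := stageErrorMean Q est η (outsideFold σ t) fun j => w j) h0 h1 h2 hM h3
  have h2 : |∑ t, (stageNoise K Q est η h (outsideFold σ t) w +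
        ∑ i ∈ (outsideFold σ t)ᶜ, weight K h 2 0 (fun k => (w k).1) i *
          stageErrorMean Q est η (outsideFold σ t) (fun j => w j) (w i).1)| ≤
      S * (δ / √(n * h) + (18 * A * (D / √(n * h)) * ρ + 3 * A ^ 2 * b * M)) := by
    refine (Finset.abs_sum_le_sum_abs _ _).trans
      ((Finset.sum_le_sum fun t _ => h1 t).trans (le_of_eq ?_))
    rw [Finset.sum_const, Finset.card_univ, Fintype.card_fin, nsmul_eq_mul]
  refine le_trans (le_of_eq ?_) ((abs_sub _ _).trans (add_le_add hβ h2))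
  congr 1; ring

/-- The bounds of the good event are inserted into `le_sum_weight_sq_mul_nnVariance`. In 3 δ, one
part comes from the squared residuals and two from the doubled cross products; the term with 2 R
pays for the units that are not interior. -/
lemma GoodEvent.le_stdError_sq [IsMarkovKernel Q] (hg : GoodEvent K Q est η T R h A δ D σ w)
    (hK : IsRDKernel K) (hb : ∀ u, K u ≤ b) (hn : 0 < n) (hh : 0 < h) (hR : 0 < R)
    (hw : WindowMoments Q η h B C) {M θ : ℝ} (hθ : 0 < θ) (hθ1 : θ < 1)
    (hM : ∀ y z, |y| ≤ h → |z| ≤ h → 0 < y * z → |condMean Q η y - condMean Q η z| ≤ M) :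
    (1 - θ) * (designVar K Q η h (fun k => (w k).1) -
        2 * R * ((3 * A * b / (n * h)) ^ 2 * (1 + |B|)) - 3 * (δ / (n * h))) -
      1 / θ * (2 * M ^ 2 * (A * (3 * A * b) ^ 2 / (n * h)) + S * (δ / (n * h))) ≤
      stdError K h 2 0 R (fun k => (w k).1) (crossOutcome est σ w) ^ 2 := by
  have hx := hg.design
  set x : Fin n → ℝ := fun k => (w k).1 with hxdef
  have hbase := le_sum_weight_sq_mul_nnVariance K hR h x hθ hθ1 (y := crossOutcome est σ w)
    (μ := fun i => condMean Q η (x i)) (ε := fun i => resid Q η h (w i).1 (w i).2)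
    (Δ := fun i => stageError est η (outsideFold σ (σ i)) (fun j => w j) (w i).2) (M := M)
    (fun i hi => crossOutcome_eq hi)
    (fun i j hi hj hs => hM _ _ hi hj (hs.mul_pos (hx.ne_zero i) (hx.ne_zero j)))
  have hnn : 0 ≤ ∑ i, weight K h 2 0 x i ^ 2 * nnVariance R x (crossOutcome est σ w) i :=
    Finset.sum_nonneg fun i _ => mul_nonneg (sq_nonneg _) (sq_nonneg _)
  rw [stdError, Real.sq_sqrt hnn]
  refine le_trans ?_ hbase
  have h1 := sum_weight_sq_sub_intWeight_le K hK R hh x (V := fun i => residVar Q η h (x i))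
    (B := 1 + |B|) (by positivity) (hx.abs_weight_le hK hb hn hh) fun i => hw.residVar_le _
  have h2 := (_root_.abs_lt.mp hg.sq).1
  have h2' : sqNoise K Q η R h w = ∑ i, intWeight K R h x i * resid Q η h (w i).1 (w i).2 ^ 2 -
      ∑ i, intWeight K R h x i * residVar Q η h (x i) := by
    rw [sqNoise, ← Finset.sum_sub_distrib]
    exact Finset.sum_congr rfl fun i _ => by ring
  have h3 := (_root_.abs_lt.mp hg.pair).2
  have h4 : ∑ i, totalWeight K R h x i *
      stageError est η (outsideFold σ (σ i)) (fun j => w j) (w i).2 ^ 2 ≤ S * (δ / (n * h)) := by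
    have := sum_sum_outsideFold σ fun t i => totalWeight K R h x i *
      stageError est η (outsideFold σ t) (fun j => w j) (w i).2 ^ 2
    rw [← this]
    refine (Finset.sum_le_sum fun t _ => (hg.sqStage t).le).trans (le_of_eq ?_)
    simp
  have h5 : ∑ i, intWeight K R h x i ≤ A * (3 * A * b) ^ 2 / (n * h) :=
    (Finset.sum_le_sum fun i _ => intWeight_le ..).trans (hx.sum_weight_sq_le hK hb hn hh)
  have h6 : 2 * M ^ 2 * ∑ i, intWeight K R h x i ≤ 2 * M ^ 2 * (A * (3 * A * b) ^ 2 / (n * h)) :=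
    mul_le_mul_of_nonneg_left h5 (by positivity)
  have h7 : ∑ i, ∑ j, pairWeight K R h x i j * (resid Q η h (w i).1 (w i).2 *
      resid Q η h (w j).1 (w j).2) = pairNoise K Q η R h w := rfl
  have h8 : designVar K Q η h x = ∑ i, weight K h 2 0 x i ^ 2 * residVar Q η h (x i) := rfl
  rw [h7]
  refine sub_le_sub (mul_le_mul_of_nonneg_left ?_ (by linarith))
    (mul_le_mul_of_nonneg_left (add_le_add h6 h4) (by positivity))
  rw [h8]
  linarith

end GoodEvents

/-! ## Probability of the good event -/

lemma tendsto_zero_of_eventually_le_ofReal {u : ℕ → ℝ≥0∞} {g : ℕ → ℝ} (hg : Tendsto g atTop (𝓝 0))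
    (hu : ∀ᶠ n in atTop, u n ≤ ENNReal.ofReal (g n)) : Tendsto u atTop (𝓝 0) := by
  have h1 : Tendsto (fun n => ENNReal.ofReal (g n)) atTop (𝓝 0) := by
    simpa using ENNReal.tendsto_ofReal hg
  exact tendsto_of_tendsto_of_tendsto_of_le_of_le' tendsto_const_nhds h1
    (Eventually.of_forall fun _ => zero_le) hu

section Sample

variable {d : ℕ → ℕ} {S : ℕ} {Ω : ℕ → Type*} [∀ n, MeasurableSpace (Ω n)]
  {P : (n : ℕ) → Measure (Ω n)} [∀ n, IsProbabilityMeasure (P n)] {PX : Measure ℝ}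
  [IsProbabilityMeasure PX] {Q : (n : ℕ) → Kernel ℝ (ℝ × (Fin (d n) → ℝ))}
  [∀ n, IsMarkovKernel (Q n)]
  {W : (n : ℕ) → Fin n → Ω n → Obs (d n)} {s : (n : ℕ) → Ω n → Fin n → Fin S}

/-- Probabilities of events that concern the running variables and the split only. -/
lemma IsSample.measure_fst_le (hs : IsSample P PX Q W s) (n : ℕ)
    {D : (Fin n → Fin S) → Set (Fin n → ℝ)} (hD : ∀ σ, MeasurableSet (D σ)) {η : ℝ≥0∞}
    (hη : ∀ σ, Measure.pi (fun _ : Fin n => PX) (D σ) ≤ η) :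
    P n {ω | (fun i => (W n i ω).1) ∈ D (s n ω)} ≤ η := by
  refine measure_split_le (W := fun ω i => W n i ω) (s := s n)
    (B := fun σ => {w | (fun i => (w i).1) ∈ D σ}) (hs.measurable_split n)
    (hs.indep_split n) (fun σ => measurable_obsFst (hD σ))
    (measurable_pi_lambda _ fun i => hs.measurable_obs n i) fun σ => ?_
  rw [hs.map_eq n, map_fst_pi PX (Q n) (hD σ)]
  exact hη σ

variable {est : (n : ℕ) → FirstStageEstimator n (d n)} {K : ℝ → ℝ} {h : ℕ → ℝ}
  {T : (n : ℕ) → Set ((Fin (d n) → ℝ) → ℝ)} {η : (n : ℕ) → (Fin (d n) → ℝ) → ℝ} {R : ℕ}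
  {A B C δ : ℝ}

lemma IsBandwidth.eventually_pos (hh : IsBandwidth h) :
    ∀ᶠ n : ℕ in atTop, 0 < n ∧ 0 < (n : ℝ) * h n := by
  filter_upwards [eventually_gt_atTop 0] with n hn
  exact ⟨hn, mul_pos (by exact_mod_cast hn) (hh.pos n)⟩

/-- A variance of order (nh)^{-3} against a squared threshold of order (nh)^{-2} leaves (nh)^{-1}.
-/
lemma IsSample.tendsto_measure_sqNoise (hs : IsSample P PX Q W s) (hK : IsRDKernel K)
    (hh : IsBandwidth h) (hη : ∀ n, Measurable (η n))
    (hw : ∀ᶠ n in atTop, WindowMoments (Q n) (η n) (h n) B C) (R : ℕ) (hδ : 0 < δ) :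
    Tendsto (fun n => P n {ω | (fun i => (W n i ω).1) ∈ {x | GoodDesign K (h n) A x} ∧
      (fun i => W n i ω) ∈ {w | δ / (n * h n) ≤ |sqNoise K (Q n) (η n) R (h n) w|}})
      atTop (𝓝 0) := by
  obtain ⟨b, hb⟩ := hK.bounded
  refine tendsto_zero_of_eventually_le_ofReal
    (g := fun n : ℕ => A * (3 * A * b) ^ 4 * (1 + |B|) / δ ^ 2 / (n * h n))
    (hh.tendsto_mul.const_div_atTop _) ?_
  filter_upwards [hw, hh.eventually_pos] with n hwn ⟨hn, hN⟩
  refine hs.measure_le n (hK.measurableSet_goodDesign (h n) A) (B := fun _ =>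
    {w | δ / (n * h n) ≤ |sqNoise K (Q n) (η n) R (h n) w|})
    (fun _ => measurableSet_le measurable_const
      (measurable_abs_real.comp (measurable_sqNoise hK (hη n) R (h n)))) fun _ x hx => ?_
  refine (GoodDesign.measure_sqNoise_le hx hK hb hn (hh.pos n) hwn R
    (div_pos hδ hN)).trans (le_of_eq ?_)
  congr 1
  have hn' : (n : ℝ) ≠ 0 := by positivity
  have hh' := (hh.pos n).ne'
  field_simp

lemma IsSample.tendsto_measure_pairNoise (hs : IsSample P PX Q W s) (hK : IsRDKernel K)
    (hh : IsBandwidth h) (hη : ∀ n, Measurable (η n))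
    (hw : ∀ᶠ n in atTop, WindowMoments (Q n) (η n) (h n) B C) (hR : 0 < R) (hδ : 0 < δ) :
    Tendsto (fun n => P n {ω | (fun i => (W n i ω).1) ∈ {x | GoodDesign K (h n) A x} ∧
      (fun i => W n i ω) ∈ {w | δ / (n * h n) ≤ |pairNoise K (Q n) (η n) R (h n) w|}})
      atTop (𝓝 0) := by
  obtain ⟨b, hb⟩ := hK.bounded
  refine tendsto_zero_of_eventually_le_ofReal
    (g := fun n : ℕ => 2 * (1 + |B|) ^ 2 * (A * (3 * A * b) ^ 4) / δ ^ 2 / (n * h n))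
    (hh.tendsto_mul.const_div_atTop _) ?_
  filter_upwards [hw, hh.eventually_pos] with n hwn ⟨hn, hN⟩
  refine hs.measure_le n (hK.measurableSet_goodDesign (h n) A) (B := fun _ =>
    {w | δ / (n * h n) ≤ |pairNoise K (Q n) (η n) R (h n) w|})
    (fun _ => measurableSet_le measurable_const
      (measurable_abs_real.comp (measurable_pairNoise hK (hη n) R (h n)))) fun _ x hx => ?_
  refine (GoodDesign.measure_pairNoise_le hx hK hb hn (hh.pos n) hwn hR
    (div_pos hδ hN)).trans (le_of_eq ?_)
  congr 1
  have hn' : (n : ℝ) ≠ 0 := by positivity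
  have hh' := (hh.pos n).ne'
  field_simp

/-- Here the powers of n h cancel, and convergence comes from the first-stage rate V. -/
lemma IsSample.tendsto_measure_sqStageNoise (hs : IsSample P PX Q W s) (hK : IsRDKernel K)
    (hh : IsBandwidth h) (hη : ∀ n, Measurable (η n))
    (hest : ∀ n (I : Finset (Fin n)),
      Measurable fun wz : (I → Obs (d n)) × (Fin (d n) → ℝ) => est n I wz.1 wz.2)
    (hR : 0 < R) (hδ : 0 < δ) {V : ℕ → ℝ} (hV0 : ∀ n, 0 ≤ V n) (hV : Tendsto V atTop (𝓝 0))
    (t : Fin S) :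
    Tendsto (fun n => P n {ω | (fun i => (W n i ω).1) ∈ {x | GoodDesign K (h n) A x} ∧
      (fun i => W n i ω) ∈ {w | StageErrorBound (Q n) (est n) (η n) (h n) (V n)
        (outsideFold (s n ω) t) (fun j => w j) (fun k => (w k).1) ∧
        δ / (n * h n) ≤ sqStageNoise K (est n) (η n) R (h n) (outsideFold (s n ω) t) w}})
      atTop (𝓝 0) := by
  obtain ⟨b, hb⟩ := hK.bounded
  refine tendsto_zero_of_eventually_le_ofReal
    (g := fun n : ℕ => 8 * (A * (3 * A * b) ^ 2) / δ * V n) (by simpa using hV.const_mul _) ?_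
  filter_upwards [hh.eventually_pos] with n ⟨hn, hN⟩
  refine hs.measure_le n (hK.measurableSet_goodDesign (h n) A) (B := fun σ =>
    {w | StageErrorBound (Q n) (est n) (η n) (h n) (V n)
        (outsideFold σ t) (fun j => w j) (fun k => (w k).1) ∧
        δ / (n * h n) ≤ sqStageNoise K (est n) (η n) R (h n) (outsideFold σ t) w})
    (fun σ => (measurableSet_stageErrorBound_obs (hest n _) (hη n) _ _).inter
      (measurableSet_le measurable_const (measurable_sqStageNoise hK (hest n _) (hη n) R (h n))))
    fun σ x hx => ?_
  refine (GoodDesign.measure_sqStageNoise_le hx hK hb hn (hh.pos n) (hη n) (hest n _) hR (hV0 n)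
    (div_pos hδ hN)).trans (le_of_eq ?_)
  congr 1
  have hn' : (n : ℝ) ≠ 0 := by positivity
  have hh' := (hh.pos n).ne'
  field_simp

lemma IsSample.tendsto_measure_stageNoise (hs : IsSample P PX Q W s) (hK : IsRDKernel K)
    (hh : IsBandwidth h) (hη : ∀ n, Measurable (η n))
    (hest : ∀ n (I : Finset (Fin n)),
      Measurable fun wz : (I → Obs (d n)) × (Fin (d n) → ℝ) => est n I wz.1 wz.2)
    (hδ : 0 < δ) {V : ℕ → ℝ} (hV0 : ∀ n, 0 ≤ V n) (hV : Tendsto V atTop (𝓝 0)) (t : Fin S) :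
    Tendsto (fun n => P n {ω | (fun i => (W n i ω).1) ∈ {x | GoodDesign K (h n) A x} ∧
      (fun i => W n i ω) ∈ {w | StageErrorBound (Q n) (est n) (η n) (h n) (V n)
        (outsideFold (s n ω) t) (fun j => w j) (fun k => (w k).1) ∧
        δ / √(n * h n) ≤ |stageNoise K (Q n) (est n) (η n) (h n) (outsideFold (s n ω) t) w|}})
      atTop (𝓝 0) := by
  obtain ⟨b, hb⟩ := hK.bounded
  refine tendsto_zero_of_eventually_le_ofReal
    (g := fun n : ℕ => A * (3 * A * b) ^ 2 / δ ^ 2 * V n) (by simpa using hV.const_mul _) ?_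
  filter_upwards [hh.eventually_pos] with n ⟨hn, hN⟩
  refine hs.measure_le n (hK.measurableSet_goodDesign (h n) A) (B := fun σ =>
    {w | StageErrorBound (Q n) (est n) (η n) (h n) (V n)
        (outsideFold σ t) (fun j => w j) (fun k => (w k).1) ∧
        δ / √(n * h n) ≤ |stageNoise K (Q n) (est n) (η n) (h n) (outsideFold σ t) w|})
    (fun σ => (measurableSet_stageErrorBound_obs (hest n _) (hη n) _ _).inter
      (measurableSet_le measurable_const
        (measurable_abs_real.comp (measurable_stageNoise hK (hest n _) (hη n) (h n)))))
    fun σ x hx => ?_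
  refine (GoodDesign.measure_stageNoise_le hx hK hb hn (hh.pos n) (hη n) (hest n _) (hV0 n)
    (div_pos hδ (Real.sqrt_pos.mpr hN))).trans (le_of_eq ?_)
  congr 1
  rw [div_pow, Real.sq_sqrt hN.le]
  have hn' : (n : ℝ) ≠ 0 := by positivity
  have hh' := (hh.pos n).ne'
  field_simp

/-- At the threshold D / √(nh) Chebyshev gives a bound free of n. The fold moments are only tight at
this scale, and D is taken large later; their smallness comes from the coefficients they multiply.
-/
lemma IsSample.exists_measure_foldMoment_le (hs : IsSample P PX Q W s) (hX : HasRunningDensity PX)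
    (hh : IsBandwidth h) {φ : ℝ → ℝ} (hφ : Measurable φ) {b : ℝ} (hb : ∀ u, |φ u| ≤ b)
    (h0 : ∀ u, 1 < |u| → φ u = 0) :
    ∃ c : ℝ, 0 ≤ c ∧ ∀ D : ℝ, 0 < D → ∀ᶠ n in atTop, P n {ω | ∃ t, ∃ k < 5, D / √(n * h n) <
      |wMoment (foldCoef (outsideFold (s n ω) t)ᶜ) φ (h n) k fun i => (W n i ω).1|} ≤
      ENNReal.ofReal (c / D ^ 2) := by
  choose c hc0 hc using fun k => exists_measure_fold_wMoment_le hX hφ hb h0 hh k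
  refine ⟨S * ∑ k ∈ Finset.range 5, c k,
    mul_nonneg (by positivity) (Finset.sum_nonneg fun k _ => hc0 k), fun D hD => ?_⟩
  have hall : ∀ᶠ n in atTop, ∀ k ∈ Finset.range 5, ∀ a : Fin n → ℝ, (∀ i, |a i| ≤ 1) →
      ∑ i, a i = 0 → ∀ δ : ℝ, 0 < δ → Measure.pi (fun _ : Fin n => PX)
        {x | δ ≤ |wMoment a φ (h n) k x|} ≤ ENNReal.ofReal (c k / (n * h n * δ ^ 2)) :=
    (Filter.eventually_all_finset _).mpr fun k _ => hc k
  filter_upwards [hall, hh.eventually_pos] with n hn ⟨hn0, hN⟩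
  have hsub : {ω | ∃ t, ∃ k < 5, D / √(n * h n) <
      |wMoment (foldCoef (outsideFold (s n ω) t)ᶜ) φ (h n) k fun i => (W n i ω).1|} ⊆
      ⋃ t ∈ (Finset.univ : Finset (Fin S)), ⋃ k ∈ Finset.range 5, {ω | (fun i => (W n i ω).1) ∈
        {x | D / √(n * h n) ≤ |wMoment (foldCoef (outsideFold (s n ω) t)ᶜ) φ (h n) k x|}} := by
    rintro ω ⟨t, k, hk, hlt⟩
    simp only [Finset.mem_univ, Set.iUnion_true, Set.mem_iUnion]
    exact ⟨t, k, Finset.mem_range.mpr hk, hlt.le⟩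
  refine (measure_mono hsub).trans ((measure_biUnion_finset_le _ _).trans
    ((Finset.sum_le_sum fun t _ => measure_biUnion_finset_le _ _).trans ?_))
  have hterm : ∀ t : Fin S, ∀ k ∈ Finset.range 5, P n {ω | (fun i => (W n i ω).1) ∈
      {x | D / √(n * h n) ≤ |wMoment (foldCoef (outsideFold (s n ω) t)ᶜ) φ (h n) k x|}} ≤
      ENNReal.ofReal (c k / D ^ 2) := fun t k hk => by
    refine hs.measure_fst_le n (D := fun σ =>
      {x | D / √(n * h n) ≤ |wMoment (foldCoef (outsideFold σ t)ᶜ) φ (h n) k x|})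
      (fun σ => measurableSet_le measurable_const
        (measurable_abs_real.comp (measurable_wMoment _ hφ _ _))) fun σ => ?_
    refine (hn k hk _ (abs_foldCoef_le _) (sum_foldCoef _) _
      (div_pos hD (Real.sqrt_pos.mpr hN))).trans (le_of_eq ?_)
    congr 1
    rw [div_pow, Real.sq_sqrt hN.le]
    have hn' : (n : ℝ) ≠ 0 := by positivity
    have hh' := (hh.pos n).ne'
    field_simp
  refine (Finset.sum_le_sum fun t _ => Finset.sum_le_sum fun k hk => hterm t k hk).trans
    (le_of_eq ?_)
  rw [Finset.sum_const, Finset.card_univ, Fintype.card_fin, nsmul_eq_mul,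
    ← ENNReal.ofReal_sum_of_nonneg fun k _ => div_nonneg (hc0 k) (sq_nonneg _),
    ← ENNReal.ofReal_natCast, ← ENNReal.ofReal_mul (by positivity), ← Finset.sum_div, mul_div_assoc]

/-- D is fixed first, so that the fold moments cost at most ε / 2; the other failure probabilities
tend to zero and cost ε / 2 for large n. -/
lemma IsSample.exists_measure_not_goodEvent_le (hs : IsSample P PX Q W s)
    (hX : HasRunningDensity PX)
    (hK : IsRDKernel K) (hh : IsBandwidth h) (hη : ∀ n, Measurable (η n))
    (hest : ∀ n (I : Finset (Fin n)),
      Measurable fun wz : (I → Obs (d n)) × (Fin (d n) → ℝ) => est n I wz.1 wz.2)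
    (hgood : Tendsto (fun n => Measure.pi (fun _ : Fin n => PX) {x | ¬ GoodDesign K (h n) A x})
      atTop (𝓝 0))
    (hw : ∀ᶠ n in atTop, WindowMoments (Q n) (η n) (h n) B C) (hR : 0 < R)
    (hmem : ∀ t : Fin S,
      Tendsto (fun n => P n {ω | crossFit (est n) (s n ω) (fun i => W n i ω) t ∉ T n}) atTop (𝓝 0))
    {V : ℕ → ℝ} (hV0 : ∀ n, 0 ≤ V n) (hV : Tendsto V atTop (𝓝 0))
    (hTV : ∀ᶠ n in atTop, ∀ f ∈ T n, ∀ x, |x| ≤ h n →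
      ∫⁻ u, ENNReal.ofReal ((f u.2 - η n u.2) ^ 2) ∂(Q n x) ≤ ENNReal.ofReal (V n))
    (hδ : 0 < δ) {ε : ℝ} (hε : 0 < ε) :
    ∃ D : ℝ, 0 < D ∧ ∀ᶠ n in atTop, P n {ω | ¬ GoodEvent K (Q n) (est n) (η n) (T n) R (h n) A δ D
      (s n ω) fun i => W n i ω} ≤ ENNReal.ofReal ε := by
  obtain ⟨b, hb⟩ := hK.bounded
  obtain ⟨c₁, hc₁, hr⟩ := hs.exists_measure_foldMoment_le hX hh hK.measurable_rightPart
    (abs_rightPart_le (hK.abs_le hb)) fun u hu => hK.rightPart_eq_zero hu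
  obtain ⟨c₂, hc₂, hl⟩ := hs.exists_measure_foldMoment_le hX hh hK.measurable_leftPart
    (abs_leftPart_le (hK.abs_le hb)) fun u hu => hK.leftPart_eq_zero hu
  obtain ⟨D, hD, hDε⟩ : ∃ D : ℝ, 0 < D ∧ (c₁ + c₂) / D ^ 2 ≤ ε / 2 := by
    refine ⟨√(2 * (c₁ + c₂ + 1) / ε), Real.sqrt_pos.mpr (by positivity), ?_⟩
    rw [Real.sq_sqrt (by positivity), div_le_iff₀ (by positivity)]
    have : ε / 2 * (2 * (c₁ + c₂ + 1) / ε) = c₁ + c₂ + 1 := by field_simp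
    linarith
  refine ⟨D, hD, ?_⟩
  set u : ℕ → ℝ≥0∞ := fun n =>
    Measure.pi (fun _ : Fin n => PX) {x | ¬ GoodDesign K (h n) A x} +
    ∑ t, P n {ω | crossFit (est n) (s n ω) (fun i => W n i ω) t ∉ T n} +
    P n {ω | (fun i => (W n i ω).1) ∈ {x | GoodDesign K (h n) A x} ∧
      (fun i => W n i ω) ∈ {w | δ / (n * h n) ≤ |sqNoise K (Q n) (η n) R (h n) w|}} +
    P n {ω | (fun i => (W n i ω).1) ∈ {x | GoodDesign K (h n) A x} ∧
      (fun i => W n i ω) ∈ {w | δ / (n * h n) ≤ |pairNoise K (Q n) (η n) R (h n) w|}} +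
    ∑ t, P n {ω | (fun i => (W n i ω).1) ∈ {x | GoodDesign K (h n) A x} ∧
      (fun i => W n i ω) ∈ {w | StageErrorBound (Q n) (est n) (η n) (h n) (V n)
        (outsideFold (s n ω) t) (fun j => w j) (fun k => (w k).1) ∧
        δ / (n * h n) ≤ sqStageNoise K (est n) (η n) R (h n) (outsideFold (s n ω) t) w}} +
    ∑ t, P n {ω | (fun i => (W n i ω).1) ∈ {x | GoodDesign K (h n) A x} ∧
      (fun i => W n i ω) ∈ {w | StageErrorBound (Q n) (est n) (η n) (h n) (V n)
        (outsideFold (s n ω) t) (fun j => w j) (fun k => (w k).1) ∧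
        δ / √(n * h n) ≤ |stageNoise K (Q n) (est n) (η n) (h n) (outsideFold (s n ω) t) w|}}
    with hu
  have hu0 : Tendsto u atTop (𝓝 0) := by
    have hsum : ∀ {f : Fin S → ℕ → ℝ≥0∞}, (∀ t, Tendsto (f t) atTop (𝓝 0)) →
        Tendsto (fun n => ∑ t, f t n) atTop (𝓝 0) := fun {f} hf => by
      simpa using tendsto_finsetSum Finset.univ fun t _ => hf t
    have := ((((hgood.add (hsum hmem)).add
      (hs.tendsto_measure_sqNoise (A := A) hK hh hη hw R hδ)).add
      (hs.tendsto_measure_pairNoise (A := A) hK hh hη hw hR hδ)).add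
      (hsum (hs.tendsto_measure_sqStageNoise (A := A) hK hh hη hest hR hδ hV0 hV))).add
      (hsum (hs.tendsto_measure_stageNoise (A := A) hK hh hη hest hδ hV0 hV))
    rw [hu]
    simpa only [add_zero] using this
  have hε2 : (0 : ℝ≥0∞) < ENNReal.ofReal (ε / 2) := ENNReal.ofReal_pos.mpr (by positivity)
  filter_upwards [hu0.eventually (ge_mem_nhds hε2), hr D hD, hl D hD, hTV] with n hun hrn hln hTVn
  set E₀ : Set (Ω n) := {ω | (fun i => (W n i ω).1) ∈ {x | ¬ GoodDesign K (h n) A x}} with hE₀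
  set E₁ : Fin S → Set (Ω n) :=
    fun t => {ω | crossFit (est n) (s n ω) (fun i => W n i ω) t ∉ T n} with hE₁
  set E₂ : Set (Ω n) := {ω | (fun i => (W n i ω).1) ∈ {x | GoodDesign K (h n) A x} ∧
    (fun i => W n i ω) ∈ {w | δ / (n * h n) ≤ |sqNoise K (Q n) (η n) R (h n) w|}} with hE₂
  set E₃ : Set (Ω n) := {ω | (fun i => (W n i ω).1) ∈ {x | GoodDesign K (h n) A x} ∧
    (fun i => W n i ω) ∈ {w | δ / (n * h n) ≤ |pairNoise K (Q n) (η n) R (h n) w|}} with hE₃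
  set E₄ : Fin S → Set (Ω n) := fun t =>
    {ω | (fun i => (W n i ω).1) ∈ {x | GoodDesign K (h n) A x} ∧
      (fun i => W n i ω) ∈ {w | StageErrorBound (Q n) (est n) (η n) (h n) (V n)
        (outsideFold (s n ω) t) (fun j => w j) (fun k => (w k).1) ∧
        δ / (n * h n) ≤ sqStageNoise K (est n) (η n) R (h n) (outsideFold (s n ω) t) w}} with hE₄
  set E₅ : Fin S → Set (Ω n) := fun t =>
    {ω | (fun i => (W n i ω).1) ∈ {x | GoodDesign K (h n) A x} ∧
      (fun i => W n i ω) ∈ {w | StageErrorBound (Q n) (est n) (η n) (h n) (V n)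
        (outsideFold (s n ω) t) (fun j => w j) (fun k => (w k).1) ∧
        δ / √(n * h n) ≤ |stageNoise K (Q n) (est n) (η n) (h n) (outsideFold (s n ω) t) w|}}
    with hE₅
  set E₆ : Set (Ω n) := {ω | ∃ t, ∃ k < 5, D / √(n * h n) <
    |wMoment (foldCoef (outsideFold (s n ω) t)ᶜ) (rightPart K) (h n) k fun i => (W n i ω).1|}
    with hE₆
  set E₇ : Set (Ω n) := {ω | ∃ t, ∃ k < 5, D / √(n * h n) <
    |wMoment (foldCoef (outsideFold (s n ω) t)ᶜ) (leftPart K) (h n) k fun i => (W n i ω).1|}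
    with hE₇
  have hsub : {ω | ¬ GoodEvent K (Q n) (est n) (η n) (T n) R (h n) A δ D (s n ω)
      fun i => W n i ω} ⊆ E₀ ∪ (⋃ t ∈ (Finset.univ : Finset (Fin S)), E₁ t) ∪ E₂ ∪ E₃ ∪
      (⋃ t ∈ (Finset.univ : Finset (Fin S)), E₄ t) ∪
      (⋃ t ∈ (Finset.univ : Finset (Fin S)), E₅ t) ∪ E₆ ∪ E₇ := by
    intro ω hω
    by_contra hcon
    simp only [Set.mem_union, Finset.mem_univ, Set.iUnion_true, Set.mem_iUnion, not_or,
      not_exists] at hcon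
    obtain ⟨⟨⟨⟨⟨⟨⟨h0, h1⟩, h2⟩, h3⟩, h4⟩, h5⟩, h6⟩, h7⟩ := hcon
    have hdes : GoodDesign K (h n) A fun i => (W n i ω).1 := not_not.mp h0
    have hmemT : ∀ t, crossFit (est n) (s n ω) (fun i => W n i ω) t ∈ T n :=
      fun t => not_not.mp (h1 t)
    -- Membership in T n is used only through this consequence, which is a measurable condition on
    -- the data, as conditioning requires.
    have hbound : ∀ t, StageErrorBound (Q n) (est n) (η n) (h n) (V n) (outsideFold (s n ω) t)
        (fun j => W n j ω) fun k => (W n k ω).1 := fun t i hi => hTVn _ (hmemT t) _ hi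
    exact hω
      { design := hdes
        mem := hmemT
        sq := not_le.mp fun hle => h2 ⟨hdes, hle⟩
        pair := not_le.mp fun hle => h3 ⟨hdes, hle⟩
        sqStage := fun t => not_le.mp fun hle => h4 t ⟨hdes, hbound t, hle⟩
        stage := fun t => not_le.mp fun hle => h5 t ⟨hdes, hbound t, hle⟩
        fold_right := fun t k hk => not_lt.mp fun hlt => h6 ⟨t, k, hk, hlt⟩
        fold_left := fun t k hk => not_lt.mp fun hlt => h7 ⟨t, k, hk, hlt⟩ }
  have h0 : P n E₀ ≤ Measure.pi (fun _ : Fin n => PX) {x | ¬ GoodDesign K (h n) A x} :=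
    hs.measure_fst_le n (D := fun _ => {x | ¬ GoodDesign K (h n) A x})
      (fun _ => (hK.measurableSet_goodDesign (h n) A).compl) fun _ => le_rfl
  have hle : P n {ω | ¬ GoodEvent K (Q n) (est n) (η n) (T n) R (h n) A δ D (s n ω)
      fun i => W n i ω} ≤ u n + P n E₆ + P n E₇ := by
    refine (measure_mono hsub).trans ?_
    refine (measure_union_le _ _).trans (add_le_add_left ?_ _)
    refine (measure_union_le _ _).trans (add_le_add_left ?_ _)
    refine (measure_union_le _ _).trans (add_le_add ?_ (measure_biUnion_finset_le _ _))
    refine (measure_union_le _ _).trans (add_le_add ?_ (measure_biUnion_finset_le _ _))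
    refine (measure_union_le _ _).trans (add_le_add_left ?_ _)
    refine (measure_union_le _ _).trans (add_le_add_left ?_ _)
    exact (measure_union_le _ _).trans (add_le_add h0 (measure_biUnion_finset_le _ _))
  calc _ ≤ u n + P n E₆ + P n E₇ := hle
    _ ≤ ENNReal.ofReal (ε / 2) + ENNReal.ofReal (c₁ / D ^ 2) + ENNReal.ofReal (c₂ / D ^ 2) :=
        add_le_add (add_le_add hun hrn) hln
    _ = ENNReal.ofReal (ε / 2 + c₁ / D ^ 2 + c₂ / D ^ 2) := by
        rw [ENNReal.ofReal_add (by positivity) (by positivity),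
          ENNReal.ofReal_add (by positivity) (by positivity)]
    _ ≤ ENNReal.ofReal ε := by
        refine ENNReal.ofReal_le_ofReal ?_
        rw [add_div] at hDε
        linarith

end Sample

/-! ## Consequences of the assumptions near the cutoff -/

/-- It makes the window 𝒳_h equal to the whole interval [-h, h], inside the interior of the support,
for large n. -/
lemma HasRunningDensity.support_mem_nhds {PX : Measure ℝ} (hX : HasRunningDensity PX) :
    PX.support ∈ 𝓝 (0 : ℝ) := by
  obtain ⟨f, hf, hf0, rfl, U, hU, h0, -, c, hc, hcU⟩ := hX
  refine mem_of_superset (hU.mem_nhds h0) fun x hx => ?_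
  rw [Measure.mem_support_iff_forall]
  intro V hV
  obtain ⟨O, hOV, hO, hxO⟩ := mem_nhds_iff.mp (inter_mem hV (hU.mem_nhds hx))
  have hpos : 0 < volume O := hO.measure_pos volume ⟨x, hxO⟩
  have hle : ENNReal.ofReal c * volume O ≤
      volume.withDensity (fun x => ENNReal.ofReal (f x)) O := by
    rw [withDensity_apply _ hO.measurableSet, ← setLIntegral_const]
    exact setLIntegral_mono' hO.measurableSet fun y hy =>
      ENNReal.ofReal_le_ofReal (hcU y (hOV hy).2)
  calc 0 < ENNReal.ofReal c * volume O := ENNReal.mul_pos (ENNReal.ofReal_pos.mpr hc).ne' hpos.ne'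
    _ ≤ _ := hle
    _ ≤ _ := measure_mono fun y hy => (hOV hy).1

lemma IsBandwidth.eventually_Icc_subset {h : ℕ → ℝ} (hh : IsBandwidth h) {s : Set ℝ}
    (hs : s ∈ 𝓝 (0 : ℝ)) : ∀ᶠ n in atTop, Set.Icc (-h n) (h n) ⊆ s := by
  obtain ⟨ε, hε, hball⟩ := Metric.mem_nhds_iff.mp hs
  filter_upwards [hh.tendsto_zero.eventually (gt_mem_nhds hε)] with n hn x hx
  refine hball ?_
  rw [Metric.mem_ball, Real.dist_eq, sub_zero]
  exact (_root_.abs_le.mpr hx).trans_lt hn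

/-! ### Derivatives from smoothness and sidewise Lipschitz bounds -/

section Smoothness

variable {f : ℝ → ℝ} {O : Set ℝ} {L : ℝ}

lemma differentiableAt_iteratedDeriv_of_contDiffOn {m : ℕ} (hO : IsOpen O)
    (hf : ContDiffOn ℝ m f O) {x : ℝ} (hx : x ∈ O) {j : ℕ} (hj : j < m) :
    DifferentiableAt ℝ (iteratedDeriv j f) x := by
  have h1 := (hf.differentiableOn_iteratedDerivWithin (m := j) (by exact_mod_cast hj)
    hO.uniqueDiffOn) x hx
  exact ((h1.congr (fun y hy => (iteratedDerivWithin_of_isOpen hO hy).symm)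
    (iteratedDerivWithin_of_isOpen hO hx).symm).differentiableAt (hO.mem_nhds hx))

/-- Points near x ≠ 0 lie on its side of the cutoff, so f is Lipschitz at x in the ordinary sense.
-/
lemma SidewiseLipschitz.abs_deriv_le {A : Set ℝ} (hf : SidewiseLipschitz L f A) {x : ℝ}
    (hx : A ∈ 𝓝 x) (hx0 : x ≠ 0) (hd : DifferentiableAt ℝ f x) : |deriv f x| ≤ |L| := by
  rw [← Real.norm_eq_abs]
  refine hd.hasDerivAt.le_of_lip' (abs_nonneg _) ?_
  have hpos : ∀ᶠ y in 𝓝 x, 0 < y * x :=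
    (continuousAt_id.mul continuousAt_const).eventually (lt_mem_nhds (mul_self_pos.mpr hx0))
  filter_upwards [hx, hpos] with y hy hyx
  exact (hf y hy x (mem_of_mem_nhds hx) hyx).trans
    (mul_le_mul_of_nonneg_right (le_abs_self L) (abs_nonneg _))

end Smoothness

/-! ### Jump at the cutoff, oracle bias and mean first-stage error -/

section RD

variable {n d : ℕ} {K : ℝ → ℝ} {Q : Kernel ℝ (ℝ × (Fin d → ℝ))} {η : (Fin d → ℝ) → ℝ}
  {h A b τ : ℝ} {x : Fin n → ℝ}

/-- One-sided limits of `E[M(η) | X = x]` at the cutoff differ by the RD parameter. -/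
lemma IsRDParameter.exists_tendsto_condMean (hτ : IsRDParameter Q τ) (hη : η ∈ Admissible Q)
    (hint : ∀ᶠ y in 𝓝 (0 : ℝ), Integrable (adjOutcome η) (Q y)) :
    ∃ a c : ℝ, Tendsto (condMean Q η) (𝓝[>] 0) (𝓝 a) ∧ Tendsto (condMean Q η) (𝓝[<] 0) (𝓝 c) ∧
      τ = a - c := by
  obtain ⟨a, c, ha, hc, hac⟩ := hτ
  obtain ⟨-, hηint, hηC⟩ := hη
  have heq : ∀ᶠ y in 𝓝 (0 : ℝ),
      condMean Q η y = (∫ u, u.1 ∂(Q y)) - ∫ u, η u.2 ∂(Q y) := by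
    filter_upwards [hint, hηint] with y h1 h2
    have h3 : Integrable (fun u : ℝ × (Fin d → ℝ) => u.1) (Q y) := by
      refine (h1.add h2).congr (Eventually.of_forall fun u => ?_)
      simp [adjOutcome]
    rw [← integral_sub h3 h2]; rfl
  -- The mean of η(Z) is continuous at the cutoff, so it shifts both one-sided limits by the same
  -- amount and leaves the jump unchanged.
  have hG := hηC.continuousAt.tendsto
  refine ⟨a - ∫ u, η u.2 ∂(Q 0), c - ∫ u, η u.2 ∂(Q 0), ?_, ?_, by rw [hac]; ring⟩
  · refine (ha.sub (hG.mono_left nhdsWithin_le_nhds)).congr' ?_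
    exact (heq.filter_mono nhdsWithin_le_nhds).mono fun y hy => hy.symm
  · refine (hc.sub (hG.mono_left nhdsWithin_le_nhds)).congr' ?_
    exact (heq.filter_mono nhdsWithin_le_nhds).mono fun y hy => hy.symm

/-- Conditional bias of the local quadratic estimator. -/
lemma GoodDesign.abs_bias_le (hx : GoodDesign K h A x) (hK : IsRDKernel K) (hb : ∀ u, K u ≤ b)
    (hn : 0 < n) (hh : 0 < h) {f : ℝ → ℝ} {a c C L : ℝ} {O : Set ℝ} (hO : IsOpen O)
    (hIcc : Set.Icc (-h) h ⊆ O) (hf : ContDiffOn ℝ 3 f (O \ {0}))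
    (h2 : ∀ y ∈ O \ {0}, |iteratedDeriv 2 f y| ≤ C) (h3 : ∀ y ∈ O \ {0}, |iteratedDeriv 3 f y| ≤ C)
    (hL : SidewiseLipschitz L f O) (ha : Tendsto f (𝓝[>] 0) (𝓝 a))
    (hc : Tendsto f (𝓝[<] 0) (𝓝 c)) :
    |∑ i, weight K h 2 0 x i * f (x i) - (a - c)| ≤ 6 * A ^ 2 * b * (C * h ^ 3) := by
  have hO' : IsOpen (O \ {0}) := hO.sdiff isClosed_singleton
  have hd : ∀ j, j < 3 → ∀ y ∈ O \ {0}, DifferentiableAt ℝ (iteratedDeriv j f) y :=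
    fun j hj y hy => differentiableAt_iteratedDeriv_of_contDiffOn hO' (m := 3) hf hy hj
  have h1 : ∀ y ∈ O \ {0}, |deriv f y| ≤ |L| := fun y hy =>
    hL.abs_deriv_le (hO.mem_nhds hy.1) hy.2 (by simpa using hd 0 (by norm_num) y hy)
  have hr : ∀ y ∈ Set.Ioc 0 h, y ∈ O \ {0} := fun y hy =>
    ⟨hIcc ⟨by linarith [hy.1], hy.2⟩, hy.1.ne'⟩
  have hl : ∀ y ∈ Set.Ico (-h) 0, y ∈ O \ {0} := fun y hy =>
    ⟨hIcc ⟨hy.1, by linarith [hy.2]⟩, hy.2.ne⟩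
  have e1 := hx.abs_rightBias_le hK hb hn hh (fun j hj y hy => hd j hj y (hr y hy))
    (fun y hy => h1 y (hr y ⟨hy.1, hy.2.le⟩)) (fun y hy => h2 y (hr y hy))
    (fun y hy => h3 y (hr y hy)) ha
  have e2 := hx.abs_leftBias_le hK hb hn hh (fun j hj y hy => hd j hj y (hl y hy))
    (fun y hy => h1 y (hl y ⟨hy.1.le, hy.2⟩)) (fun y hy => h2 y (hl y hy))
    (fun y hy => h3 y (hl y hy)) hc
  have hsplit : ∑ i, weight K h 2 0 x i * f (x i) - (a - c) =
      (∑ i, sideWeight (kernelRight K h) 2 0 x i * f (x i) - a) -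
      (∑ i, sideWeight (kernelLeft K h) 2 0 x i * f (x i) - c) := by
    simp only [weight, sub_mul, Finset.sum_sub_distrib]; ring
  rw [hsplit]
  calc _ ≤ _ := abs_sub _ _
    _ ≤ _ := add_le_add e1 e2
    _ = _ := by ring

/-- The conditional mean of the first-stage error is close to a small quadratic polynomial. -/
lemma exists_quadratic_approx_errorMean [IsMarkovKernel Q] (hh : 0 < h) {f : (Fin d → ℝ) → ℝ}
    (hf : f ∈ Admissible Q) (hη : η ∈ Admissible Q) {V : ℝ} (hV : 0 ≤ V)
    (h0 : ∫⁻ u, ENNReal.ofReal ((f u.2 - η u.2) ^ 2) ∂(Q 0) ≤ ENNReal.ofReal V) {c : ℕ → ℝ}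
    (hd : ∀ j < 3, ∀ y ∈ Set.Icc (-h) h \ {0},
      DifferentiableAt ℝ (iteratedDeriv j fun y => ∫ u, (f u.2 - η u.2) ∂(Q y)) y ∧
      |iteratedDeriv (j + 1) (fun y => ∫ u, (f u.2 - η u.2) ∂(Q y)) y| ≤ c (j + 1)) :
    ∃ a₀ a₁ a₂ : ℝ, |a₀| ≤ √V ∧ |a₁| ≤ c 1 ∧ |a₂| ≤ c 2 ∧ ∀ y, y ≠ 0 → |y| ≤ h →
      |∫ u, (f u.2 - η u.2) ∂(Q y) - (a₀ + a₁ * y + a₂ * y ^ 2)| ≤ c 3 * h ^ 3 := by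
  obtain ⟨hfm, hfint, hfC⟩ := hf
  obtain ⟨hηm, hηint, hηC⟩ := hη
  set g : ℝ → ℝ := fun y => ∫ u, (f u.2 - η u.2) ∂(Q y) with hg
  have hgC : ContDiffAt ℝ 2 g 0 := by
    refine (hfC.sub hηC).congr_of_eventuallyEq ?_
    filter_upwards [hfint, hηint] with y h1 h2
    exact integral_sub h1 h2
  obtain ⟨a₁, a₂, h1, h2, h3⟩ := exists_quadratic_approx hh hgC hd
  refine ⟨g 0, a₁, a₂, ?_, h1, h2, fun y hy hyh => (h3 y hy hyh).trans ?_⟩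
  · have hm : Measurable fun u : ℝ × (Fin d → ℝ) => f u.2 - η u.2 := by fun_prop
    have hL2 : MemLp (fun u : ℝ × (Fin d → ℝ) => f u.2 - η u.2) 2 (Q 0) := by
      rw [memLp_two_iff_integrable_sq hm.aestronglyMeasurable]
      refine ⟨(hm.pow_const 2).aestronglyMeasurable, ?_⟩
      rw [hasFiniteIntegral_iff_ofReal (Eventually.of_forall fun u => sq_nonneg _)]
      exact h0.trans_lt ENNReal.ofReal_lt_top
    -- Jensen's inequality, as non-negativity of the variance: the squared mean at 0 is at most the
    -- mean square.
    have hvar := variance_eq_sub hL2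
    have hnn := variance_nonneg (fun u : ℝ × (Fin d → ℝ) => f u.2 - η u.2) (Q 0)
    have hle : ∫ u, ((fun u : ℝ × (Fin d → ℝ) => f u.2 - η u.2) ^ 2) u ∂(Q 0) ≤ V := by
      simp only [Pi.pow_apply]
      rw [integral_eq_lintegral_of_nonneg_ae (Eventually.of_forall fun u => sq_nonneg _)
        (hm.pow_const 2).aestronglyMeasurable]
      exact ENNReal.toReal_le_of_le_ofReal hV h0
    refine Real.abs_le_sqrt ?_
    change (∫ u, (f u.2 - η u.2) ∂(Q 0)) ^ 2 ≤ V
    linarith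
  · have hc3 : 0 ≤ c 3 := (abs_nonneg _).trans
      (hd 2 (by norm_num) h ⟨⟨by linarith, le_rfl⟩, hh.ne'⟩).2
    gcongr

end RD

/-! ## Quantiles of the standard normal law -/

section Quantile

variable {u : ℝ}

/-- The infimum is attained, by right continuity of the distribution function. -/
lemma le_cdf_normalQuantile (hu1 : u < 1) :
    u ≤ cdf (gaussianReal 0 1) (normalQuantile u) := by
  set F := cdf (gaussianReal 0 1) with hF
  have hne : {t : ℝ | u ≤ F t}.Nonempty :=
    (((tendsto_cdf_atTop (gaussianReal 0 1)).eventually (le_mem_nhds hu1)).exists)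
  have h1 : Tendsto F (𝓝[>] normalQuantile u) (𝓝 (F (normalQuantile u))) :=
    ((F.right_continuous _).mono Set.Ioi_subset_Ici_self).tendsto
  refine ge_of_tendsto h1 ?_
  filter_upwards [self_mem_nhdsWithin] with t ht
  obtain ⟨y, hy, hyt⟩ := exists_lt_of_csInf_lt hne ht
  exact le_trans hy (F.mono hyt.le)

lemma gaussianReal_real_Ici_neg (t : ℝ) :
    (gaussianReal 0 1).real (Set.Iic (-t)) = (gaussianReal 0 1).real (Set.Ici t) := by
  have h1 : (gaussianReal 0 1).map (fun x : ℝ => -x) = gaussianReal 0 1 := by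
    rw [gaussianReal_map_neg, neg_zero]
  conv_lhs => rw [← h1]
  rw [map_measureReal_apply measurable_neg measurableSet_Iic]
  congr 1
  ext x; simp

/-- A negative t in the set would give two disjoint half-lines, symmetric to each other, of mass
above 1/2 each. -/
lemma normalQuantile_nonneg (hu0 : 1 / 2 < u) (hu1 : u < 1) : 0 ≤ normalQuantile u := by
  refine le_csInf
    (((tendsto_cdf_atTop (gaussianReal 0 1)).eventually (le_mem_nhds hu1)).exists) fun t ht => ?_
  by_contra hneg
  rw [not_le] at hneg
  have h1 : u ≤ (gaussianReal 0 1).real (Set.Iic t) := by rw [← cdf_eq_real]; exact ht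
  have h2 := gaussianReal_real_Ici_neg (-t)
  rw [neg_neg] at h2
  have hdisj : Disjoint (Set.Iic t) (Set.Ici (-t)) := by
    rw [Set.disjoint_left]
    intro y hy hy'
    simp only [Set.mem_Iic, Set.mem_Ici] at hy hy'
    linarith
  have h3 := measureReal_union (μ := gaussianReal 0 1) hdisj measurableSet_Ici
  have h4 : (gaussianReal 0 1).real (Set.Iic t ∪ Set.Ici (-t)) ≤ 1 := measureReal_le_one
  linarith

/-- Each of the two tails has mass at most α / 2, by absence of atoms and symmetry. -/
lemma gaussianReal_normalQuantile_le_abs {α : ℝ} (hα₀ : 0 < α) :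
    (gaussianReal 0 1).real {y | normalQuantile (1 - α / 2) ≤ |y|} ≤ α := by
  set z := normalQuantile (1 - α / 2) with hz
  have h1 : 1 - α / 2 ≤ (gaussianReal 0 1).real (Set.Iic z) := by
    rw [← cdf_eq_real]; exact le_cdf_normalQuantile (by linarith)
  have h2 : (gaussianReal 0 1).real (Set.Ici z) = 1 - (gaussianReal 0 1).real (Set.Iic z) := by
    rw [← probReal_compl_eq_one_sub measurableSet_Iic, Set.compl_Iic]
    have : NullSingletonClass (gaussianReal 0 1) := nullSingletonClass_gaussianReal one_ne_zero
    exact measureReal_congr Ioi_ae_eq_Ici.symm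
  have h3 := gaussianReal_real_Ici_neg z
  have hsub : {y : ℝ | z ≤ |y|} ⊆ Set.Ici z ∪ Set.Iic (-z) := by
    intro y hy
    rcases le_abs'.mp (show z ≤ |y| from hy) with h | h
    · exact Or.inr h
    · exact Or.inl h
  calc _ ≤ (gaussianReal 0 1).real (Set.Ici z ∪ Set.Iic (-z)) := measureReal_mono hsub
    _ ≤ _ := measureReal_union_le _ _
    _ ≤ α := by linarith

/-- The two-sided tail probability is left continuous. -/
lemma exists_gaussianReal_le_abs_lt {z : ℝ} (hz : 0 ≤ z) {c : ℝ}
    (hc : (gaussianReal 0 1).real {y | z ≤ |y|} < c) :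
    ∃ ε : ℝ, 0 < ε ∧ ε < 1 ∧ (gaussianReal 0 1).real {y | z * (1 - ε) - ε ≤ |y|} < c := by
  -- A sequence decreasing to 0, with + 2 to stay below 1. The events decrease to the limiting one,
  -- so continuity from above applies.
  set e : ℕ → ℝ := fun k => 1 / ((k : ℝ) + 2) with he
  have he0 : ∀ k, 0 < e k := fun k => by positivity
  have he1 : ∀ k, e k < 1 := fun k => by
    rw [he]; simp only
    rw [div_lt_one (by positivity)]
    have : (0 : ℝ) ≤ k := by positivity
    linarith
  have helim : Tendsto e atTop (𝓝 0) :=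
    tendsto_const_nhds.div_atTop
      (tendsto_atTop_add_const_right _ _ tendsto_natCast_atTop_atTop)
  set s : ℕ → Set ℝ := fun k => {y | z * (1 - e k) - e k ≤ |y|} with hs
  have hanti : Antitone s := by
    intro i j hij y hy
    have : e j ≤ e i := one_div_le_one_div_of_le (by positivity) (by gcongr)
    simp only [hs, Set.mem_ofPred_eq] at hy ⊢
    nlinarith
  have hlim := tendsto_measure_iInter_atTop (μ := gaussianReal 0 1) (s := s)
    (fun k => (measurableSet_le measurable_const measurable_abs_real).nullMeasurableSet) hanti
    ⟨0, measure_ne_top _ _⟩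
  have hInter : ⋂ k, s k = {y : ℝ | z ≤ |y|} := by
    ext y
    simp only [hs, Set.mem_iInter, Set.mem_ofPred_eq]
    refine ⟨fun hy => ?_, fun hy k => ?_⟩
    · have h1 : Tendsto (fun k => z * (1 - e k) - e k) atTop (𝓝 (z * (1 - 0) - 0)) :=
        ((helim.const_sub 1).const_mul z).sub helim
      have := le_of_tendsto h1 (Eventually.of_forall hy)
      linarith
    · nlinarith [he0 k]
  rw [hInter] at hlim
  have hlim' := (ENNReal.tendsto_toReal (measure_ne_top _ _)).comp hlim
  obtain ⟨k, hk⟩ := (hlim'.eventually (gt_mem_nhds hc)).exists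
  exact ⟨e k, he0 k, he1 k, hk⟩

end Quantile

/-! ## Coverage of the robust bias-corrected interval -/

section Coverage

/-- A miss means that the error exceeds z times the standard error, hence z (1 - ε) standard
deviations; of this, the remainder accounts for at most ε standard deviations and the noise for the
rest. -/
lemma GoodDesign.le_abs_stdNoise {n d : ℕ} {K : ℝ → ℝ} {Q : Kernel ℝ (ℝ × (Fin d → ℝ))}
    {η : (Fin d → ℝ) → ℝ} {R : ℕ} {h A τ ε α : ℝ} {w : Fin n → Obs d} {m : Fin n → ℝ}
    (hx : GoodDesign K h A fun k => (w k).1) (hV : 0 < designVar K Q η h fun k => (w k).1)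
    (hz : 0 ≤ normalQuantile (1 - α / 2))
    (h1 : |localPoly K h 2 0 (fun k => (w k).1) m - τ - oracleNoise K Q η h w| ≤
      ε * √(designVar K Q η h fun k => (w k).1))
    (h2 : (1 - ε) ^ 2 * designVar K Q η h (fun k => (w k).1) ≤
      stdError K h 2 0 R (fun k => (w k).1) m ^ 2)
    (hτ : τ ∉ rbcInterval K h R α (fun k => (w k).1) m) :
    normalQuantile (1 - α / 2) * (1 - ε) - ε ≤ |stdNoise K Q η h A w| := by
  rw [stdNoise, if_pos hx]
  set σ := √(designVar K Q η h fun k => (w k).1) with hσ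
  set z := normalQuantile (1 - α / 2)
  set t := localPoly K h 2 0 (fun k => (w k).1) m
  set e := stdError K h 2 0 R (fun k => (w k).1) m
  have hσ0 : 0 < σ := Real.sqrt_pos.mpr hV
  have he : (1 - ε) * σ ≤ e := by
    rw [← Real.sq_sqrt hV.le, ← mul_pow] at h2
    exact le_of_sq_le_sq h2 (Real.sqrt_nonneg _)
  have ht : z * e < |t - τ| := by
    by_contra hcon
    rw [not_lt, _root_.abs_le] at hcon
    exact hτ ⟨by linarith, by linarith⟩
  rw [abs_div, abs_of_pos hσ0, le_div_iff₀ hσ0]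
  have h3 : |t - τ| ≤ |t - τ - oracleNoise K Q η h w| + |oracleNoise K Q η h w| := by
    have := abs_add_le (t - τ - oracleNoise K Q η h w) (oracleNoise K Q η h w)
    rwa [sub_add_cancel] at this
  have h4 := mul_le_mul_of_nonneg_left he hz
  nlinarith

lemma one_div_sqrt_le {N q v : ℝ} (hN : 0 < N) (hq : 0 ≤ q) (h : 1 ≤ q * N * v) :
    1 / √N ≤ √q * √v := by
  have hN' : 0 < √N := Real.sqrt_pos.mpr hN
  rw [div_le_iff₀ hN', mul_right_comm, ← Real.sqrt_mul hq, ← Real.sqrt_mul (by positivity)]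
  exact Real.one_le_sqrt.mpr h

/-- Rescaled form of the estimation error bound. -/
lemma error_le_mul_sqrt {N q dV s β S h₃ V₃ A D b δ ε ρ : ℝ} (hN : 0 < N) (hq : 0 ≤ q)
    (hdV : 1 ≤ q * N * dV)
    (hs : s = √N * h₃) (hpos : 0 ≤ β * s + S * (δ + 18 * A * D * ρ + 3 * A ^ 2 * b * (V₃ * s)))
    (hε : √q * (β * s + S * (δ + 18 * A * D * ρ + 3 * A ^ 2 * b * (V₃ * s))) ≤ ε) :
    β * h₃ + S * (δ / √N + (18 * A * (D / √N) * ρ + 3 * A ^ 2 * b * (V₃ * h₃))) ≤ ε * √dV := by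
  have hN' : 0 < √N := Real.sqrt_pos.mpr hN
  have h1 := one_div_sqrt_le hN hq hdV
  calc _ = 1 / √N * (β * s + S * (δ + 18 * A * D * ρ + 3 * A ^ 2 * b * (V₃ * s))) := by
        rw [hs]; field_simp; ring
    _ ≤ √q * √dV * (β * s + S * (δ + 18 * A * D * ρ + 3 * A ^ 2 * b * (V₃ * s))) :=
        mul_le_mul_of_nonneg_right h1 hpos
    _ = √q * (β * s + S * (δ + 18 * A * D * ρ + 3 * A ^ 2 * b * (V₃ * s))) * √dV := by ring
    _ ≤ _ := mul_le_mul_of_nonneg_right hε (Real.sqrt_nonneg _)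

/-- Rescaled form of the lower bound for the squared standard error. -/
lemma sq_mul_le_of_rescaled {N q dV S R c₁ B₁ M k δ ε : ℝ} (hN : 0 < N) (hdV : 1 ≤ q * N * dV)
    (hdV0 : 0 ≤ dV) (hε0 : 0 < ε) (hε1 : ε < 1) (hR : 0 ≤ R) (hB : 0 ≤ B₁) (hδ : 0 ≤ δ)
    (hS : 0 ≤ S) (hk : 0 ≤ k)
    (hsmall : q * (2 * R * (c₁ ^ 2 * B₁) / N + 3 * δ + 2 / ε * (2 * M ^ 2 * k + S * δ)) ≤ ε / 2) :
    (1 - ε) ^ 2 * dV ≤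
      (1 - ε / 2) * (dV - 2 * R * ((c₁ / N) ^ 2 * B₁) - 3 * (δ / N)) -
        1 / (ε / 2) * (2 * M ^ 2 * (k / N) + S * (δ / N)) := by
  set e := 2 * R * (c₁ ^ 2 * B₁) / N + 3 * δ + 2 / ε * (2 * M ^ 2 * k + S * δ) with he
  have he0 : 0 ≤ e := by positivity
  have h1 : 1 / N ≤ q * dV := by
    rw [div_le_iff₀ hN]; linarith
  have h2 : 1 / N * e ≤ ε / 2 * dV := by
    calc _ ≤ q * dV * e := mul_le_mul_of_nonneg_right h1 he0
      _ = q * e * dV := by ring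
      _ ≤ _ := mul_le_mul_of_nonneg_right hsmall hdV0
  have h3 : 1 / N * e = (2 * R * ((c₁ / N) ^ 2 * B₁) + 3 * (δ / N)) +
      1 / (ε / 2) * (2 * M ^ 2 * (k / N) + S * (δ / N)) := by
    rw [he]; field_simp
  have h4 : 0 ≤ 2 * R * ((c₁ / N) ^ 2 * B₁) + 3 * (δ / N) := by positivity
  -- Half of the loss ε comes from the factor 1 - ε / 2 and half from the remainders. The square
  -- fits the later passage to square roots.
  have h5 : (1 - ε) ^ 2 * dV ≤ (1 - ε) * dV :=
    mul_le_mul_of_nonneg_right (by nlinarith) hdV0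
  have h6 : 0 ≤ ε / 2 * (2 * R * ((c₁ / N) ^ 2 * B₁) + 3 * (δ / N)) := by positivity
  linarith

variable {d : ℕ → ℕ} {S R : ℕ} {Ω : ℕ → Type*} [∀ n, MeasurableSpace (Ω n)]
  {P : (n : ℕ) → Measure (Ω n)} {PX : Measure ℝ} {Q : (n : ℕ) → Kernel ℝ (ℝ × (Fin (d n) → ℝ))}
  {W : (n : ℕ) → Fin n → Ω n → Obs (d n)} {s : (n : ℕ) → Ω n → Fin n → Fin S}
  {est : (n : ℕ) → FirstStageEstimator n (d n)} {K : ℝ → ℝ} {h τ r : ℕ → ℝ} {v : ℕ → ℕ → ℝ}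
  {T : (n : ℕ) → Set ((Fin (d n) → ℝ) → ℝ)} {η : (n : ℕ) → (Fin (d n) → ℝ) → ℝ} {B C : ℝ}

lemma FirstStageAssumption.eventually_contraction
    (hfirst : FirstStageAssumption P Q W s est T η (fun n => window PX (h n)) r)
    (hwin : ∀ᶠ n in atTop, Set.Icc (-h n) (h n) ⊆ interior PX.support) :
    ∃ V : ℕ → ℝ, (∀ n, 0 ≤ V n) ∧ Tendsto V atTop (𝓝 0) ∧
      ∀ᶠ n in atTop, ∀ f ∈ T n, ∀ x, |x| ≤ h n →
        ∫⁻ u, ENNReal.ofReal ((f u.2 - η n u.2) ^ 2) ∂(Q n x) ≤ ENNReal.ofReal (V n) := by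
  obtain ⟨c, hc⟩ := hfirst.contraction
  refine ⟨fun n => |c| * r n ^ 2, fun n => by positivity, ?_, ?_⟩
  · simpa using (hfirst.rate_tendsto.pow 2).const_mul |c|
  · filter_upwards [hc, hwin] with n hn hwn f hf x hx
    have hx' := _root_.abs_le.mp hx
    refine (hn f hf x ⟨interior_subset (hwn hx'), hx'⟩).trans (ENNReal.ofReal_le_ofReal ?_)
    exact mul_le_mul_of_nonneg_right (le_abs_self c) (sq_nonneg _)

lemma OutcomeAssumption.eventually_windowMoments {N : ℕ → Set ℝ}
    (hη : ∀ n, η n ∈ T n) (hηm : ∀ n, Measurable (η n))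
    (hwin : ∀ᶠ n in atTop, Set.Icc (-h n) (h n) ⊆ interior PX.support)
    (hN : ∀ n, window PX (h n) ⊆ N n)
    (hB : ∀ n, ∀ f ∈ T n, ∀ x ∈ N n ∩ PX.support, Integrable (adjOutcome f) (Q n x) ∧
      ∫⁻ u, ENNReal.ofReal ((adjOutcome f u - ∫ u', adjOutcome f u' ∂(Q n x)) ^ 4) ∂(Q n x)
        ≤ ENNReal.ofReal B)
    (hC : ∀ n, ∀ x ∈ PX.support \ {0}, 1 / C ≤ variance (adjOutcome (η n)) (Q n x)) :
    ∀ᶠ n in atTop, WindowMoments (Q n) (η n) (h n) B C := by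
  filter_upwards [hwin] with n hn
  have hmem : ∀ x, |x| ≤ h n → x ∈ PX.support ∧ x ∈ N n := fun x hx => by
    have hx' := _root_.abs_le.mp hx
    have := interior_subset (hn hx')
    exact ⟨this, hN n ⟨this, hx'⟩⟩
  exact
    { measurable := hηm n
      integrable := fun x hx => (hB n _ (hη n) x ⟨(hmem x hx).2, (hmem x hx).1⟩).1
      fourth := fun x hx => (hB n _ (hη n) x ⟨(hmem x hx).2, (hmem x hx).1⟩).2
      variance_ge := fun x hx hx0 => hC n x ⟨(hmem x hx).1, hx0⟩ }

lemma DerivativeAssumption.eventually_quadratic_approx [∀ n, IsMarkovKernel (Q n)]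
    (hh : IsBandwidth h)
    (hderiv : DerivativeAssumption Q T η (fun n => window PX (h n)) 3 v)
    (hadm : ∀ n, T n ⊆ Admissible (Q n)) (hη : ∀ n, η n ∈ T n)
    (hwin : ∀ᶠ n in atTop, Set.Icc (-h n) (h n) ⊆ interior PX.support) {V : ℕ → ℝ}
    (hV0 : ∀ n, 0 ≤ V n) (hV : Tendsto V atTop (𝓝 0))
    (hTV : ∀ᶠ n in atTop, ∀ f ∈ T n, ∀ x, |x| ≤ h n →
      ∫⁻ u, ENNReal.ofReal ((f u.2 - η n u.2) ^ 2) ∂(Q n x) ≤ ENNReal.ofReal (V n)) :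
    ∃ ρ V₃ : ℕ → ℝ, (∀ n, 0 ≤ ρ n) ∧ (∀ n, 0 ≤ V₃ n) ∧ Tendsto ρ atTop (𝓝 0) ∧
      Tendsto V₃ atTop (𝓝 0) ∧ ∀ᶠ n in atTop, ∀ f ∈ T n, ∃ a₀ a₁ a₂ : ℝ, |a₀| ≤ ρ n ∧
        |a₁| * h n ≤ ρ n ∧ |a₂| * h n ^ 2 ≤ ρ n ∧ ∀ y, y ≠ 0 → |y| ≤ h n →
        |∫ u, (f u.2 - η n u.2) ∂(Q n y) - (a₀ + a₁ * y + a₂ * y ^ 2)| ≤ V₃ n * h n ^ 3 := by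
  obtain ⟨hv1, c₁, hc₁⟩ := hderiv 0 (by norm_num)
  obtain ⟨hv2, c₂, hc₂⟩ := hderiv 1 (by norm_num)
  obtain ⟨hv3, c₃, hc₃⟩ := hderiv 2 (by norm_num)
  set c := |c₁| + |c₂| + |c₃| with hc
  have hlim : ∀ {f : ℕ → ℝ}, Tendsto f atTop (𝓝 0) → Tendsto (fun n => c * |f n|) atTop (𝓝 0) :=
    fun hf => by simpa using hf.abs.const_mul c
  -- The value at 0 costs √V, the first two derivatives v₁ and v₂, and the remainder v₃. Once h < 1
  -- the powers of h in the coefficient bounds can be dropped.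
  refine ⟨fun n => √(V n) + c * |v 1 n| + c * |v 2 n|, fun n => c * |v 3 n|,
    fun n => by positivity, fun n => by positivity, ?_, hlim hv3, ?_⟩
  · simpa using (hV.sqrt.add (hlim hv1)).add (hlim hv2)
  filter_upwards [hwin, hTV, hc₁, hc₂, hc₃,
    hh.tendsto_zero.eventually (gt_mem_nhds one_pos)] with n hwn hTVn h1 h2 h3 hh1 f hf
  have hwindow : ∀ y ∈ Set.Icc (-h n) (h n) \ {0}, y ∈ window PX (h n) \ {0} := fun y hy =>
    ⟨⟨interior_subset (hwn hy.1), hy.1⟩, hy.2⟩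
  have hcle : c₁ ≤ c ∧ c₂ ≤ c ∧ c₃ ≤ c := by
    refine ⟨?_, ?_, ?_⟩ <;> rw [hc] <;>
      linarith [le_abs_self c₁, le_abs_self c₂, le_abs_self c₃, abs_nonneg c₁, abs_nonneg c₂,
        abs_nonneg c₃]
  have hd : ∀ j < 3, ∀ y ∈ Set.Icc (-h n) (h n) \ {0},
      DifferentiableAt ℝ (iteratedDeriv j fun y => ∫ u, (f u.2 - η n u.2) ∂(Q n y)) y ∧
      |iteratedDeriv (j + 1) (fun y => ∫ u, (f u.2 - η n u.2) ∂(Q n y)) y| ≤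
        (fun m => c * |v m n|) (j + 1) := by
    intro j hj y hy
    have hy' := hwindow y hy
    interval_cases j
    · exact ⟨(h1 f hf y hy').1, (h1 f hf y hy').2.trans
        (mul_le_mul_of_nonneg_right hcle.1 (abs_nonneg _))⟩
    · exact ⟨(h2 f hf y hy').1, (h2 f hf y hy').2.trans
        (mul_le_mul_of_nonneg_right hcle.2.1 (abs_nonneg _))⟩
    · exact ⟨(h3 f hf y hy').1, (h3 f hf y hy').2.trans
        (mul_le_mul_of_nonneg_right hcle.2.2 (abs_nonneg _))⟩
  obtain ⟨a₀, a₁, a₂, e0, e1, e2, e3⟩ := exists_quadratic_approx_errorMean (hh.pos n)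
    (c := fun m => c * |v m n|) (hadm n hf) (hadm n (hη n)) (hV0 n) (hTVn f hf 0
      (by simpa using (hh.pos n).le)) hd
  have hp1 : 0 ≤ c * |v 1 n| := by positivity
  have hp2 : 0 ≤ c * |v 2 n| := by positivity
  have hp0 := Real.sqrt_nonneg (V n)
  have hhp := hh.pos n
  have hm : ∀ {a k m : ℝ}, |a| ≤ m → 0 ≤ k → k ≤ 1 → |a| * k ≤ m := fun ha hk hk1 =>
    (mul_le_of_le_one_right (abs_nonneg _) hk1).trans ha
  refine ⟨a₀, a₁, a₂, by linarith, ?_, ?_, e3⟩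
  · linarith [hm e1 hhp.le hh1.le]
  · linarith [hm e2 (by positivity : 0 ≤ h n ^ 2) (pow_le_one₀ hhp.le hh1.le)]

end Coverage

/-! ### Probability of missing the parameter -/

section Noncoverage

variable {d : ℕ → ℕ} {S R : ℕ} {Ω : ℕ → Type*} [∀ n, MeasurableSpace (Ω n)]
  {P : (n : ℕ) → Measure (Ω n)} [∀ n, IsProbabilityMeasure (P n)] {PX : Measure ℝ}
  [IsProbabilityMeasure PX] {Q : (n : ℕ) → Kernel ℝ (ℝ × (Fin (d n) → ℝ))}
  [∀ n, IsMarkovKernel (Q n)]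
  {W : (n : ℕ) → Fin n → Ω n → Obs (d n)} {s : (n : ℕ) → Ω n → Fin n → Fin S}
  {est : (n : ℕ) → FirstStageEstimator n (d n)} {K : ℝ → ℝ} {h τ r : ℕ → ℝ} {v : ℕ → ℕ → ℝ}
  {T : (n : ℕ) → Set ((Fin (d n) → ℝ) → ℝ)} {η : (n : ℕ) → (Fin (d n) → ℝ) → ℝ} {α : ℝ}

/-- The interval misses the RD parameter with asymptotic probability at most `α`. -/
lemma eventually_measure_notMem_rbcInterval_le (hR : 0 < R) (hα₀ : 0 < α) (hα₁ : α < 1)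
    (hsample : IsSample P PX Q W s) (hτ : ∀ n, IsRDParameter (Q n) (τ n))
    (hest : ∀ n (I : Finset (Fin n)),
      Measurable fun wz : (I → Obs (d n)) × (Fin (d n) → ℝ) => est n I wz.1 wz.2)
    (hK : IsRDKernel K) (hX : HasRunningDensity PX) (hh : IsBandwidth h)
    (hfirst : FirstStageAssumption P Q W s est T η (fun n => window PX (h n)) r)
    (hderiv : DerivativeAssumption Q T η (fun n => window PX (h n)) 3 v)
    (houtcome : OutcomeAssumption PX Q η 2) {N : ℕ → Set ℝ}
    (hN_window : ∀ n, window PX (h n) ⊆ N n)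
    (hfourth : FourthMomentAssumption Q T (fun n => N n ∩ PX.support))
    (hrate : Tendsto (fun n : ℕ => (n : ℝ) * h n ^ 7) atTop (𝓝 0)) {c : ℝ} (hc : α < c) :
    ∀ᶠ n in atTop, P n {ω | τ n ∉ rbcInterval K (h n) R α (fun i => (W n i ω).1)
      (crossOutcome (est n) (s n ω) fun i => W n i ω)} ≤ ENNReal.ofReal c := by
  obtain ⟨b, hb⟩ := hK.bounded
  have hb0 : 0 ≤ b := (hK.nonneg 0).trans (hb 0)
  obtain ⟨A, hA, hgood⟩ := exists_tendsto_measure_goodDesign hX hK hh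
  obtain ⟨C, L, q, hC, hq, hout⟩ := houtcome
  obtain ⟨B, hB⟩ := hfourth
  have hsupp := hX.support_mem_nhds
  have hwin : ∀ᶠ n in atTop, Set.Icc (-h n) (h n) ⊆ interior PX.support :=
    hh.eventually_Icc_subset (interior_mem_nhds.mpr hsupp)
  have hadm : ∀ n, η n ∈ Admissible (Q n) := fun n => hfirst.admissible n (hfirst.mem n)
  have hηm : ∀ n, Measurable (η n) := fun n => (hadm n).1
  have hw : ∀ᶠ n in atTop, WindowMoments (Q n) (η n) (h n) B C :=
    OutcomeAssumption.eventually_windowMoments hfirst.mem hηm hwin hN_window hB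
      fun n => (hout n).2.2.2.2.2
  obtain ⟨V, hV0, hV, hTV⟩ := hfirst.eventually_contraction hwin
  obtain ⟨ρ, V₃, hρ0, hV₃0, hρ, hV₃, hquad⟩ :=
    hderiv.eventually_quadratic_approx hh hfirst.admissible hfirst.mem hwin hV0 hV hTV
  have hz : 0 ≤ normalQuantile (1 - α / 2) :=
    normalQuantile_nonneg (by linarith) (by linarith)
  obtain ⟨ε, hε0, hε1, hεc⟩ := exists_gaussianReal_le_abs_lt hz
    ((gaussianReal_normalQuantile_le_abs hα₀).trans_lt hc)
  set y := normalQuantile (1 - α / 2) * (1 - ε) - ε with hy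
  -- The room left below c is shared equally between the bad event and the normal approximation.
  set gap := c - (gaussianReal 0 1).real {x | y ≤ |x|} with hgap
  have hgap0 : 0 < gap := sub_pos.mpr hεc
  have hAC : 0 < A * C := mul_pos hA hC
  -- Chosen so that δ m = ε / 4 dominates at once the terms in δ of the error bound and of the
  -- standard error bound, which do not vanish as n grows.
  set m : ℝ := 1 + S * √(A * C) + A * C * (3 + 2 / ε * S) with hm
  have hm1 : 0 < m := by positivity
  set δ : ℝ := ε / (4 * m) with hδ
  have hδ0 : 0 < δ := by positivity
  have hδm : δ * m = ε / 4 := by rw [hδ]; field_simp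
  have hδ1 : √(A * C) * (S * δ) ≤ ε / 4 := by
    rw [← hδm, hm]
    have : 0 ≤ δ * (1 + A * C * (3 + 2 / ε * S)) := by positivity
    linarith
  have hδ2 : A * C * (3 * δ + 2 / ε * (S * δ)) ≤ ε / 4 := by
    rw [← hδm, hm]
    have : 0 ≤ δ * (1 + S * √(A * C)) := by positivity
    linarith
  obtain ⟨D, hD, hbad⟩ := hsample.exists_measure_not_goodEvent_le hX hK hh hηm hest hgood hw hR
    hfirst.estimator_mem hV0 hV hTV hδ0 (half_pos hgap0)
  have hnoise := eventually_measure_stdNoise_le (y := y) hηm hK hh hA hC hgood hw (half_pos hgap0)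
  -- The undersmoothing condition: √(nh) h³ = √(n h⁷).
  have hs : Tendsto (fun n : ℕ => √(n * h n) * h n ^ 3) atTop (𝓝 0) := by
    have h1 : Tendsto (fun n : ℕ => √(n * h n ^ 7)) atTop (𝓝 0) := by simpa using hrate.sqrt
    refine h1.congr fun n => ?_
    have hp := (hh.pos n).le
    rw [show (n : ℝ) * h n ^ 7 = (n * h n) * (h n ^ 3) ^ 2 by ring,
      Real.sqrt_mul (by positivity), Real.sqrt_sq (by positivity)]
  -- Estimation error in units of the standard deviation. In the limit only the δ term survives, and
  -- it is at most ε / 4.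
  have hE1 : ∀ᶠ n : ℕ in atTop, √(A * C) * (6 * A ^ 2 * b * C * (√(n * h n) * h n ^ 3) +
      S * (δ + 18 * A * D * ρ n + 3 * A ^ 2 * b * (V₃ n * (√(n * h n) * h n ^ 3)))) ≤ ε := by
    have hlim : Tendsto (fun n : ℕ => √(A * C) * (6 * A ^ 2 * b * C * (√(n * h n) * h n ^ 3) +
        S * (δ + 18 * A * D * ρ n + 3 * A ^ 2 * b * (V₃ n * (√(n * h n) * h n ^ 3))))) atTop
        (𝓝 (√(A * C) * (6 * A ^ 2 * b * C * 0 +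
          S * (δ + 18 * A * D * 0 + 3 * A ^ 2 * b * (0 * 0))))) :=
      ((hs.const_mul _).add (((tendsto_const_nhds.add (hρ.const_mul _)).add
        ((hV₃.mul hs).const_mul _)).const_mul _)).const_mul _
    refine hlim.eventually (ge_mem_nhds ?_)
    simp only [mul_zero, zero_add, add_zero]
    linarith
  -- Loss in the squared standard error, relative to the variance. Two units of the window are at
  -- most 2 h apart, which explains |L| (2 h).
  have hE2 : ∀ᶠ n : ℕ in atTop, A * C * (2 * R * ((3 * A * b) ^ 2 * (1 + |B|)) / (n * h n) +
      3 * δ + 2 / ε * (2 * (|L| * (2 * h n)) ^ 2 * (A * (3 * A * b) ^ 2) + S * δ)) ≤ ε / 2 := by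
    have hlim : Tendsto (fun n : ℕ => A * C * (2 * R * ((3 * A * b) ^ 2 * (1 + |B|)) / (n * h n) +
        3 * δ + 2 / ε * (2 * (|L| * (2 * h n)) ^ 2 * (A * (3 * A * b) ^ 2) + S * δ))) atTop
        (𝓝 (A * C * (0 + 3 * δ +
          2 / ε * (2 * (|L| * (2 * 0)) ^ 2 * (A * (3 * A * b) ^ 2) + S * δ)))) :=
      ((((hh.tendsto_mul.const_div_atTop _).add tendsto_const_nhds).add
        (((((((hh.tendsto_zero.const_mul 2).const_mul |L|).pow 2).const_mul 2).mul_const _).add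
          tendsto_const_nhds).const_mul _))).const_mul _
    refine hlim.eventually (ge_mem_nhds ?_)
    have : A * C * (0 + 3 * δ + 2 / ε * (2 * (|L| * (2 * 0)) ^ 2 * (A * (3 * A * b) ^ 2) + S * δ)) =
      A * C * (3 * δ + 2 / ε * (S * δ)) := by ring
    rw [this]
    linarith
  filter_upwards [hbad, hnoise, hE1, hE2, hwin, hw, hquad, hh.eventually_pos] with n hbadn hnoisen
    hE1n hE2n hwinn hwn hquadn ⟨hn, hN⟩
  have hhn := hh.pos n
  obtain ⟨hint, hsmooth, hderivs, hLip, -, -⟩ := hout n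
  obtain ⟨a, a', ha, ha', hτn⟩ := (hτ n).exists_tendsto_condMean (hadm n)
    (mem_of_superset hsupp fun x hx => (hint x hx).1)
  have hsub : {ω | τ n ∉ rbcInterval K (h n) R α (fun i => (W n i ω).1)
      (crossOutcome (est n) (s n ω) fun i => W n i ω)} ⊆
      {ω | ¬ GoodEvent K (Q n) (est n) (η n) (T n) R (h n) A δ D (s n ω) fun i => W n i ω} ∪
      (fun ω i => W n i ω) ⁻¹' {w | y ≤ |stdNoise K (Q n) (η n) (h n) A w|} := by
    intro ω hω
    by_cases hg : GoodEvent K (Q n) (est n) (η n) (T n) R (h n) A δ D (s n ω) fun i => W n i ω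
    · right
      have hx := hg.design
      have hbias := hx.abs_bias_le hK hb hn hhn isOpen_interior hwinn hsmooth
        ((hderivs 2 (by simp)).1) ((hderivs 3 (by simp)).1)
        (fun x hx y hy hxy => hLip x (interior_subset hx) y (interior_subset hy) hxy) ha ha'
      rw [← hτn] at hbias
      have hdV := hx.one_le_mul_designVar hK hA hn hhn hC hwn
      have hdV0 := hx.designVar_pos hK hA hn hhn hC hwn
      refine hx.le_abs_stdNoise hdV0 hz ?_ ?_ hω
      · refine (hg.abs_localPoly_sub_le hK hb hn hhn hA.le hD.le
          (M := V₃ n * h n ^ 3) (mul_nonneg (hV₃0 n) (by positivity)) hbias hquadn).trans ?_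
        rw [show 6 * A ^ 2 * b * (C * h n ^ 3) = 6 * A ^ 2 * b * C * h n ^ 3 by ring]
        refine error_le_mul_sqrt hN hAC.le hdV rfl ?_ hE1n
        have := hρ0 n
        have := hV₃0 n
        positivity
      · refine le_trans ?_ (hg.le_stdError_sq hK hb hn hhn hR hwn (M := |L| * (2 * h n))
          (half_pos hε0) (by linarith) fun x z hx hz hxz => ?_)
        · exact sq_mul_le_of_rescaled hN hdV hdV0.le hε0 hε1 (by positivity) (by positivity)
            hδ0.le (by positivity) (by positivity) hE2n
        · have hx' := _root_.abs_le.mp hx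
          have hz' := _root_.abs_le.mp hz
          refine (hLip x (interior_subset (hwinn hx')) z (interior_subset (hwinn hz')) hxz).trans ?_
          refine mul_le_mul (le_abs_self L) ?_ (abs_nonneg _) (abs_nonneg _)
          rw [_root_.abs_le]
          constructor <;> linarith
    · exact Or.inl hg
  have hmeas : MeasurableSet {w : Fin n → Obs (d n) | y ≤ |stdNoise K (Q n) (η n) (h n) A w|} :=
    measurableSet_le measurable_const
      (measurable_abs_real.comp (measurable_stdNoise hK (hηm n) _ _))
  have hpre : P n ((fun ω i => W n i ω) ⁻¹' {w | y ≤ |stdNoise K (Q n) (η n) (h n) A w|}) ≤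
      gaussianReal 0 1 {z | y ≤ |z|} + ENNReal.ofReal (gap / 2) := by
    rw [← Measure.map_apply (measurable_pi_lambda _ fun i => hsample.measurable_obs n i) hmeas,
      hsample.map_eq n]
    exact hnoisen
  calc _ ≤ _ := (measure_mono hsub).trans (measure_union_le _ _)
    _ ≤ ENNReal.ofReal (gap / 2) +
        (ENNReal.ofReal ((gaussianReal 0 1).real {x | y ≤ |x|}) + ENNReal.ofReal (gap / 2)) := by
      refine add_le_add hbadn (hpre.trans (le_of_eq ?_))
      rw [ofReal_measureReal]
    _ = ENNReal.ofReal c := by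
      rw [← ENNReal.ofReal_add measureReal_nonneg (half_pos hgap0).le,
        ← ENNReal.ofReal_add (half_pos hgap0).le (by positivity)]
      congr 1
      rw [hgap]; ring

end Noncoverage

end FlexRD

end

theorem mainTheorem8
    {S : ℕ} (hS : 0 < S) {R : ℕ} (hR : 0 < R) {α : ℝ} (hα₀ : 0 < α) (hα₁ : α < 1)
    (d : ℕ → ℕ) (Ω : ℕ → Type*) [∀ n, MeasurableSpace (Ω n)]
    (P : (n : ℕ) → Measure (Ω n)) [∀ n, IsProbabilityMeasure (P n)]
    (PX : Measure ℝ) [IsProbabilityMeasure PX]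
    (Q : (n : ℕ) → Kernel ℝ (ℝ × (Fin (d n) → ℝ))) [∀ n, IsMarkovKernel (Q n)]
    (W : (n : ℕ) → Fin n → Ω n → FlexRD.Obs (d n)) (s : (n : ℕ) → Ω n → Fin n → Fin S)
    (hsample : FlexRD.IsSample P PX Q W s)
    (τ : ℕ → ℝ) (hτ : ∀ n, FlexRD.IsRDParameter (Q n) (τ n))
    (est : (n : ℕ) → FlexRD.FirstStageEstimator n (d n))
    (hest : ∀ n (I : Finset (Fin n)),
      Measurable fun wz : (I → FlexRD.Obs (d n)) × (Fin (d n) → ℝ) => est n I wz.1 wz.2)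
    (K : ℝ → ℝ) (hK : FlexRD.IsRDKernel K)
    (hX : FlexRD.HasRunningDensity PX)
    (h : ℕ → ℝ) (hh : FlexRD.IsBandwidth h)
    (T : (n : ℕ) → Set ((Fin (d n) → ℝ) → ℝ)) (ηbar : (n : ℕ) → (Fin (d n) → ℝ) → ℝ)
    (r : ℕ → ℝ)
    (hfirst : FlexRD.FirstStageAssumption P Q W s est T ηbar
      (fun n => FlexRD.window PX (h n)) r)
    (v : ℕ → ℕ → ℝ)
    (hderiv : FlexRD.DerivativeAssumption Q T ηbar (fun n => FlexRD.window PX (h n)) 3 v)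
    (houtcome : FlexRD.OutcomeAssumption PX Q ηbar 2)
    (N : ℕ → Set ℝ) (hN_open : ∀ n, IsOpen (N n))
    (hN_window : ∀ n, FlexRD.window PX (h n) ⊆ N n)
    (r' : ℕ → ℝ)
    (hfirst_N : FlexRD.FirstStageAssumption P Q W s est T ηbar
      (fun n => N n ∩ PX.support) r')
    (hfourth : FlexRD.FourthMomentAssumption Q T (fun n => N n ∩ PX.support))
    (hcross : FlexRD.CrossTermAssumption P W s est ηbar K h R 2)
    (hrate : Tendsto (fun n : ℕ => (n : ℝ) * h n ^ 7) atTop (𝓝 0)) :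
    ∃ o : ℕ → ℝ, Tendsto o atTop (𝓝 0) ∧ ∀ n,
      1 - α + o n ≤ (P n).real {ω | τ n ∈ FlexRD.rbcInterval K (h n) R α
        (fun i => (W n i ω).1)
        (FlexRD.crossOutcome (est n) (s n ω) (fun i => W n i ω))} := by
  set p : ℕ → ℝ := fun n => (P n).real {ω | τ n ∈ FlexRD.rbcInterval K (h n) R α
    (fun i => (W n i ω).1) (FlexRD.crossOutcome (est n) (s n ω) (fun i => W n i ω))} with hp
  -- The shortfall of the coverage; that it vanishes says exactly that the liminf of the coverage is
  -- at least 1 - α.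
  refine ⟨fun n => min 0 (p n - (1 - α)), ?_, fun n => ?_⟩
  · rw [Metric.tendsto_atTop']
    intro ε hε
    have hmiss := FlexRD.eventually_measure_notMem_rbcInterval_le hR hα₀ hα₁ hsample hτ hest
      hK hX hh
      hfirst hderiv houtcome hN_window hfourth hrate (c := α + ε / 2) (by linarith)
    obtain ⟨n₀, hn₀⟩ := eventually_atTop.mp hmiss
    refine ⟨n₀, fun n hn => ?_⟩
    have hcover : 1 - (α + ε / 2) ≤ p n := by
      have h1 := hn₀ n hn.le
      set E := {ω | τ n ∈ FlexRD.rbcInterval K (h n) R α (fun i => (W n i ω).1)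
        (FlexRD.crossOutcome (est n) (s n ω) (fun i => W n i ω))} with hE
      have h2 : (P n).real Eᶜ ≤ α + ε / 2 := ENNReal.toReal_le_of_le_ofReal (by linarith) h1
      -- Subadditivity gives P(E) ≥ 1 - P(Eᶜ) without measurability of the coverage event.
      have h3 := measureReal_union_le (μ := P n) E Eᶜ
      rw [Set.union_compl_self, probReal_univ] at h3
      have h4 : p n = (P n).real E := rfl
      linarith
    rw [Real.dist_eq, sub_zero, abs_of_nonpos (min_le_left _ _), neg_lt]
    exact lt_min (by linarith) (by linarith)
  · have := min_le_right 0 (p n - (1 - α))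
    have h1 : p n = (P n).real {ω | τ n ∈ FlexRD.rbcInterval K (h n) R α
      (fun i => (W n i ω).1) (FlexRD.crossOutcome (est n) (s n ω) (fun i => W n i ω))} := rfl
    simp only
    linarith
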